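/- Let $n$ be a positive even integer. Let $\mathcal K_n$ be the Nichols Hopf algebra: the complex algebra with generators $K,\xi_1,\dots,\xi_n$ and relations $K^2=1$, $\xi_i^2=0$, $K\xi_i=-\xi_iK$, $\xi_i\xi_j=-\xi_j\xi_i$, with $$\Delta(K)=K\otimes K,\quad \Delta(\xi_i)=K\otimes\xi_i+\xi_i\otimes 1,\quad \varepsilon(K)=1,\quad \varepsilon(\xi_i)=0,\quad S(K)=K,\quad S(\xi_i)=-K\xi_i .$$ Let $D=D\mathcal K_n=\mathcal K_n^{*\mathrm{cop}}\bowtie\mathcal K_n$ be its Drinfeld double, that is, the vector space $\mathcal K_n^*\otimes\mathcal K_n$ with product $$(\phi\otimes h)(\phi'\otimes h')=\sum\phi\,\phi'\big(S^{-1}(h_{(3)})\,(-)\,h_{(1)}\big)\otimes h_{(2)}h',$$ with comultiplication, counit and antipode determined by those of its Hopf subalgebras $\mathcal K_n^{*\mathrm{cop}}$ and $\mathcal K_n$, and with the universal $R$-matrix $R=\sum_i(\varepsilon\otimes e_i)\otimes(e^i\otimes 1)$, where $(e_i)$ and $(e^i)$ are dual bases of $\mathcal K_n$ and $\mathcal K_n^*$;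 let $R_{21}$ be its flip. Let $\Lambda\in D$ and $\lambda\in D^*$ be nonzero left integrals (so $x\Lambda=\varepsilon(x)\Lambda$ and $\sum x_{(1)}\lambda(x_{(2)})=\lambda(x)1$ for all $x\in D$). Let $v\in D$ be a ribbon element, i.e. a central element with $\Delta(v)=(R_{21}R)^{-1}(v\otimes v)$, $\varepsilon(v)=1$ and $S(v)=v$. Let $G\in D$ be an invertible element with $S^2(x)=GxG^{-1}$ for all $x\in D$. Let $$\mathrm{Hig}(D)=\Big\{\sum S(\Lambda_{(2)})\,x\,\Lambda_{(1)}G^{-1} : x\in D\Big\}$$ be the Higman ideal, and define the Lyubashenko--Majid maps by $$S_{LM}(x)=(\mathrm{id}\otimes\lambda)\big(R^{-1}(1\otimes x)R_{21}^{-1}\big),\qquad T_{LM}(x)=v\,x .$$ Then $S_{LM}$ and $T_{LM}$ define a representation of $\mathrm{SL}(2,\mathbb Z)$ on $\mathrm{Hig}(D)$: there is a homomorphism $\rho:\mathrm{SL}(2,\mathbb Z)\to\mathrm{GL}(\mathrm{Hig}(D))$ such that $\rho\begin{pmatrix}0&-1\\1&0\end{pmatrix}=c\,S_{LM}|_{\mathrm{Hig}(D)}$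 for some nonzero scalar $c$ and $\rho\begin{pmatrix}1&1\\0&1\end{pmatrix}=T_{LM}|_{\mathrm{Hig}(D)}$. For every such $\rho$, both the kernel of $\rho$ and the kernel of the induced projective representation $\mathrm{SL}(2,\mathbb Z)\to\mathrm{GL}(\mathrm{Hig}(D))/\mathbb C^\times$ are congruence subgroups of level $2$; that is, $2$ is the least positive integer $N$ for which the kernel contains the principal congruence subgroup $\Gamma(N)$. -/

import Mathlib

open scoped TensorProduct

set_option linter.unusedSectionVars false

noncomputable section

/-- The generators `K, ξ₁, …, ξₙ` of the Nichols Hopf algebra. -/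
inductive NicholsGen (n : ℕ) : Type
  | K : NicholsGen n
  | xi (i : Fin n) : NicholsGen n

/-- The defining relations `K² = 1`, `ξᵢ² = 0`, `K ξᵢ = -ξᵢ K`, `ξᵢ ξⱼ = -ξⱼ ξᵢ`. -/
inductive NicholsRel (n : ℕ) :
    FreeAlgebra ℂ (NicholsGen n) → FreeAlgebra ℂ (NicholsGen n) → Prop
  | K_sq : NicholsRel n (FreeAlgebra.ι ℂ .K * FreeAlgebra.ι ℂ .K) 1
  | xi_sq (i : Fin n) :
      NicholsRel n (FreeAlgebra.ι ℂ (.xi i) * FreeAlgebra.ι ℂ (.xi i)) 0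
  | K_xi (i : Fin n) :
      NicholsRel n (FreeAlgebra.ι ℂ .K * FreeAlgebra.ι ℂ (.xi i))
        (-(FreeAlgebra.ι ℂ (.xi i) * FreeAlgebra.ι ℂ .K))
  | xi_xi (i j : Fin n) :
      NicholsRel n (FreeAlgebra.ι ℂ (.xi i) * FreeAlgebra.ι ℂ (.xi j))
        (-(FreeAlgebra.ι ℂ (.xi j) * FreeAlgebra.ι ℂ (.xi i)))

/-- The Nichols Hopf algebra `𝒦ₙ` over `ℂ`, by generators and relations. -/
def NicholsAlgebra (n : ℕ) : Type := RingQuot (NicholsRel n)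

namespace NicholsAlgebra

variable {n : ℕ}

instance : Ring (NicholsAlgebra n) := inferInstanceAs (Ring (RingQuot (NicholsRel n)))

instance : Algebra ℂ (NicholsAlgebra n) :=
  inferInstanceAs (Algebra ℂ (RingQuot (NicholsRel n)))

/-- The class of a generator in `𝒦ₙ`. -/
def gen (g : NicholsGen n) : NicholsAlgebra n :=
  RingQuot.mkAlgHom ℂ (NicholsRel n) (FreeAlgebra.ι ℂ g)

/-- The generator `K` of `𝒦ₙ`. -/
def K (n : ℕ) : NicholsAlgebra n := gen .K

/-- The generator `ξᵢ` of `𝒦ₙ`. -/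
def xi (i : Fin n) : NicholsAlgebra n := gen (.xi i)

theorem K_mul_K : K n * K n = 1 := by
  have h := RingQuot.mkAlgHom_rel ℂ (NicholsRel.K_sq (n := n))
  rw [map_mul, map_one] at h
  exact h

theorem xi_mul_self (i : Fin n) : xi i * xi i = 0 := by
  have h := RingQuot.mkAlgHom_rel ℂ (NicholsRel.xi_sq i)
  rw [map_mul, map_zero] at h
  exact h

theorem K_mul_xi (i : Fin n) : K n * xi i = -(xi i * K n) := by
  have h := RingQuot.mkAlgHom_rel ℂ (NicholsRel.K_xi i)
  rw [map_neg, map_mul, map_mul] at h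
  exact h

theorem xi_mul_xi (i j : Fin n) : xi i * xi j = -(xi j * xi i) := by
  have h := RingQuot.mkAlgHom_rel ℂ (NicholsRel.xi_xi i j)
  rw [map_neg, map_mul, map_mul] at h
  exact h

/-- The universal property of `𝒦ₙ`. -/
def lift {A : Type*} [Ring A] [Algebra ℂ A] (k : A) (x : Fin n → A) (hkk : k * k = 1)
    (hxx : ∀ i, x i * x i = 0) (hkx : ∀ i, k * x i = -(x i * k))
    (hx : ∀ i j, x i * x j = -(x j * x i)) : NicholsAlgebra n →ₐ[ℂ] A :=
  RingQuot.liftAlgHom ℂ ⟨FreeAlgebra.lift ℂ (fun g => match g with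
    | .K => k
    | .xi i => x i), by
      intro a b h
      cases h <;> simp [hkk, hxx, hkx]
      exact hx _ _⟩

section lift

variable {A : Type*} [Ring A] [Algebra ℂ A] (k : A) (x : Fin n → A) (hkk : k * k = 1)
    (hxx : ∀ i, x i * x i = 0) (hkx : ∀ i, k * x i = -(x i * k))
    (hx : ∀ i j, x i * x j = -(x j * x i))

@[simp] theorem lift_K : lift k x hkk hxx hkx hx (K n) = k := by
  unfold lift K gen
  erw [RingQuot.liftAlgHom_mkAlgHom_apply]
  simp

@[simp] theorem lift_xi (i : Fin n) : lift k x hkk hxx hkx hx (xi i) = x i := by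
  unfold lift xi gen
  erw [RingQuot.liftAlgHom_mkAlgHom_apply]
  simp

theorem algHom_ext {B : Type*} [Semiring B] [Algebra ℂ B] {f g : NicholsAlgebra n →ₐ[ℂ] B}
    (hK : f (K n) = g (K n)) (hxi : ∀ i, f (xi i) = g (xi i)) : f = g := by
  apply RingQuot.ringQuot_ext'
  apply FreeAlgebra.hom_ext
  funext t
  cases t with
  | K => exact hK
  | xi i => exact hxi i

end lift

/-- A subalgebra of `𝒦ₙ` that contains the generators is everything. -/
theorem subalgebra_eq_top (S : Subalgebra ℂ (NicholsAlgebra n)) (hK : K n ∈ S)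
    (hxi : ∀ i, xi i ∈ S) : S = ⊤ := by
  let f : NicholsAlgebra n →ₐ[ℂ] S :=
    lift ⟨K n, hK⟩ (fun i => ⟨xi i, hxi i⟩) (Subtype.ext K_mul_K)
      (fun i => Subtype.ext (xi_mul_self i)) (fun i => Subtype.ext (K_mul_xi i))
      (fun i j => Subtype.ext (xi_mul_xi i j))
  have h : S.val.comp f = AlgHom.id ℂ _ := by
    apply algHom_ext <;> simp [f]
  rw [eq_top_iff]
  rintro x -
  have := congrArg (fun φ => φ x) h
  simp only [AlgHom.comp_apply, AlgHom.id_apply] at this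
  rw [← this]
  exact (f x).2

/-- `Δ(K) = K ⊗ K`, `Δ(ξᵢ) = K ⊗ ξᵢ + ξᵢ ⊗ 1`. -/
def comulHom (n : ℕ) : NicholsAlgebra n →ₐ[ℂ] NicholsAlgebra n ⊗[ℂ] NicholsAlgebra n :=
  lift (K n ⊗ₜ K n) (fun i => K n ⊗ₜ xi i + xi i ⊗ₜ 1)
    (by simp [K_mul_K, Algebra.TensorProduct.one_def])
    (fun i => by
      simp [mul_add, add_mul, K_mul_K, xi_mul_self, K_mul_xi, TensorProduct.neg_tmul])
    (fun i => by
      simp [mul_add, add_mul, K_mul_K, K_mul_xi, TensorProduct.neg_tmul,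
        TensorProduct.tmul_neg, add_comm])
    (fun i j => by
      have h := xi_mul_xi i j
      simp only [mul_add, add_mul, Algebra.TensorProduct.tmul_mul_tmul, K_mul_K, K_mul_xi, h,
        mul_one, one_mul, TensorProduct.neg_tmul, TensorProduct.tmul_neg]
      abel)

/-- `ε(K) = 1`, `ε(ξᵢ) = 0`. -/
def counitHom (n : ℕ) : NicholsAlgebra n →ₐ[ℂ] ℂ :=
  lift 1 (fun _ => 0) (by simp) (by simp) (by simp) (by simp)

/-- The anti-homomorphism with `S(K) = K`, `S(ξᵢ) = -K ξᵢ`. -/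
def antipodeHom (n : ℕ) : NicholsAlgebra n →ₐ[ℂ] (NicholsAlgebra n)ᵐᵒᵖ :=
  lift (.op (K n)) (fun i => .op (-(K n * xi i)))
    (by rw [← MulOpposite.op_mul, K_mul_K, MulOpposite.op_one])
    (fun i => by
      rw [← MulOpposite.op_mul, neg_mul_neg, K_mul_xi, neg_mul_neg, mul_assoc,
        ← mul_assoc (K n), K_mul_xi, neg_mul, mul_neg, mul_assoc, ← mul_assoc, xi_mul_self]
      simp)
    (fun i => by
      rw [← MulOpposite.op_mul, ← MulOpposite.op_mul, ← MulOpposite.op_neg]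
      congr 1
      rw [K_mul_xi, neg_neg, mul_assoc, K_mul_K, ← mul_assoc, K_mul_xi, neg_mul, mul_assoc,
        K_mul_K, neg_neg])
    (fun i j => by
      rw [← MulOpposite.op_mul, ← MulOpposite.op_mul, ← MulOpposite.op_neg]
      congr 1
      have key : ∀ a b : Fin n, K n * xi a * (K n * xi b) = -(xi a * xi b) := by
        intro a b
        rw [K_mul_xi, neg_mul, mul_assoc, ← mul_assoc (K n), K_mul_K, one_mul]
      rw [neg_mul_neg, neg_mul_neg, key, key, xi_mul_xi j i])

instance : Bialgebra ℂ (NicholsAlgebra n) :=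
  Bialgebra.ofAlgHom (comulHom n) (counitHom n)
    (by
      apply algHom_ext
      · simp [comulHom]
      · intro i
        simp [comulHom, TensorProduct.tmul_add, TensorProduct.add_tmul,
          Algebra.TensorProduct.one_def, add_assoc])
    (by apply algHom_ext <;> simp [comulHom, counitHom])
    (by apply algHom_ext <;> simp [comulHom, counitHom])

theorem comul_K : Coalgebra.comul (R := ℂ) (K n) = K n ⊗ₜ K n := lift_K ..
theorem comul_xi (i : Fin n) :
    Coalgebra.comul (R := ℂ) (xi i) = K n ⊗ₜ xi i + xi i ⊗ₜ 1 := lift_xi ..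
theorem counit_K : Coalgebra.counit (R := ℂ) (K n) = 1 := lift_K ..
theorem counit_xi (i : Fin n) : Coalgebra.counit (R := ℂ) (xi i) = 0 := lift_xi ..

/-- The antipode of `𝒦ₙ` as a linear map. -/
def antipodeLin (n : ℕ) : NicholsAlgebra n →ₗ[ℂ] NicholsAlgebra n :=
  (MulOpposite.opLinearEquiv ℂ).symm.toLinearMap ∘ₗ (antipodeHom n).toLinearMap

theorem antipodeLin_mul (x y : NicholsAlgebra n) :
    antipodeLin n (x * y) = antipodeLin n y * antipodeLin n x := by
  simp [antipodeLin]

theorem antipodeLin_one : antipodeLin n 1 = 1 := by simp [antipodeLin]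
theorem antipodeLin_K : antipodeLin n (K n) = K n := by simp [antipodeLin, antipodeHom]
theorem antipodeLin_xi (i : Fin n) : antipodeLin n (xi i) = -(K n * xi i) := by
  simp [antipodeLin, antipodeHom]

theorem antipode_left (x : NicholsAlgebra n) :
    LinearMap.mul' ℂ _ ((antipodeLin n).rTensor _ (Coalgebra.comul (R := ℂ) x)) =
      algebraMap ℂ _ (Coalgebra.counit x) := by
  let S : Subalgebra ℂ (NicholsAlgebra n) :=
    { carrier := {x | LinearMap.mul' ℂ _ ((antipodeLin n).rTensor _ (Coalgebra.comul (R := ℂ) x))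
        = algebraMap ℂ _ (Coalgebra.counit x)}
      mul_mem' := by
        intro a b ha hb
        simp only [Set.mem_ofPred_eq, Bialgebra.comul_mul, Bialgebra.counit_mul, map_mul] at *
        have key : ∀ s t : NicholsAlgebra n ⊗[ℂ] NicholsAlgebra n,
            ∀ c : ℂ, LinearMap.mul' ℂ _ ((antipodeLin n).rTensor _ s) = algebraMap ℂ _ c →
            LinearMap.mul' ℂ _ ((antipodeLin n).rTensor _ (s * t)) =
              algebraMap ℂ _ c * LinearMap.mul' ℂ _ ((antipodeLin n).rTensor _ t) := by
          intro s t c hs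
          induction t with
          | zero => simp
          | add t u ht hu => rw [mul_add, map_add, map_add, ht, hu, map_add, map_add, mul_add]
          | tmul p q =>
            have : ∀ s : NicholsAlgebra n ⊗[ℂ] NicholsAlgebra n,
                LinearMap.mul' ℂ _ ((antipodeLin n).rTensor _ (s * p ⊗ₜ q)) =
                antipodeLin n p * LinearMap.mul' ℂ _ ((antipodeLin n).rTensor _ s) * q := by
              intro s
              induction s with
              | zero => simp
              | add t u ht hu =>
                rw [add_mul, map_add, map_add, ht, hu, map_add, map_add, mul_add, add_mul]
              | tmul u v => simp [antipodeLin_mul, mul_assoc]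
            rw [this, hs, ← Algebra.commutes, mul_assoc]
            simp
        rw [key _ _ _ ha, hb]
      add_mem' := by
        intro a b ha hb
        simp only [Set.mem_ofPred_eq, map_add] at *
        rw [ha, hb]
      algebraMap_mem' := by
        intro r
        simp [Algebra.algebraMap_eq_smul_one,
          antipodeLin_one, Algebra.TensorProduct.one_def] }
  have hS : S = ⊤ := by
    apply subalgebra_eq_top
    · change _ = _
      simp [comul_K, counit_K, antipodeLin_K, K_mul_K]
    · intro i
      change _ = _
      simp [comul_xi, counit_xi, antipodeLin_K, antipodeLin_xi]
  have : x ∈ S := by rw [hS]; trivial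
  exact this

theorem antipode_right (x : NicholsAlgebra n) :
    LinearMap.mul' ℂ _ ((antipodeLin n).lTensor _ (Coalgebra.comul (R := ℂ) x)) =
      algebraMap ℂ _ (Coalgebra.counit x) := by
  let S : Subalgebra ℂ (NicholsAlgebra n) :=
    { carrier := {x | LinearMap.mul' ℂ _ ((antipodeLin n).lTensor _ (Coalgebra.comul (R := ℂ) x))
        = algebraMap ℂ _ (Coalgebra.counit x)}
      mul_mem' := by
        intro a b ha hb
        simp only [Set.mem_ofPred_eq, Bialgebra.comul_mul, Bialgebra.counit_mul, map_mul] at *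
        have key : ∀ s t : NicholsAlgebra n ⊗[ℂ] NicholsAlgebra n,
            ∀ c : ℂ, LinearMap.mul' ℂ _ ((antipodeLin n).lTensor _ t) = algebraMap ℂ _ c →
            LinearMap.mul' ℂ _ ((antipodeLin n).lTensor _ (s * t)) =
              LinearMap.mul' ℂ _ ((antipodeLin n).lTensor _ s) * algebraMap ℂ _ c := by
          intro s t c ht
          induction s with
          | zero => simp
          | add s u hs hu => rw [add_mul, map_add, map_add, hs, hu, map_add, map_add, add_mul]
          | tmul p q =>
            have : ∀ t : NicholsAlgebra n ⊗[ℂ] NicholsAlgebra n,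
                LinearMap.mul' ℂ _ ((antipodeLin n).lTensor _ (p ⊗ₜ q * t)) =
                p * LinearMap.mul' ℂ _ ((antipodeLin n).lTensor _ t) * antipodeLin n q := by
              intro t
              induction t with
              | zero => simp
              | add t u ht hu =>
                rw [mul_add, map_add, map_add, ht, hu, map_add, map_add, mul_add, add_mul]
              | tmul u v => simp [antipodeLin_mul, mul_assoc]
            rw [this, ht, mul_assoc, Algebra.commutes, ← mul_assoc]
            simp
        rw [key _ _ _ hb, ha]
      add_mem' := by
        intro a b ha hb
        simp only [Set.mem_ofPred_eq, map_add] at *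
        rw [ha, hb]
      algebraMap_mem' := by
        intro r
        simp [Algebra.algebraMap_eq_smul_one,
          antipodeLin_one, Algebra.TensorProduct.one_def] }
  have hS : S = ⊤ := by
    apply subalgebra_eq_top
    · change _ = _
      simp [comul_K, counit_K, antipodeLin_K, K_mul_K]
    · intro i
      change _ = _
      simp [comul_xi, counit_xi, antipodeLin_one, antipodeLin_xi, ← mul_assoc, K_mul_K]
  have : x ∈ S := by rw [hS]; trivial
  exact this

instance : HopfAlgebra ℂ (NicholsAlgebra n) where
  antipode := antipodeLin n
  mul_antipode_rTensor_comul := LinearMap.ext antipode_left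
  mul_antipode_lTensor_comul := LinearMap.ext antipode_right

/-- `S⁴ = id` on `𝒦ₙ`. -/
theorem antipodeLin_four (x : NicholsAlgebra n) :
    antipodeLin n (antipodeLin n (antipodeLin n (antipodeLin n x))) = x := by
  have h2 : ∀ i, antipodeLin n (antipodeLin n (xi i)) = -xi i := by
    intro i
    rw [antipodeLin_xi, map_neg, antipodeLin_mul, antipodeLin_K, antipodeLin_xi, neg_mul,
      neg_neg, K_mul_xi, neg_mul, mul_assoc, K_mul_K, mul_one]
  let S : Subalgebra ℂ (NicholsAlgebra n) :=
    { carrier := {x | antipodeLin n (antipodeLin n (antipodeLin n (antipodeLin n x))) = x}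
      mul_mem' := by
        intro a b ha hb
        simp only [Set.mem_ofPred_eq, antipodeLin_mul] at *
        rw [ha, hb]
      add_mem' := by
        intro a b ha hb
        simp only [Set.mem_ofPred_eq, map_add] at *
        rw [ha, hb]
      algebraMap_mem' := by
        intro r
        simp [Algebra.algebraMap_eq_smul_one, antipodeLin_one] }
  have hS : S = ⊤ := by
    apply subalgebra_eq_top
    · change _ = _
      simp [antipodeLin_K]
    · intro i
      change _ = _
      rw [h2, map_neg, map_neg, h2, neg_neg]
  have : x ∈ S := by rw [hS]; trivial
  exact this

theorem span_mul_prod_le (l : List (NicholsGen n)) (g : NicholsGen n) (hg : g ∈ l) :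
    Submodule.span ℂ {gen g} * (l.map fun h => Submodule.span ℂ {1, gen h}).prod ≤
      (l.map fun h => Submodule.span ℂ {1, gen h}).prod := by
  have hself : ∀ g : NicholsGen n, Submodule.span ℂ {gen g} * Submodule.span ℂ {1, gen g} ≤
      Submodule.span ℂ {1, gen g} := by
    intro g
    rw [Submodule.span_mul_span, Submodule.span_le]
    rintro _ ⟨a, rfl, b, rfl | rfl, rfl⟩
    · simpa using Submodule.subset_span (by simp)
    · cases g with
      | K =>
        have h : gen .K * gen .K = (1 : NicholsAlgebra n) := K_mul_K
        simp only [h]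
        exact Submodule.subset_span (by simp)
      | xi i =>
        have h : gen (.xi i) * gen (.xi i) = (0 : NicholsAlgebra n) := xi_mul_self i
        simp only [h]
        exact Submodule.zero_mem _
  have hcomm : ∀ g h : NicholsGen n, g ≠ h → gen g * gen h = -(gen h * gen g) := by
    intro g h hne
    cases g <;> cases h
    · exact absurd rfl hne
    · exact K_mul_xi _
    · exact (neg_eq_iff_eq_neg.mpr (K_mul_xi _)).symm
    · exact xi_mul_xi _ _
  have hswap : ∀ g h : NicholsGen n, g ≠ h →
      Submodule.span ℂ {gen g} * Submodule.span ℂ {1, gen h} ≤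
        Submodule.span ℂ {1, gen h} * Submodule.span ℂ {gen g} := by
    intro g h hne
    rw [Submodule.span_mul_span, Submodule.span_mul_span, Submodule.span_le]
    rintro _ ⟨a, rfl, b, rfl | rfl, rfl⟩
    · exact Submodule.subset_span ⟨1, by simp, _, rfl, by simp⟩
    · simp only [hcomm g h hne]
      exact Submodule.neg_mem _ (Submodule.subset_span ⟨gen h, by simp, _, rfl, rfl⟩)
  induction l with
  | nil => simp at hg
  | cons h l ih =>
    rw [List.map_cons, List.prod_cons, ← mul_assoc]
    by_cases hgh : g = h
    · subst hgh
      exact mul_le_mul' (hself g) le_rfl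
    · have hgl : g ∈ l := by simpa [hgh] using hg
      refine (mul_le_mul' (hswap g h hgh) le_rfl).trans ?_
      rw [mul_assoc]
      exact mul_le_mul' le_rfl (ih hgl)

instance : Module.Finite ℂ (NicholsAlgebra n) := by
  let l : List (NicholsGen n) := .K :: (List.finRange n).map .xi
  let P : Submodule ℂ (NicholsAlgebra n) :=
    (l.map fun h => Submodule.span ℂ {1, gen h}).prod
  have hfg : ∀ l : List (NicholsGen n),
      ((l.map fun h => Submodule.span ℂ ({1, gen h} : Set (NicholsAlgebra n))).prod).FG ∧
      (1 : NicholsAlgebra n) ∈ (l.map fun h => Submodule.span ℂ {1, gen h}).prod := by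
    intro l
    induction l with
    | nil => 
      refine ⟨?_, ?_⟩
      · rw [List.map_nil, List.prod_nil, Submodule.one_eq_span]
        exact Submodule.fg_span (by simp)
      · rw [List.map_nil, List.prod_nil]
        exact Submodule.one_le.mp le_rfl
    | cons h l ih =>
      rw [List.map_cons, List.prod_cons]
      refine ⟨Submodule.FG.mul (Submodule.fg_span (by simp)) ih.1, ?_⟩
      have h1 := Submodule.mul_mem_mul
        (Submodule.subset_span (s := {1, gen h}) (R := ℂ) (Set.mem_insert _ _)) ih.2
      rwa [one_mul] at h1
  let S : Subalgebra ℂ (NicholsAlgebra n) :=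
    { carrier := {x | ∀ p ∈ P, x * p ∈ P}
      mul_mem' := fun {a b} ha hb p hp => by rw [mul_assoc]; exact ha _ (hb _ hp)
      add_mem' := fun {a b} ha hb p hp => by rw [add_mul]; exact P.add_mem (ha _ hp) (hb _ hp)
      algebraMap_mem' := fun r p hp => by
        rw [← Algebra.smul_def]; exact P.smul_mem _ hp }
  have hgen : ∀ g ∈ l, gen g ∈ S := fun g hg p hp =>
    span_mul_prod_le l g hg (Submodule.mul_mem_mul (Submodule.subset_span rfl) hp)
  have hS : S = ⊤ := subalgebra_eq_top S (hgen _ (by simp [l])) (fun i => hgen _ (by simp [l]))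
  refine ⟨?_⟩
  have : (⊤ : Submodule ℂ (NicholsAlgebra n)) = P := by
    symm
    rw [eq_top_iff]
    rintro x -
    have hx : x ∈ S := by rw [hS]; trivial
    simpa using hx 1 (hfg l).2
  rw [this]
  exact (hfg l).1

end NicholsAlgebra

/-- A two-sided compositional inverse of the antipode. -/
class AntipodeInverse (k H : Type*) [Field k] [Ring H] [HopfAlgebra k H] where
  /-- The inverse antipode `S⁻¹`. -/
  inv : H →ₗ[k] H
  inv_antipode : ∀ x, inv (HopfAlgebra.antipode k x) = x
  antipode_inv : ∀ x, HopfAlgebra.antipode k (inv x) = x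

/-- The underlying space `H^* ⊗ H` of the Drinfeld double. The dual `H^*` carries the
convolution product `(φ ψ)(x) = ∑ φ(x₍₁₎) ψ(x₍₂₎)` of `WithConv (H →ₗ[k] k)`. -/
def DrinfeldDouble (k H : Type*) [Field k] [Ring H] [HopfAlgebra k H] : Type _ :=
  WithConv (H →ₗ[k] k) ⊗[k] H

namespace DrinfeldDouble

open Coalgebra (comul counit)
open HopfAlgebra WithConv TensorProduct

section inverse

variable {k H : Type*} [Field k] [Ring H] [HopfAlgebra k H]

theorem comul_antipode (x : H) :
    comul (R := k) (antipode k x) =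
      map (antipode k) (antipode k) (TensorProduct.comm k H H (comul x)) := by
  have hR := LinearMap.comul_right_inv (R := k) (C := H)
  have hL : toConv (map (antipode k) (antipode k) ∘ₗ (TensorProduct.comm k H H).toLinearMap ∘ₗ
      (comul : H →ₗ[k] H ⊗[k] H)) * toConv (comul : H →ₗ[k] H ⊗[k] H) = 1 := by
    have h4 : (TensorProduct.assoc k H H (H ⊗[k] H)).symm.toLinearMap ∘ₗ
        map .id (TensorProduct.assoc k H H H).toLinearMap ∘ₗ
        map .id (map comul .id) ∘ₗ map .id comul ∘ₗ comul =
        map comul comul ∘ₗ (comul : H →ₗ[k] H ⊗[k] H) := by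
      simp [coassoc_simps]
    apply WithConv.ext
    simp only [LinearMap.convMul_def, LinearMap.convOne_def, ofConv_toConv]
    have h5 : map (map (antipode k) (antipode k) ∘ₗ (TensorProduct.comm k H H).toLinearMap ∘ₗ
        comul) (comul : H →ₗ[k] H ⊗[k] H) =
        map (map (antipode k) (antipode k) ∘ₗ (TensorProduct.comm k H H).toLinearMap) .id ∘ₗ
        map comul comul := by
      rw [← TensorProduct.map_comp]
      rfl
    rw [h5, LinearMap.comp_assoc, ← h4]
    have h6 : ∀ t : H ⊗[k] (H ⊗[k] H), LinearMap.mul' k (H ⊗[k] H)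
        (map (map (antipode k) (antipode k) ∘ₗ (TensorProduct.comm k H H).toLinearMap) .id
          ((TensorProduct.assoc k H H (H ⊗[k] H)).symm
            (map .id (TensorProduct.assoc k H H H).toLinearMap
              (map .id (map comul .id) t)))) =
        (TensorProduct.mk k H H 1 ∘ₗ LinearMap.mul' k H ∘ₗ map (antipode k)
          ((TensorProduct.lid k H).toLinearMap ∘ₗ map counit .id)) t := by
      intro t
      induction t with
      | zero => simp
      | add a b ha hb => simp only [map_add, ha, hb]
      | tmul a s =>
        induction s with
        | zero => simp
        | add c d hc hd => simp only [tmul_add, map_add, hc, hd]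
        | tmul b d =>
          have h7 : ∀ u : H ⊗[k] H, LinearMap.mul' k (H ⊗[k] H)
              (map (map (antipode k) (antipode k) ∘ₗ
                  (TensorProduct.comm k H H).toLinearMap) .id
                ((TensorProduct.assoc k H H (H ⊗[k] H)).symm
                  (a ⊗ₜ ((TensorProduct.assoc k H H H) (u ⊗ₜ d))))) =
              LinearMap.mul' k H ((antipode k).rTensor H u) ⊗ₜ (antipode k a * d) := by
            intro u
            induction u with
            | zero => simp
            | add c d hc hd => simp only [tmul_add, add_tmul, map_add, hc, hd]
            | tmul p q => simp
          simp only [map_tmul, LinearMap.id_apply, LinearEquiv.coe_coe, h7,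
            mul_antipode_rTensor_comul_apply]
          simp [Algebra.algebraMap_eq_smul_one, smul_tmul]
    ext x
    simp only [LinearMap.comp_apply, LinearEquiv.coe_coe, h6]
    have h9 : map (antipode k) ((TensorProduct.lid k H).toLinearMap ∘ₗ
        map counit .id) (map .id comul (comul x)) = map (antipode k) .id (comul (R := k) x) := by
      rw [← LinearMap.comp_apply, ← TensorProduct.map_comp]
      congr 2
      ext y
      simp [← LinearMap.rTensor_def]
    rw [h9]
    have h10 := mul_antipode_rTensor_comul_apply (R := k) x
    rw [LinearMap.rTensor_def] at h10
    rw [h10]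
    simp [Algebra.algebraMap_eq_smul_one, Algebra.TensorProduct.one_def]
  have := left_inv_eq_right_inv hL hR
  have := congrArg WithConv.ofConv this
  exact (LinearMap.congr_fun this x).symm

variable [AntipodeInverse k H]

theorem antipode_injective : Function.Injective (antipode k : H →ₗ[k] H) :=
  Function.LeftInverse.injective AntipodeInverse.inv_antipode

theorem inv_one : AntipodeInverse.inv (k := k) (H := H) 1 = 1 :=
  antipode_injective (k := k) (by rw [AntipodeInverse.antipode_inv, antipode_one])

theorem inv_mul (x y : H) :
    AntipodeInverse.inv (k := k) (H := H) (x * y) =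
      AntipodeInverse.inv (k := k) (H := H) y * AntipodeInverse.inv (k := k) (H := H) x :=
  antipode_injective (k := k) (by
    rw [antipode_mul_antidistrib]
    simp only [AntipodeInverse.antipode_inv])

theorem counit_inv (x : H) :
    counit (R := k) (AntipodeInverse.inv (k := k) (H := H) x) = counit (R := k) x := by
  conv_rhs => rw [← AntipodeInverse.antipode_inv (k := k) x, counit_antipode]

theorem comul_inv (x : H) :
    comul (R := k) (AntipodeInverse.inv (k := k) (H := H) x) =
      map (AntipodeInverse.inv (k := k) (H := H)) (AntipodeInverse.inv (k := k) (H := H))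
        (TensorProduct.comm k H H (comul x)) := by
  have h := comul_antipode (k := k) (AntipodeInverse.inv (k := k) (H := H) x)
  rw [AntipodeInverse.antipode_inv] at h
  rw [h, ← LinearEquiv.coe_coe, ← LinearMap.comp_apply]
  have : ∀ t : H ⊗[k] H, map (AntipodeInverse.inv (k := k) (H := H))
      (AntipodeInverse.inv (k := k) (H := H))
      (TensorProduct.comm k H H (map (antipode k) (antipode k)
      (TensorProduct.comm k H H t))) = t := by
    intro t
    induction t with
    | zero => simp
    | add a b ha hb => simp only [map_add, ha, hb]
    | tmul a b => simp [AntipodeInverse.inv_antipode]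
  exact (this _).symm

end inverse

variable (k H : Type*) [Field k] [Ring H] [HopfAlgebra k H]

/-- The dual algebra `H^*`. -/
abbrev DualAlg : Type _ := WithConv (H →ₗ[k] k)

instance : AddCommGroup (DrinfeldDouble k H) :=
  inferInstanceAs (AddCommGroup (DualAlg k H ⊗[k] H))

instance : Module k (DrinfeldDouble k H) :=
  inferInstanceAs (Module k (DualAlg k H ⊗[k] H))

/-- `a ↦ (φ ↦ φ(- a))`. -/
def actR : H →ₐ[k] Module.End k (DualAlg k H) where
  toFun a := (WithConv.linearEquiv k _).symm.toLinearMap ∘ₗ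
    (LinearMap.mulRight k a).lcomp k k ∘ₗ (WithConv.linearEquiv k _).toLinearMap
  map_one' := by ext; simp
  map_mul' a b := by ext; simp [mul_assoc]
  map_zero' := by ext; simp
  map_add' a b := by ext; simp [mul_add]
  commutes' r := by ext; simp [Algebra.algebraMap_eq_smul_one]

theorem actR_apply (a : H) (φ : DualAlg k H) (x : H) : actR k H a φ x = φ (x * a) := rfl

variable [AntipodeInverse k H]

/-- `c ↦ (φ ↦ φ(S⁻¹(c) -))`. -/
def actL : H →ₐ[k] Module.End k (DualAlg k H) where
  toFun c := (WithConv.linearEquiv k _).symm.toLinearMap ∘ₗ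
    (LinearMap.mulLeft k (AntipodeInverse.inv (k := k) c)).lcomp k k ∘ₗ
      (WithConv.linearEquiv k _).toLinearMap
  map_one' := by ext; simp [inv_one]
  map_mul' a b := by ext; simp [inv_mul]
  map_zero' := by ext; simp
  map_add' a b := by ext; simp [add_mul]
  commutes' r := by ext; simp [Algebra.algebraMap_eq_smul_one, inv_one]

theorem actL_apply (c : H) (φ : DualAlg k H) (x : H) :
    actL k H c φ x = φ (AntipodeInverse.inv (k := k) c * x) := rfl

theorem actR_comm_actL (a c : H) : Commute (actR k H a) (actL k H c) := by
  ext φ x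
  change φ _ = φ _
  exact congrArg _ (mul_assoc _ _ _).symm

/-- Left multiplication by `φ ∈ H^*` on `H^* ⊗ H`. -/
def dualMulLeft : DualAlg k H →ₐ[k] Module.End k (DualAlg k H ⊗[k] H) :=
  (Module.End.rTensorAlgHom k (DualAlg k H) H).comp (Algebra.lmul k (DualAlg k H))

/-- `a ↦ (φ ⊗ g ↦ φ(- a) ⊗ g)`. -/
def actA : H →ₐ[k] Module.End k (DualAlg k H ⊗[k] H) :=
  (Module.End.rTensorAlgHom k (DualAlg k H) H).comp (actR k H)

/-- `b ↦ (φ ⊗ g ↦ φ ⊗ b g)`. -/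
def actB : H →ₐ[k] Module.End k (DualAlg k H ⊗[k] H) :=
  (Module.End.lTensorAlgHom k H (DualAlg k H)).comp (Algebra.lmul k H)

/-- `c ↦ (φ ⊗ g ↦ φ(S⁻¹(c) -) ⊗ g)`. -/
def actC : H →ₐ[k] Module.End k (DualAlg k H ⊗[k] H) :=
  (Module.End.rTensorAlgHom k (DualAlg k H) H).comp (actL k H)

theorem actA_comm_actB (a b : H) : Commute (actA k H a) (actB k H b) :=
  TensorProduct.ext' fun _ _ => rfl

theorem actA_comm_actC (a c : H) : Commute (actA k H a) (actC k H c) :=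
  TensorProduct.ext' fun φ g =>
    congrArg (fun χ => χ ⊗ₜ[k] g) (LinearMap.congr_fun (actR_comm_actL k H a c) φ)

theorem actB_comm_actC (b c : H) : Commute (actB k H b) (actC k H c) :=
  TensorProduct.ext' fun _ _ => rfl

/-- `a ⊗ b ↦ (φ ⊗ g ↦ φ(- a) ⊗ b g)`. -/
def pairAct : H ⊗[k] H →ₐ[k] Module.End k (DualAlg k H ⊗[k] H) :=
  Algebra.TensorProduct.lift (actA k H) (actB k H) (actA_comm_actB k H)

theorem pairAct_comm_actC (t : H ⊗[k] H) (c : H) : Commute (pairAct k H t) (actC k H c) := by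
  induction t with
  | zero => rw [map_zero]; exact Commute.zero_left _
  | add s t hs ht => rw [map_add]; exact hs.add_left ht
  | tmul a b =>
    rw [pairAct, Algebra.TensorProduct.lift_tmul]
    exact (actA_comm_actC k H a c).mul_left (actB_comm_actC k H b c)

/-- The linear map `(a ⊗ b) ⊗ c ↦ (φ ⊗ g ↦ φ(S⁻¹(c) - a) ⊗ b g)`, an algebra homomorphism. -/
def tripleAct : (H ⊗[k] H) ⊗[k] H →ₐ[k] Module.End k (DualAlg k H ⊗[k] H) :=
  Algebra.TensorProduct.lift (pairAct k H) (actC k H) (pairAct_comm_actC k H)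

theorem tripleAct_tmul (a b c g : H) (φ : DualAlg k H) :
    tripleAct k H ((a ⊗ₜ b) ⊗ₜ c) (φ ⊗ₜ g) = actR k H a (actL k H c φ) ⊗ₜ (b * g) := by
  rw [tripleAct, Algebra.TensorProduct.lift_tmul, pairAct, Algebra.TensorProduct.lift_tmul]
  rfl

/-- Left multiplication by `h ∈ H` on `H^* ⊗ H`:
`h (φ ⊗ g) = ∑ φ(S⁻¹(h₍₃₎) - h₍₁₎) ⊗ h₍₂₎ g`. -/
def hopfMulLeft : H →ₐ[k] Module.End k (DualAlg k H ⊗[k] H) :=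
  (tripleAct k H).comp
    ((Algebra.TensorProduct.map (Bialgebra.comulAlgHom k H) (AlgHom.id k H)).comp
      (Bialgebra.comulAlgHom k H))

theorem hopfMulLeft_apply (h : H) :
    hopfMulLeft k H h = tripleAct k H (map comul .id (comul h)) := rfl

/-- Left multiplication in the double: `φ ⊗ h` acts as `h` followed by `φ`, so that
`(φ ⊗ h)(φ' ⊗ h') = ∑ φ φ'(S⁻¹(h₍₃₎) - h₍₁₎) ⊗ h₍₂₎ h'`. -/
def mulLeftMap : DualAlg k H ⊗[k] H →ₗ[k] Module.End k (DualAlg k H ⊗[k] H) :=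
  TensorProduct.lift ((LinearMap.mul k (Module.End k (DualAlg k H ⊗[k] H))).compl₁₂
    (dualMulLeft k H).toLinearMap (hopfMulLeft k H).toLinearMap)

section assoc

variable {k H}

theorem mulLeftMap_tmul (φ : DualAlg k H) (h : H) :
    mulLeftMap k H (φ ⊗ₜ h) = dualMulLeft k H φ * hopfMulLeft k H h := by
  simp [mulLeftMap]

theorem dualMulLeft_tmul (φ ψ : DualAlg k H) (g : H) :
    dualMulLeft k H φ (ψ ⊗ₜ g) = (φ * ψ) ⊗ₜ g := by
  rfl

/-- Right multiplication by `g ∈ H` on `H^* ⊗ H`. -/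
def rightMul (g : H) : Module.End k (DualAlg k H ⊗[k] H) :=
  (LinearMap.mulRight k g).lTensor (DualAlg k H)

theorem rightMul_tmul (g h : H) (φ : DualAlg k H) :
    rightMul g (φ ⊗ₜ[k] h) = φ ⊗ₜ[k] (h * g) := rfl

theorem dualMulLeft_rightMul (φ : DualAlg k H) (g : H) (z : DualAlg k H ⊗[k] H) :
    dualMulLeft k H φ (rightMul g z) = rightMul g (dualMulLeft k H φ z) := by
  induction z with
  | zero => simp
  | add a b ha hb => simp only [map_add, ha, hb]
  | tmul ψ h => simp only [rightMul_tmul, dualMulLeft_tmul]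

theorem hopfMulLeft_rightMul (h g : H) (z : DualAlg k H ⊗[k] H) :
    hopfMulLeft k H h (rightMul g z) = rightMul g (hopfMulLeft k H h z) := by
  rw [hopfMulLeft_apply]
  generalize map (comul : H →ₗ[k] H ⊗[k] H) (LinearMap.id : H →ₗ[k] H) (comul h) = t
  induction t with
  | zero => simp
  | add a b ha hb => simp only [map_add, LinearMap.add_apply, ha, hb]
  | tmul s c =>
    induction s with
    | zero => simp
    | add a b ha hb => simp only [map_add, add_tmul, LinearMap.add_apply, ha, hb]
    | tmul a b =>
      induction z with
      | zero => simp
      | add a b ha hb => simp only [map_add, ha, hb]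
      | tmul ψ h => simp only [rightMul_tmul, tripleAct_tmul, mul_assoc]

theorem mulLeftMap_rightMul_apply (z w : DualAlg k H ⊗[k] H) (g : H) :
    mulLeftMap k H z (rightMul g w) = rightMul g (mulLeftMap k H z w) := by
  induction z with
  | zero => simp
  | add a b ha hb => simp only [map_add, LinearMap.add_apply, ha, hb]
  | tmul φ h =>
    simp only [mulLeftMap_tmul, Module.End.mul_apply, hopfMulLeft_rightMul,
      dualMulLeft_rightMul]

theorem mulLeftMap_rightMul (z : DualAlg k H ⊗[k] H) (g : H) :
    mulLeftMap k H (rightMul g z) = mulLeftMap k H z * hopfMulLeft k H g := by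
  induction z with
  | zero => simp
  | add a b ha hb => simp only [map_add, ha, hb, add_mul]
  | tmul φ h => rw [rightMul_tmul, mulLeftMap_tmul, mulLeftMap_tmul, map_mul, mul_assoc]

theorem mulLeftMap_dualMulLeft (φ : DualAlg k H) (z : DualAlg k H ⊗[k] H) :
    mulLeftMap k H (dualMulLeft k H φ z) = dualMulLeft k H φ * mulLeftMap k H z := by
  induction z with
  | zero => simp
  | add a b ha hb => simp only [map_add, ha, hb, mul_add]
  | tmul ψ h => rw [dualMulLeft_tmul, mulLeftMap_tmul, mulLeftMap_tmul, map_mul, mul_assoc]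

/-- `a ⊗ c ↦ φ(S⁻¹(c) - a)`. -/
def sandwich (φ : DualAlg k H) : H ⊗[k] H →ₗ[k] DualAlg k H :=
  TensorProduct.lift (LinearMap.mk₂ k (fun a c => actR k H a (actL k H c φ))
    (by intros; simp) (by intros; simp) (by intros; simp) (by intros; simp))

theorem sandwich_tmul (φ : DualAlg k H) (a c : H) :
    sandwich φ (a ⊗ₜ c) = actR k H a (actL k H c φ) := rfl

/-- `a ⊗ a' ⊗ b ⊗ c' ⊗ c ↦ ((a ⊗ c) ⊗ (a' ⊗ c')) ⊗ b`. -/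
def perm5 : H ⊗[k] (H ⊗[k] (H ⊗[k] (H ⊗[k] H))) →ₗ[k] ((H ⊗[k] H) ⊗[k] (H ⊗[k] H)) ⊗[k] H :=
  (TensorProduct.comm k H ((H ⊗[k] H) ⊗[k] (H ⊗[k] H))).toLinearMap ∘ₗ
  map .id ((TensorProduct.assoc k H H (H ⊗[k] H)).symm.toLinearMap ∘ₗ
    map .id ((TensorProduct.comm k (H ⊗[k] H) H).toLinearMap ∘ₗ
      (TensorProduct.assoc k H H H).symm.toLinearMap)) ∘ₗ
  (TensorProduct.leftComm k H H (H ⊗[k] (H ⊗[k] H))).toLinearMap ∘ₗ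
  map .id (TensorProduct.leftComm k H H (H ⊗[k] H)).toLinearMap

theorem perm5_tmul (a a' b c' c : H) :
    perm5 (k := k) (a ⊗ₜ (a' ⊗ₜ (b ⊗ₜ (c' ⊗ₜ c)))) = ((a ⊗ₜ c) ⊗ₜ (a' ⊗ₜ c')) ⊗ₜ b := by
  simp [perm5]

/-- `a ⊗ a' ⊗ b ⊗ c' ⊗ c ↦ φ(S⁻¹(c) - a) ψ(S⁻¹(c') - a') ⊗ b`. -/
def contract5 (φ ψ : DualAlg k H) :
    H ⊗[k] (H ⊗[k] (H ⊗[k] (H ⊗[k] H))) →ₗ[k] DualAlg k H ⊗[k] H :=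
  map (LinearMap.mul' k (DualAlg k H) ∘ₗ map (sandwich φ) (sandwich ψ)) .id ∘ₗ perm5

theorem contract5_tmul (φ ψ : DualAlg k H) (a a' b c' c : H) :
    contract5 φ ψ (a ⊗ₜ (a' ⊗ₜ (b ⊗ₜ (c' ⊗ₜ c)))) =
      (sandwich φ (a ⊗ₜ c) * sandwich ψ (a' ⊗ₜ c')) ⊗ₜ b := by
  simp [contract5, perm5_tmul]

theorem sandwich_mul (φ ψ : DualAlg k H) (a b c : H) :
    (sandwich (φ * ψ) (a ⊗ₜ c)) ⊗ₜ[k] b =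
      contract5 φ ψ (TensorProduct.assoc k H H (H ⊗[k] (H ⊗[k] H))
        (TensorProduct.assoc k (H ⊗[k] H) H (H ⊗[k] H) ((comul a ⊗ₜ b) ⊗ₜ comul c))) := by
  have key : ∀ s t : H ⊗[k] H, ∃ w : DualAlg k H,
      contract5 φ ψ (TensorProduct.assoc k H H (H ⊗[k] (H ⊗[k] H))
        (TensorProduct.assoc k (H ⊗[k] H) H (H ⊗[k] H) ((s ⊗ₜ b) ⊗ₜ t))) = w ⊗ₜ b ∧
      ∀ x, w x = LinearMap.mul' k k (map φ.ofConv ψ.ofConv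
        (map (AntipodeInverse.inv (k := k)) (AntipodeInverse.inv (k := k))
          (TensorProduct.comm k H H t) * comul x * s)) := by
    intro s t
    induction s with
    | zero => exact ⟨0, by simp⟩
    | add s s' hs hs' =>
      obtain ⟨w, h1, h2⟩ := hs
      obtain ⟨w', h1', h2'⟩ := hs'
      refine ⟨w + w', ?_, fun x => ?_⟩
      · simp only [add_tmul, map_add, h1, h1']
      · rw [mul_add, map_add, map_add, ← h2, ← h2']; rfl
    | tmul a a' =>
      induction t with
      | zero => exact ⟨0, by simp⟩
      | add t t' ht ht' =>
        obtain ⟨w, h1, h2⟩ := ht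
        obtain ⟨w', h1', h2'⟩ := ht'
        refine ⟨w + w', ?_, fun x => ?_⟩
        · simp only [tmul_add, add_tmul, map_add, h1, h1']
        · rw [map_add, map_add, add_mul, add_mul, map_add, map_add, ← h2, ← h2']; rfl
      | tmul c' c =>
        refine ⟨sandwich φ (a ⊗ₜ c) * sandwich ψ (a' ⊗ₜ c'), ?_, fun x => ?_⟩
        · rw [TensorProduct.assoc_tmul, TensorProduct.assoc_tmul, contract5_tmul]
        · rw [LinearMap.convMul_apply]
          generalize comul (R := k) x = u
          induction u with
          | zero => simp
          | add u v hu hv => simp only [mul_add, add_mul, map_add, hu, hv]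
          | tmul p q =>
            simp only [TensorProduct.map_tmul, TensorProduct.comm_tmul,
              Algebra.TensorProduct.tmul_mul_tmul, LinearMap.mul'_apply, sandwich_tmul]
            rw [mul_assoc, mul_assoc]
            rfl
  obtain ⟨w, h1, h2⟩ := key (comul a) (comul c)
  rw [h1]
  congr 1
  ext x
  change _ = w x
  rw [h2, ← comul_inv, ← Bialgebra.comul_mul, ← Bialgebra.comul_mul]
  rw [mul_assoc]
  rfl

theorem hopfMulLeft_dualMulLeft (h : H) (φ : DualAlg k H) :
    mulLeftMap k H (hopfMulLeft k H h (φ ⊗ₜ 1)) = hopfMulLeft k H h * dualMulLeft k H φ := by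
  have five :
      (TensorProduct.assoc k H H (H ⊗[k] (H ⊗[k] H))).toLinearMap ∘ₗ
        (TensorProduct.assoc k (H ⊗[k] H) H (H ⊗[k] H)).toLinearMap ∘ₗ
        map (map comul .id) comul ∘ₗ map comul .id ∘ₗ (comul : H →ₗ[k] H ⊗[k] H) =
      map .id (map .id (TensorProduct.assoc k H H H).toLinearMap) ∘ₗ
        map .id (TensorProduct.assoc k H (H ⊗[k] H) H).toLinearMap ∘ₗ
        map .id (map (TensorProduct.assoc k H H H).toLinearMap .id) ∘ₗ
        (TensorProduct.assoc k H ((H ⊗[k] H) ⊗[k] H) H).toLinearMap ∘ₗ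
        map (map .id (map comul .id ∘ₗ comul)) .id ∘ₗ map comul .id ∘ₗ comul := by
    simp [coassoc_simps]
  apply TensorProduct.ext'
  intro ψ g
  have hg : ψ ⊗ₜ[k] g = rightMul g (ψ ⊗ₜ 1) := by rw [rightMul_tmul, one_mul]
  rw [Module.End.mul_apply, hg, mulLeftMap_rightMul_apply, dualMulLeft_rightMul,
    hopfMulLeft_rightMul, dualMulLeft_tmul]
  congr 1
  have h1 : ∀ t : (H ⊗[k] H) ⊗[k] H, tripleAct k H t ((φ * ψ) ⊗ₜ 1) =
      contract5 φ ψ (TensorProduct.assoc k H H (H ⊗[k] (H ⊗[k] H))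
        (TensorProduct.assoc k (H ⊗[k] H) H (H ⊗[k] H) (map (map comul .id) comul t))) := by
    intro t
    induction t with
    | zero => simp
    | add a b ha hb => simp only [map_add, LinearMap.add_apply, ha, hb]
    | tmul s c =>
      induction s with
      | zero => simp
      | add a b ha hb => simp only [map_add, add_tmul, LinearMap.add_apply, ha, hb]
      | tmul a b =>
        rw [tripleAct_tmul, mul_one, ← sandwich_tmul, sandwich_mul]
        rfl
  have h3 : ∀ (a c : H) (t : (H ⊗[k] H) ⊗[k] H),
      dualMulLeft k H (sandwich φ (a ⊗ₜ c)) (tripleAct k H t (ψ ⊗ₜ 1)) =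
      contract5 φ ψ (map .id (map .id (TensorProduct.assoc k H H H).toLinearMap)
        (map .id (TensorProduct.assoc k H (H ⊗[k] H) H).toLinearMap
        (map .id (map (TensorProduct.assoc k H H H).toLinearMap .id)
        (TensorProduct.assoc k H ((H ⊗[k] H) ⊗[k] H) H ((a ⊗ₜ t) ⊗ₜ c))))) := by
    intro a c t
    induction t with
    | zero => simp
    | add s t hs ht =>
      simp only [map_add, add_tmul, tmul_add, LinearMap.add_apply, hs, ht]
    | tmul s c' =>
      induction s with
      | zero => simp
      | add s t hs ht =>
        simp only [map_add, add_tmul, tmul_add, LinearMap.add_apply, hs, ht]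
      | tmul a' b =>
        rw [tripleAct_tmul, dualMulLeft_tmul, mul_one, ← sandwich_tmul]
        simp [contract5_tmul]
  have h2 : ∀ t : (H ⊗[k] H) ⊗[k] H,
      mulLeftMap k H (tripleAct k H t (φ ⊗ₜ 1)) (ψ ⊗ₜ 1) =
      contract5 φ ψ (map .id (map .id (TensorProduct.assoc k H H H).toLinearMap)
        (map .id (TensorProduct.assoc k H (H ⊗[k] H) H).toLinearMap
        (map .id (map (TensorProduct.assoc k H H H).toLinearMap .id)
        (TensorProduct.assoc k H ((H ⊗[k] H) ⊗[k] H) H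
        (map (map .id (map comul .id ∘ₗ comul)) .id t))))) := by
    intro t
    induction t with
    | zero => simp
    | add a b ha hb => simp only [map_add, LinearMap.add_apply, ha, hb]
    | tmul s c =>
      induction s with
      | zero => simp
      | add a b ha hb => simp only [map_add, add_tmul, LinearMap.add_apply, ha, hb]
      | tmul a b =>
        rw [tripleAct_tmul, mul_one, mulLeftMap_tmul, Module.End.mul_apply, hopfMulLeft_apply,
          ← sandwich_tmul, h3]
        rfl
  rw [hopfMulLeft_apply, h1, h2]
  have := LinearMap.congr_fun five h
  simp only [LinearMap.comp_apply, LinearEquiv.coe_coe] at this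
  rw [this]

theorem mulLeftMap_mulLeftMap (x y : DualAlg k H ⊗[k] H) :
    mulLeftMap k H (mulLeftMap k H x y) = mulLeftMap k H x * mulLeftMap k H y := by
  induction x with
  | zero => simp
  | add a b ha hb => simp only [map_add, LinearMap.add_apply, ha, hb, add_mul]
  | tmul φ h =>
    induction y with
    | zero => simp
    | add a b ha hb => simp only [map_add, ha, hb, mul_add]
    | tmul ψ g =>
      have hg : ψ ⊗ₜ[k] g = rightMul g (ψ ⊗ₜ 1) := by rw [rightMul_tmul, one_mul]
      rw [hg, mulLeftMap_rightMul_apply, mulLeftMap_rightMul, mulLeftMap_rightMul,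
        mulLeftMap_tmul, mulLeftMap_tmul, Module.End.mul_apply, mulLeftMap_dualMulLeft,
        hopfMulLeft_dualMulLeft, map_one, mul_one]
      simp only [mul_assoc]

theorem mulLeftMap_one : mulLeftMap k H (1 ⊗ₜ 1) = 1 := by
  rw [mulLeftMap_tmul, map_one, map_one, one_mul]

theorem mulLeftMap_apply_one (x : DualAlg k H ⊗[k] H) : mulLeftMap k H x (1 ⊗ₜ 1) = x := by
  have h1 : ∀ t : (H ⊗[k] H) ⊗[k] H, tripleAct k H t (1 ⊗ₜ 1) =
      (1 : DualAlg k H) ⊗ₜ (TensorProduct.lid k H (map counit .id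
        (TensorProduct.rid k _ (map .id counit t)))) := by
    intro t
    induction t with
    | zero => simp
    | add a b ha hb => simp only [map_add, LinearMap.add_apply, tmul_add, ha, hb]
    | tmul s c =>
      induction s with
      | zero => simp
      | add a b ha hb => simp only [map_add, add_tmul, LinearMap.add_apply, tmul_add, ha, hb]
      | tmul a b =>
        rw [tripleAct_tmul]
        have : actR k H a (actL k H c 1) =
            (counit (R := k) a * counit (R := k) c) • (1 : DualAlg k H) := by
          ext x
          change counit (R := k) (AntipodeInverse.inv (k := k) c * (x * a)) =
            (counit (R := k) a * counit (R := k) c) * counit (R := k) x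
          rw [Bialgebra.counit_mul, Bialgebra.counit_mul, counit_inv]
          ring
        rw [this]
        simp [smul_tmul, smul_smul, mul_comm]
  induction x with
  | zero => simp
  | add a b ha hb => simp only [map_add, LinearMap.add_apply, ha, hb]
  | tmul φ h =>
    rw [mulLeftMap_tmul, Module.End.mul_apply, hopfMulLeft_apply, h1, dualMulLeft_tmul, mul_one]
    congr 1
    have h2 : ∀ t : H ⊗[k] H, TensorProduct.rid k (H ⊗[k] H) (map .id counit
        (map comul .id t)) = comul (TensorProduct.rid k H (map .id counit t)) := by
      intro t
      induction t with
      | zero => simp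
      | add a b ha hb => simp only [map_add, ha, hb]
      | tmul a b => simp
    rw [h2]
    have h3 := Coalgebra.lTensor_counit_comul (R := k) h
    rw [LinearMap.lTensor_def] at h3
    rw [h3, rid_tmul, one_smul]
    have h4 := Coalgebra.rTensor_counit_comul (R := k) h
    rw [LinearMap.rTensor_def] at h4
    rw [h4, lid_tmul, one_smul]

end assoc

instance : Ring (DrinfeldDouble k H) :=
  { (inferInstance : AddCommGroup (DrinfeldDouble k H)) with
    mul := fun x y => mulLeftMap k H x y
    one := (1 ⊗ₜ 1 : DualAlg k H ⊗[k] H)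
    mul_assoc := fun x y z => LinearMap.congr_fun (mulLeftMap_mulLeftMap (k := k) (H := H) x y) z
    one_mul := fun x => LinearMap.congr_fun (mulLeftMap_one (k := k) (H := H)) x
    mul_one := fun x => mulLeftMap_apply_one (k := k) (H := H) x
    left_distrib := fun x y z => (mulLeftMap k H x).map_add y z
    right_distrib := fun x y z => LinearMap.congr_fun ((mulLeftMap k H).map_add x y) z
    zero_mul := fun x => LinearMap.congr_fun (mulLeftMap k H).map_zero x
    mul_zero := fun x => (mulLeftMap k H x).map_zero }

instance : Algebra k (DrinfeldDouble k H) :=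
  Algebra.ofModule
    (fun r x y => LinearMap.congr_fun ((mulLeftMap k H).map_smul r x) y)
    (fun r x y => (mulLeftMap k H x).map_smul r y)

end DrinfeldDouble

namespace NicholsAlgebra

/-- The inverse of the antipode is `S³`. -/
instance (n : ℕ) : AntipodeInverse ℂ (NicholsAlgebra n) where
  inv := antipodeLin n ∘ₗ antipodeLin n ∘ₗ antipodeLin n
  inv_antipode := antipodeLin_four
  antipode_inv := antipodeLin_four

end NicholsAlgebra

namespace DrinfeldDouble

open Coalgebra (comul counit)
open HopfAlgebra WithConv TensorProduct

section structureMaps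

variable {k H : Type*} [Field k] [Ring H] [HopfAlgebra k H]

/-- The element `φ ⊗ h` of the double. -/
def mk : DualAlg k H →ₗ[k] H →ₗ[k] DrinfeldDouble k H := TensorProduct.mk k (DualAlg k H) H

/-- The linear map on the double determined by a bilinear map on `H^* × H`. -/
def liftLinear {M : Type*} [AddCommGroup M] [Module k M]
    (f : DualAlg k H →ₗ[k] H →ₗ[k] M) : DrinfeldDouble k H →ₗ[k] M :=
  TensorProduct.lift f

theorem liftLinear_mk {M : Type*} [AddCommGroup M] [Module k M]
    (f : DualAlg k H →ₗ[k] H →ₗ[k] M) (φ : DualAlg k H) (h : H) :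
    liftLinear f (mk φ h) = f φ h := rfl

/-- The embedding `h ↦ ε ⊗ h` of `H`. -/
def ofHopf : H →ₗ[k] DrinfeldDouble k H := mk 1

/-- The embedding `φ ↦ φ ⊗ 1` of `H^*`. -/
def ofDual : DualAlg k H →ₗ[k] DrinfeldDouble k H := mk.flip 1

/-- The counit `φ ⊗ h ↦ φ(1) ε(h)`. -/
def counitD : DrinfeldDouble k H →ₗ[k] k :=
  liftLinear (LinearMap.mk₂ k (fun φ h => φ 1 * counit (R := k) h)
    (fun _ _ _ => add_mul _ _ _) (fun _ _ _ => mul_assoc _ _ _)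
    (fun _ _ _ => by rw [map_add, mul_add])
    (fun _ _ _ => by rw [map_smul, smul_eq_mul, smul_eq_mul, mul_left_comm]))

variable (k H) in
/-- The comultiplication `φ ↦ ∑ φ₍₁₎ ⊗ φ₍₂₎` of `H^*`, where `∑ φ₍₁₎(x) φ₍₂₎(y) = φ(x y)`. -/
def comulDual [Module.Finite k H] : DualAlg k H →ₗ[k] DualAlg k H ⊗[k] DualAlg k H :=
  map (WithConv.linearEquiv k (H →ₗ[k] k)).symm.toLinearMap
      (WithConv.linearEquiv k (H →ₗ[k] k)).symm.toLinearMap ∘ₗ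
    (TensorProduct.dualDistribEquiv k H H).symm.toLinearMap ∘ₗ
    (LinearMap.mul' k H).dualMap ∘ₗ (WithConv.linearEquiv k (H →ₗ[k] k)).toLinearMap

theorem comulDual_spec [Module.Finite k H] (φ : DualAlg k H) (x y : H) :
    TensorProduct.dualDistrib k H H
      (map (WithConv.linearEquiv k (H →ₗ[k] k)).toLinearMap
        (WithConv.linearEquiv k (H →ₗ[k] k)).toLinearMap (comulDual k H φ)) (x ⊗ₜ y) =
      φ (x * y) := by
  have h : ∀ t : Module.Dual k H ⊗[k] Module.Dual k H,
      map (WithConv.linearEquiv k (H →ₗ[k] k)).toLinearMap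
        (WithConv.linearEquiv k (H →ₗ[k] k)).toLinearMap
        (map (WithConv.linearEquiv k (H →ₗ[k] k)).symm.toLinearMap
          (WithConv.linearEquiv k (H →ₗ[k] k)).symm.toLinearMap t) = t := by
    intro t
    induction t with
    | zero => simp
    | add a b ha hb => simp only [map_add, ha, hb]
    | tmul a b => simp
  simp only [comulDual, LinearMap.comp_apply, h]
  have h2 := (TensorProduct.dualDistribEquiv k H H).apply_symm_apply
    ((LinearMap.mul' k H).dualMap (WithConv.linearEquiv k (H →ₗ[k] k) φ))
  exact LinearMap.congr_fun h2 (x ⊗ₜ y)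

/-- The comultiplication of `H^{*cop} ⊗ H`: `φ ⊗ h ↦ ∑ (φ₍₂₎ ⊗ h₍₁₎) ⊗ (φ₍₁₎ ⊗ h₍₂₎)`. -/
def comulD [Module.Finite k H] :
    DrinfeldDouble k H →ₗ[k] DrinfeldDouble k H ⊗[k] DrinfeldDouble k H :=
  (TensorProduct.tensorTensorTensorComm k (DualAlg k H) (DualAlg k H) H H).toLinearMap ∘ₗ
    map ((TensorProduct.comm k (DualAlg k H) (DualAlg k H)).toLinearMap ∘ₗ comulDual k H) comul

variable [AntipodeInverse k H]

theorem mk_mul_mk (φ ψ : DualAlg k H) (h g : H) :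
    mk φ h * mk ψ g =
      dualMulLeft k H φ (tripleAct k H (map comul .id (comul h)) (ψ ⊗ₜ[k] g)) := by
  change mulLeftMap k H (φ ⊗ₜ h) (ψ ⊗ₜ g) = _
  rw [mulLeftMap_tmul]
  rfl

theorem ofDual_mul_ofHopf (φ : DualAlg k H) (h : H) : ofDual φ * ofHopf h = mk φ h := by
  change mulLeftMap k H (φ ⊗ₜ 1) (1 ⊗ₜ h) = _
  rw [mulLeftMap_tmul, map_one, mul_one, dualMulLeft_tmul, mul_one]
  rfl

/-- The antipode `φ ⊗ h ↦ (ε ⊗ S(h)) (φ ∘ S⁻¹ ⊗ 1)`. -/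
def antipodeD : DrinfeldDouble k H →ₗ[k] DrinfeldDouble k H :=
  liftLinear (LinearMap.mk₂ k
    (fun φ h => ofHopf (antipode k h) *
      ofDual (toConv (φ.ofConv ∘ₗ AntipodeInverse.inv (k := k) (H := H))))
    (fun _ _ _ => by
      rw [← mul_add, ← map_add]; rfl)
    (fun _ _ _ => by
      rw [← mul_smul_comm, ← map_smul]; rfl)
    (fun _ _ _ => by rw [map_add, map_add, add_mul])
    (fun _ _ _ => by rw [map_smul, map_smul, smul_mul_assoc]))

/-- The universal `R`-matrix `R = ∑ᵢ (ε ⊗ eᵢ) ⊗ (eⁱ ⊗ 1)` for dual bases `eᵢ`, `eⁱ` of `H` and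
`H^*`. -/
def RMatrix (k H : Type*) [Field k] [Ring H] [HopfAlgebra k H] [Module.Finite k H]
    [AntipodeInverse k H] : DrinfeldDouble k H ⊗[k] DrinfeldDouble k H :=
  map ofHopf (ofDual ∘ₗ (WithConv.linearEquiv k (H →ₗ[k] k)).symm.toLinearMap)
    (coevaluation k H 1)

/-- `R₂₁`, the flip of the universal `R`-matrix. -/
def RMatrix₂₁ (k H : Type*) [Field k] [Ring H] [HopfAlgebra k H] [Module.Finite k H]
    [AntipodeInverse k H] : DrinfeldDouble k H ⊗[k] DrinfeldDouble k H :=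
  TensorProduct.comm k (DrinfeldDouble k H) (DrinfeldDouble k H) (RMatrix k H)

variable [Module.Finite k H]

/-- Ribbon elements: `v` is central, `Δ(v) = (R₂₁ R)⁻¹ (v ⊗ v)`, `ε(v) = 1` and `S(v) = v`. -/
structure IsRibbon (v : DrinfeldDouble k H) : Prop where
  central : ∀ x, v * x = x * v
  comul_eq : comulD v = Ring.inverse (RMatrix₂₁ k H * RMatrix k H) * (v ⊗ₜ[k] v)
  counit_eq : counitD v = 1
  antipode_eq : antipodeD v = v

/-- `Λ` is a nonzero left integral in the double: `x Λ = ε(x) Λ` for all `x`. -/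
structure IsIntegral (Λ : DrinfeldDouble k H) : Prop where
  ne_zero : Λ ≠ 0
  mul_eq : ∀ x, x * Λ = counitD x • Λ

/-- `λ` is a nonzero left integral in the dual of the double: `∑ x₍₁₎ λ(x₍₂₎) = λ(x) 1` for
all `x`. -/
structure IsCointegral (l : DrinfeldDouble k H →ₗ[k] k) : Prop where
  ne_zero : l ≠ 0
  comul_eq : ∀ x, TensorProduct.rid k (DrinfeldDouble k H)
    (l.lTensor (DrinfeldDouble k H) (comulD x)) = l x • (1 : DrinfeldDouble k H)

/-- `S²` is the inner automorphism `x ↦ G x G⁻¹`. -/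
def ImplementsAntipodeSq (G : (DrinfeldDouble k H)ˣ) : Prop :=
  ∀ x : DrinfeldDouble k H, antipodeD (antipodeD x) =
    (G : DrinfeldDouble k H) * x * (↑G⁻¹ : DrinfeldDouble k H)

/-- The trace map `τ(x) = ∑ S(Λ₍₂₎) x Λ₍₁₎ G⁻¹`. -/
def higmanTrace (Λ : DrinfeldDouble k H) (G : (DrinfeldDouble k H)ˣ) :
    DrinfeldDouble k H →ₗ[k] DrinfeldDouble k H :=
  LinearMap.mulRight k (↑G⁻¹ : DrinfeldDouble k H) ∘ₗ
    TensorProduct.lift (LinearMap.mk₂ k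
      (fun a b : DrinfeldDouble k H =>
        LinearMap.mulLeft k (antipodeD b) ∘ₗ LinearMap.mulRight k a)
      (fun _ _ _ => by ext; simp [mul_add])
      (fun _ _ _ => by ext; simp)
      (fun _ _ _ => by ext; simp [add_mul])
      (fun _ _ _ => by ext; simp)) (comulD Λ)

/-- The Higman ideal, the image of the trace map. -/
def Higman (Λ : DrinfeldDouble k H) (G : (DrinfeldDouble k H)ˣ) :
    Submodule k (DrinfeldDouble k H) :=
  LinearMap.range (higmanTrace Λ G)

/-- The Lyubashenko–Majid map `S_LM(x) = (id ⊗ λ)(R⁻¹ (1 ⊗ x) R₂₁⁻¹)`. -/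
def lyubashenkoMajidS (l : DrinfeldDouble k H →ₗ[k] k) (x : DrinfeldDouble k H) :
    DrinfeldDouble k H :=
  TensorProduct.rid k (DrinfeldDouble k H) (l.lTensor (DrinfeldDouble k H)
    (Ring.inverse (RMatrix k H) * ((1 : DrinfeldDouble k H) ⊗ₜ[k] x) *
      Ring.inverse (RMatrix₂₁ k H)))

/-- `ρ` is the Lyubashenko–Majid representation of `SL(2,ℤ)` on the Higman ideal: the generator
`s = (0, -1; 1, 0)` acts as a nonzero multiple of `S_LM` and the generator `t = (1, 1; 0, 1)` acts
as `T_LM`, the multiplication by the ribbon element `v`. -/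
structure IsLyubashenkoMajid (l : DrinfeldDouble k H →ₗ[k] k) (v Λ : DrinfeldDouble k H)
    (G : (DrinfeldDouble k H)ˣ)
    (ρ : Matrix.SpecialLinearGroup (Fin 2) ℤ →*
      LinearMap.GeneralLinearGroup k (Higman Λ G)) : Prop where
  map_S : ∃ c : k, c ≠ 0 ∧ ∀ x : Higman Λ G,
    (((ρ ModularGroup.S : Higman Λ G →ₗ[k] Higman Λ G) x : Higman Λ G) : DrinfeldDouble k H) =
      c • lyubashenkoMajidS l x
  map_T : ∀ x : Higman Λ G,
    (((ρ ModularGroup.T : Higman Λ G →ₗ[k] Higman Λ G) x : Higman Λ G) : DrinfeldDouble k H) =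
      v * x

end structureMaps

end DrinfeldDouble

/-- `Γ` is a congruence subgroup of level `N`: `N` is the least positive integer such that `Γ`
contains the principal congruence subgroup `Γ(N)`. -/
def IsCongruenceOfLevel (Γ : Subgroup (Matrix.SpecialLinearGroup (Fin 2) ℤ)) (N : ℕ) : Prop :=
  IsLeast {M : ℕ | 0 < M ∧ CongruenceSubgroup.Gamma M ≤ Γ} N

end

/-!
Write `xᵢ = ξᵢ`, `yᵢ = ξ̄ᵢ` for the odd generators of `D` that come from `𝒦ₙ` and from its dual, and
`c = K̄ K`. Then `c` is central and group-like, `c² = K² = 1`, `K` anticommutes with all odd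
generators, and the odd generators anticommute with each other except that
`xᵢ yᵢ + yᵢ xᵢ = 1 - c` (`doubleRel`). So `D` is a tensor-like product of `n` pairs: on the part
`c = -1` a Clifford algebra, on the part `c = 1` an exterior algebra, both with `K` adjoined. Most
computations are done in an arbitrary algebra with these relations, one pair at a time.

*The Higman ideal.* The integral is a multiple of `(∏ᵢ xᵢ yᵢ)(1 + c)(1 + K)`, and `S²` is
conjugation by `K`. The Higman ideal is therefore the image of an iterated twisted commutator with
all `xᵢ` and `yᵢ`. The induction over the pairs gives the three-dimensional span of `1 - c`, `ω`,
`c ω`, where `ω = K ∏ᵢ (xᵢ yᵢ - yᵢ xᵢ)` is central (`higman_eq`). This image is stable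
under multiplication by central elements such as `v` (`central_mul_mem`).

*The map `S`.* The `R`-matrix is a product of a group-like part and of one factor
`1 + K xᵢ ⊗ yᵢ` for each pair, so `(R₂₁ R)⁻¹` and `R⁻¹ R₂₁⁻¹` are products of factors as well. A
cointegral vanishes on words that lack an odd letter and on `∏ᵢ yᵢ xᵢ K` (`CointegralRel`), and for
even `n` on `∏ᵢ yᵢ xᵢ c` (`cointegral_prodYX_mul_c`). This gives the values of `S_LM` on `1 - c`,
`ω (1 - c)` and `ω (1 + c)`, up to one nonzero scalar that depends on the cointegral
(`lmS_values`).

*The ribbon element.* No formula for `v` is needed. On `ω (1 + c)` it acts by a scalar, and this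
scalar is `1` because `ω (1 + c)(1 + K)` is an integral (`ribbon_mul_om_one_add`). On the part
`c = -1`, evaluate `Δ(v) = (R₂₁ R)⁻¹ (v ⊗ v)` on an element of the socle in the second leg, where
the odd factors of the `R`-matrices act trivially: `v (1 - c)` is a multiple of `ω (1 - c)`
(`ribbon_mul_one_sub`). Finally `v²` is the inverse of `∑ a S(b)` for `∑ a ⊗ b = (R₂₁ R)⁻¹`, so for
even `n` it acts as `1` on the part `c = -1` (`ribbon_mul_ribbon_mul_one_sub`).

Hence `1 - c`, `v (1 - c)`, `2⁻ⁿ ω (1 + c)` is a basis of the Higman ideal in which `T_LM`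
exchanges the first two vectors, and `S_LM`, after scaling, the first and the last one. This is the
permutation action of `SL(2, ℤ/2)` on the three nonzero vectors of the plane (`levelTwo`). The
relation `(S T)³ = S²` leaves no choice for the scaling of `S_LM`, so every `ρ` as in the theorem is
this representation (`eq_levelTwo`). Its kernel contains `Γ(2)`, and already modulo scalars it is
nontrivial, so the level is two.
-/

set_option linter.unusedSimpArgs false

noncomputable section

namespace NicholsDouble

open Coalgebra (comul counit)
open HopfAlgebra WithConv TensorProduct DrinfeldDouble NicholsAlgebra

section

/-! ### Induction on words in generators -/

section words

variable {A : Type*} [Ring A] [Algebra ℂ A]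

theorem mem_of_mul_right_mem {s : Set A} (hs : Algebra.adjoin ℂ s = ⊤) (P : Submodule ℂ A)
    (h1 : 1 ∈ P) (hmul : ∀ g ∈ s, ∀ a ∈ P, a * g ∈ P) (a : A) : a ∈ P := by
  let S : Subalgebra ℂ A :=
    { carrier := {a | ∀ p ∈ P, p * a ∈ P}
      mul_mem' := fun {a b} ha hb p hp => by rw [← mul_assoc]; exact hb _ (ha _ hp)
      add_mem' := fun {a b} ha hb p hp => by rw [mul_add]; exact P.add_mem (ha _ hp) (hb _ hp)
      algebraMap_mem' := fun r p hp => by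
        rw [← Algebra.commutes, ← Algebra.smul_def]; exact P.smul_mem _ hp }
  have hS : S = ⊤ := by
    rw [eq_top_iff, ← hs]
    exact Algebra.adjoin_le fun g hg p hp => hmul g hg p hp
  have ha : a ∈ S := by rw [hS]; trivial
  simpa using ha 1 h1

theorem mem_of_mul_left_mem {s : Set A} (hs : Algebra.adjoin ℂ s = ⊤) (P : Submodule ℂ A)
    (h1 : 1 ∈ P) (hmul : ∀ g ∈ s, ∀ a ∈ P, g * a ∈ P) (a : A) : a ∈ P := by
  let S : Subalgebra ℂ A :=
    { carrier := {a | ∀ p ∈ P, a * p ∈ P}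
      mul_mem' := fun {a b} ha hb p hp => by rw [mul_assoc]; exact ha _ (hb _ hp)
      add_mem' := fun {a b} ha hb p hp => by rw [add_mul]; exact P.add_mem (ha _ hp) (hb _ hp)
      algebraMap_mem' := fun r p hp => by
        rw [← Algebra.smul_def]; exact P.smul_mem _ hp }
  have hS : S = ⊤ := by
    rw [eq_top_iff, ← hs]
    exact Algebra.adjoin_le fun g hg p hp => hmul g hg p hp
  have ha : a ∈ S := by rw [hS]; trivial
  simpa using ha 1 h1

end words

variable {n : ℕ}

/-- The generators of `𝒦ₙ`, as a set. -/
def nicholsGens (n : ℕ) : Set (NicholsAlgebra n) := insert (K n) (Set.range xi)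

theorem adjoin_nicholsGens : Algebra.adjoin ℂ (nicholsGens n) = ⊤ :=
  subalgebra_eq_top _ (Algebra.subset_adjoin (Set.mem_insert _ _))
    fun i => Algebra.subset_adjoin (Set.mem_insert_of_mem _ ⟨i, rfl⟩)

theorem nichols_mem_of_mul_right (P : Submodule ℂ (NicholsAlgebra n)) (h1 : 1 ∈ P)
    (hK : ∀ a ∈ P, a * K n ∈ P) (hx : ∀ i, ∀ a ∈ P, a * xi i ∈ P) (a : NicholsAlgebra n) :
    a ∈ P := by
  refine mem_of_mul_right_mem adjoin_nicholsGens P h1 ?_ a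
  rintro g (rfl | ⟨i, rfl⟩)
  exacts [hK, hx i]

theorem nichols_linearMap_ext {V : Type*} [AddCommGroup V] [Module ℂ V]
    (f : NicholsAlgebra n →ₗ[ℂ] V) (h1 : f 1 = 0) (hK : ∀ a, f a = 0 → f (a * K n) = 0)
    (hx : ∀ i a, f a = 0 → f (a * xi i) = 0) : f = 0 := by
  ext a
  exact nichols_mem_of_mul_right (LinearMap.ker f) h1 hK hx a

/-! ### The dual of the Nichols Hopf algebra -/

/-- The two-dimensional representation of `𝒦ₙ` in which `ξᵢ` acts by the elementary matrix
`E₀₁`, `K` by `diag(1, -1)`, and the remaining `ξⱼ` by zero. -/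
def twoDimRep (i : Fin n) : NicholsAlgebra n →ₐ[ℂ] Matrix (Fin 2) (Fin 2) ℂ :=
  lift !![1, 0; 0, -1] (fun j => if j = i then !![0, 1; 0, 0] else 0)
    (by ext a b; fin_cases a <;> fin_cases b <;> simp)
    (fun j => by split_ifs <;> ext a b <;> fin_cases a <;> fin_cases b <;> simp)
    (fun j => by split_ifs <;> simp)
    (fun j l => by split_ifs <;> ext a b <;> fin_cases a <;> fin_cases b <;> simp)

/-- The functional `K ↦ -1`, `ξᵢ ↦ 0`, an algebra homomorphism `𝒦ₙ → ℂ`. -/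
def signHom (n : ℕ) : NicholsAlgebra n →ₐ[ℂ] ℂ :=
  lift (-1) (fun _ => 0) (by simp) (by simp) (by simp) (by simp)

/-- The convolution algebra `𝒦ₙ^*` with the ring structure of `DualAlg` as its only source of
additive structure, so that tensor products with it are tensor products of rings. -/
def DualNichols (n : ℕ) : Type := DualAlg ℂ (NicholsAlgebra n)

instance : Ring (DualNichols n) := inferInstanceAs (Ring (DualAlg ℂ (NicholsAlgebra n)))

instance : Algebra ℂ (DualNichols n) :=
  inferInstanceAs (Algebra ℂ (DualAlg ℂ (NicholsAlgebra n)))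

/-- The value of a functional. -/
def DualNichols.eval (φ : DualNichols n) : NicholsAlgebra n →ₗ[ℂ] ℂ :=
  WithConv.ofConv (show DualAlg ℂ (NicholsAlgebra n) from φ)

/-- The linear isomorphism of `𝒦ₙ^*` with the linear dual. -/
def DualNichols.equivDual (n : ℕ) :
    DualNichols n ≃ₗ[ℂ] (NicholsAlgebra n →ₗ[ℂ] ℂ) where
  toFun φ := φ.eval
  invFun f := (toConv f : DualAlg ℂ (NicholsAlgebra n))
  map_add' _ _ := rfl
  map_smul' _ _ := rfl
  left_inv _ := rfl
  right_inv _ := rfl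

/-- The right translation `φ ↦ φ(- a)` of functionals. -/
def translate (a : NicholsAlgebra n) : DualNichols n →ₗ[ℂ] DualNichols n where
  toFun φ := actR ℂ (NicholsAlgebra n) a φ
  map_add' φ ψ := map_add (actR ℂ (NicholsAlgebra n) a) φ ψ
  map_smul' r φ := map_smul (actR ℂ (NicholsAlgebra n) a) r φ

theorem translate_eval (a b : NicholsAlgebra n) (φ : DualNichols n) :
    (translate a φ).eval b = φ.eval (b * a) := rfl

/-- The group-like element `K̄` of `𝒦ₙ^*`. -/
def kbar (n : ℕ) : DualNichols n := show DualAlg ℂ (NicholsAlgebra n) from toConv (signHom n).toLinearMap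

/-- The entry of `twoDimRep i` above the diagonal, as a linear functional. -/
def xibarLin (i : Fin n) : NicholsAlgebra n →ₗ[ℂ] ℂ :=
  (LinearMap.proj 1 ∘ₗ LinearMap.proj 0 : (Fin 2 → Fin 2 → ℂ) →ₗ[ℂ] ℂ) ∘ₗ
    (twoDimRep i).toLinearMap

/-- The skew-primitive element `ξ̄ᵢ` of `𝒦ₙ^*`, a matrix coefficient of `twoDimRep i`. -/
def xibar (i : Fin n) : DualNichols n :=
  show DualAlg ℂ (NicholsAlgebra n) from toConv (xibarLin i)

theorem xibarLin_apply (i : Fin n) (a : NicholsAlgebra n) :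
    xibarLin i a = twoDimRep i a 0 1 := rfl

@[simp] theorem signHom_K : signHom n (K n) = -1 := lift_K ..
@[simp] theorem signHom_xi (i : Fin n) : signHom n (xi i) = 0 := lift_xi ..

theorem twoDimRep_K (i : Fin n) : twoDimRep i (K n) = !![1, 0; 0, -1] := lift_K ..
theorem twoDimRep_xi (i j : Fin n) :
    twoDimRep i (xi j) = if j = i then !![0, 1; 0, 0] else 0 := lift_xi ..

theorem twoDimRep_one_zero (i : Fin n) (a : NicholsAlgebra n) : twoDimRep i a 1 0 = 0 := by
  refine nichols_mem_of_mul_right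
    (LinearMap.ker ((LinearMap.proj 0 ∘ₗ LinearMap.proj 1 : (Fin 2 → Fin 2 → ℂ) →ₗ[ℂ] ℂ) ∘ₗ
    (twoDimRep i).toLinearMap)) ?_ ?_ ?_ a
  · change twoDimRep i 1 1 0 = 0
    simp
  · intro a (ha : twoDimRep i a 1 0 = 0)
    change twoDimRep i (a * K n) 1 0 = 0
    simp [twoDimRep_K, Matrix.mul_apply, Fin.sum_univ_two, ha]
  · intro j a (ha : twoDimRep i a 1 0 = 0)
    change twoDimRep i (a * xi j) 1 0 = 0
    rw [map_mul, twoDimRep_xi]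
    split_ifs <;> simp [Matrix.mul_apply, Fin.sum_univ_two]

theorem twoDimRep_zero_zero (i : Fin n) (a : NicholsAlgebra n) :
    twoDimRep i a 0 0 = counit (R := ℂ) a := by
  have := nichols_mem_of_mul_right
    (LinearMap.ker ((LinearMap.proj 0 ∘ₗ LinearMap.proj 0 : (Fin 2 → Fin 2 → ℂ) →ₗ[ℂ] ℂ) ∘ₗ
    (twoDimRep i).toLinearMap - counit)) ?_ ?_ ?_ a
  · exact sub_eq_zero.mp this
  · change twoDimRep i 1 0 0 - counit (R := ℂ) (1 : NicholsAlgebra n) = 0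
    simp
  · intro a (ha : twoDimRep i a 0 0 - counit (R := ℂ) a = 0)
    change twoDimRep i (a * K n) 0 0 - counit (R := ℂ) (a * K n) = 0
    simpa [twoDimRep_K, Matrix.mul_apply, Fin.sum_univ_two, counit_K] using ha
  · intro j a (ha : twoDimRep i a 0 0 - counit (R := ℂ) a = 0)
    change twoDimRep i (a * xi j) 0 0 - counit (R := ℂ) (a * xi j) = 0
    rw [map_mul, twoDimRep_xi, Bialgebra.counit_mul, counit_xi]
    split_ifs <;> simp [Matrix.mul_apply, Fin.sum_univ_two]

theorem twoDimRep_one_one (i : Fin n) (a : NicholsAlgebra n) :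
    twoDimRep i a 1 1 = signHom n a := by
  have := nichols_mem_of_mul_right
    (LinearMap.ker ((LinearMap.proj 1 ∘ₗ LinearMap.proj 1 : (Fin 2 → Fin 2 → ℂ) →ₗ[ℂ] ℂ) ∘ₗ
    (twoDimRep i).toLinearMap - (signHom n).toLinearMap)) ?_ ?_ ?_ a
  · exact sub_eq_zero.mp this
  · change twoDimRep i 1 1 1 - signHom n 1 = 0
    simp
  · intro a (ha : twoDimRep i a 1 1 - signHom n a = 0)
    change twoDimRep i (a * K n) 1 1 - signHom n (a * K n) = 0
    simp only [map_mul, twoDimRep_K, Matrix.mul_apply, Fin.sum_univ_two, signHom_K]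
    simp
    linear_combination -ha
  · intro j a (ha : twoDimRep i a 1 1 - signHom n a = 0)
    change twoDimRep i (a * xi j) 1 1 - signHom n (a * xi j) = 0
    rw [map_mul, twoDimRep_xi, map_mul, signHom_xi]
    split_ifs <;> simp [Matrix.mul_apply, Fin.sum_univ_two, twoDimRep_one_zero]

theorem xibarLin_mul (i : Fin n) (a b : NicholsAlgebra n) :
    xibarLin i (a * b) = counit (R := ℂ) a * xibarLin i b + xibarLin i a * signHom n b := by
  simp only [xibarLin_apply, map_mul, Matrix.mul_apply, Fin.sum_univ_two, twoDimRep_zero_zero,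
    twoDimRep_one_one]

@[simp] theorem xibarLin_one (i : Fin n) : xibarLin i 1 = 0 := by simp [xibarLin_apply]
@[simp] theorem xibarLin_K (i : Fin n) : xibarLin i (K n) = 0 := by
  simp [xibarLin_apply, twoDimRep_K]
theorem xibarLin_xi (i j : Fin n) : xibarLin i (xi j) = if j = i then 1 else 0 := by
  rw [xibarLin_apply, twoDimRep_xi]
  split_ifs <;> simp

theorem xibar_apply (i : Fin n) (a : NicholsAlgebra n) : (xibar i).eval a = xibarLin i a := rfl
theorem kbar_apply (a : NicholsAlgebra n) : (kbar n).eval a = signHom n a := rfl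

theorem dual_one_apply (a : NicholsAlgebra n) :
    (1 : DualNichols n).eval a = counit (R := ℂ) a := by
  change (1 : DualAlg ℂ (NicholsAlgebra n)) a = _
  rw [LinearMap.convOne_apply]; simp

section actR

variable {k H : Type*} [Field k] [Ring H] [HopfAlgebra k H]

/-- Right translation is compatible with the convolution product:
`(φψ)(- y) = ∑ φ(- y₍₁₎) ψ(- y₍₂₎)`. -/
theorem actR_conv (y : H) (φ ψ : DualAlg k H) :
    actR k H y (φ * ψ) = LinearMap.mul' k (DualAlg k H)
      (map ((actR k H).toLinearMap.flip φ) ((actR k H).toLinearMap.flip ψ) (comul y)) := by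
  ext x
  change (φ * ψ) (x * y) = _
  rw [LinearMap.convMul_apply, Bialgebra.comul_mul]
  generalize comul (R := k) y = u
  induction u with
  | zero => simp
  | add a b ha hb => rw [mul_add, map_add, map_add, ha, hb, map_add, map_add]; rfl
  | tmul a b =>
    simp only [map_tmul, LinearMap.mul'_apply, LinearMap.flip_apply, AlgHom.toLinearMap_apply]
    rw [LinearMap.convMul_apply]
    generalize comul (R := k) x = v
    induction v with
    | zero => simp
    | add p q hp hq => simp only [add_mul, map_add, hp, hq]
    | tmul p q => rw [Algebra.TensorProduct.tmul_mul_tmul]; rfl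

end actR

theorem translate_K_mul (φ ψ : DualNichols n) :
    translate (K n) (φ * ψ) = translate (K n) φ * translate (K n) ψ := by
  refine (actR_conv (K n) φ ψ).trans ?_
  rw [comul_K]; rfl

theorem translate_xi_mul (i : Fin n) (φ ψ : DualNichols n) :
    translate (xi i) (φ * ψ) = translate (K n) φ * translate (xi i) ψ + translate (xi i) φ * ψ := by
  refine (actR_conv (xi i) φ ψ).trans ?_
  rw [comul_xi, map_add, map_add]
  exact congrArg (fun χ : DualNichols n => translate (K n) φ * translate (xi i) ψ +
    translate (xi i) φ * χ) (LinearMap.congr_fun (map_one (actR ℂ (NicholsAlgebra n))) ψ)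

theorem dual_ext {φ ψ : DualNichols n} (h : ∀ a, φ.eval a = ψ.eval a) : φ = ψ :=
  (DualNichols.equivDual n).injective (LinearMap.ext h)

theorem translate_one (y : NicholsAlgebra n) :
    translate y (1 : DualNichols n) = counit (R := ℂ) y • 1 := by
  apply dual_ext
  intro x
  change (1 : DualNichols n).eval (x * y) = counit (R := ℂ) y • (1 : DualNichols n).eval x
  rw [dual_one_apply, dual_one_apply, Bialgebra.counit_mul, smul_eq_mul, mul_comm]

@[simp] theorem translate_K_one : translate (K n) (1 : DualNichols n) = 1 := by
  rw [translate_one, counit_K, one_smul]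
@[simp] theorem translate_xi_one (i : Fin n) :
    translate (xi i) (1 : DualNichols n) = 0 := by
  rw [translate_one, counit_xi, zero_smul]

@[simp] theorem translate_K_kbar : translate (K n) (kbar n) = -kbar n := by
  apply dual_ext
  intro x
  change signHom n (x * K n) = - signHom n x
  simp
@[simp] theorem translate_xi_kbar (i : Fin n) : translate (xi i) (kbar n) = 0 := by
  apply dual_ext
  intro x
  change signHom n (x * xi i) = 0
  simp
@[simp] theorem translate_K_xibar (i : Fin n) : translate (K n) (xibar i) = -xibar i := by
  apply dual_ext
  intro x
  change xibarLin i (x * K n) = -xibarLin i x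
  rw [xibarLin_mul]; simp
theorem translate_xi_xibar (i j : Fin n) :
    translate (xi i) (xibar j) = if i = j then 1 else 0 := by
  apply dual_ext
  intro x
  change xibarLin j (x * xi i) = _
  rw [xibarLin_mul, xibarLin_xi, signHom_xi]
  split_ifs
  · rw [dual_one_apply]; simp
  · rw [mul_zero, mul_zero, add_zero]; rfl

/-- A functional is determined by its behaviour under right translation by the generators. -/
theorem dual_eq_zero_of_translate (φ : DualNichols n) (h1 : φ.eval 1 = 0) (s : ℂ)
    (hK : translate (K n) φ = s • φ) (hx : ∀ i, translate (xi i) φ = 0) : φ = 0 := by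
  have : φ.eval = 0 := by
    apply nichols_linearMap_ext
    · exact h1
    · intro a ha
      have h : φ.eval (a * K n) = s • φ.eval a := by rw [← translate_eval, hK]; rfl
      exact h.trans (by rw [show φ.eval a = 0 from ha, smul_zero])
    · intro i a _
      have h : φ.eval (a * xi i) = 0 := by rw [← translate_eval, hx]; rfl
      exact h
  exact (DualNichols.equivDual n).injective this

theorem conv_apply_one (φ ψ : DualNichols n) : (φ * ψ).eval 1 = φ.eval 1 * ψ.eval 1 := by
  refine (LinearMap.convMul_apply _ _ _).trans ?_
  rw [Bialgebra.comul_one, Algebra.TensorProduct.one_def]; rfl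

theorem kbar_mul_kbar : kbar n * kbar n = 1 := by
  rw [← sub_eq_zero]
  apply dual_eq_zero_of_translate _ _ 1
  · rw [map_sub, translate_K_mul]; simp
  · intro i; rw [map_sub, translate_xi_mul]; simp
  · change (kbar n * kbar n).eval 1 - (1 : DualNichols n).eval 1 = 0
    rw [conv_apply_one, dual_one_apply, kbar_apply]; simp

theorem kbar_mul_xibar (i : Fin n) : kbar n * xibar i = -(xibar i * kbar n) := by
  rw [← add_eq_zero_iff_eq_neg]
  apply dual_eq_zero_of_translate _ _ 1
  · rw [map_add, translate_K_mul, translate_K_mul]; simp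
  · intro j; rw [map_add, translate_xi_mul, translate_xi_mul, translate_xi_xibar]; split_ifs <;> simp
  · change (kbar n * xibar i).eval 1 + (xibar i * kbar n).eval 1 = 0
    rw [conv_apply_one, conv_apply_one, xibar_apply]; simp

theorem xibar_mul_xibar (i j : Fin n) : xibar i * xibar j = -(xibar j * xibar i) := by
  rw [← add_eq_zero_iff_eq_neg]
  apply dual_eq_zero_of_translate _ _ 1
  · rw [map_add, translate_K_mul, translate_K_mul]; simp
  · intro l
    rw [map_add, translate_xi_mul, translate_xi_mul, translate_xi_xibar, translate_xi_xibar, translate_K_xibar,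
      translate_K_xibar]
    split_ifs <;> simp
  · change (xibar i * xibar j).eval 1 + (xibar j * xibar i).eval 1 = 0
    rw [conv_apply_one, conv_apply_one, xibar_apply]; simp

theorem xibar_mul_self (i : Fin n) : xibar i * xibar i = 0 :=
  by
  have h := xibar_mul_xibar i i
  rw [eq_neg_iff_add_eq_zero, ← two_smul ℂ] at h
  exact (smul_eq_zero.mp h).resolve_left two_ne_zero

/-! ### The canonical element of `𝒦ₙ ⊗ 𝒦ₙ^*` -/

/-- The algebra `𝒦ₙ ⊗ 𝒦ₙ^*`. -/
abbrev HDual (n : ℕ) : Type := NicholsAlgebra n ⊗[ℂ] DualNichols n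

/-- The group part `½ ∑ (-1)^{ab} K^a ⊗ K̄^b` of the canonical element. -/
def canonGroup (n : ℕ) : HDual n :=
  (1 / 2 : ℂ) • (1 ⊗ₜ 1 + 1 ⊗ₜ kbar n + K n ⊗ₜ 1 - K n ⊗ₜ kbar n)

/-- The product `∏ (1 + K ξᵢ ⊗ ξ̄ᵢ)` over a list of indices. -/
def canonOdd (l : List (Fin n)) : HDual n :=
  (l.map fun i => 1 + (K n * xi i) ⊗ₜ xibar i).prod

/-- The canonical element `∑ eᵢ ⊗ eⁱ` as a product. -/
def canon (n : ℕ) : HDual n := canonGroup n * canonOdd (List.finRange n)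

theorem lTensor_translate_K_mul (s t : HDual n) :
    (translate (K n)).lTensor (NicholsAlgebra n) (s * t) =
      (translate (K n)).lTensor _ s * (translate (K n)).lTensor _ t := by
  induction s using TensorProduct.induction_on with
  | zero => simp
  | add a b ha hb => simp only [add_mul, map_add, ha, hb]
  | tmul a φ =>
    induction t using TensorProduct.induction_on with
    | zero => simp
    | add a b ha hb => simp only [mul_add, map_add, ha, hb]
    | tmul b ψ => simp [translate_K_mul]

theorem lTensor_translate_xi_mul (i : Fin n) (s t : HDual n) :
    (translate (xi i)).lTensor (NicholsAlgebra n) (s * t) =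
      (translate (K n)).lTensor _ s * (translate (xi i)).lTensor _ t +
      (translate (xi i)).lTensor _ s * t := by
  induction s using TensorProduct.induction_on with
  | zero => simp
  | add a b ha hb => simp only [add_mul, map_add, ha, hb]; abel
  | tmul a φ =>
    induction t using TensorProduct.induction_on with
    | zero => simp
    | add a b ha hb => simp only [mul_add, map_add, ha, hb]; abel
    | tmul b ψ => simp [translate_xi_mul, tmul_add]

theorem lTensor_translate_K_canonGroup :
    (translate (K n)).lTensor _ (canonGroup n) = canonGroup n * K n ⊗ₜ 1 := by
  simp only [canonGroup, map_smul, map_sub, map_add, LinearMap.lTensor_tmul, translate_K_one,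
    translate_K_kbar, smul_mul_assoc, sub_mul, add_mul, Algebra.TensorProduct.tmul_mul_tmul, one_mul,
    mul_one, K_mul_K, tmul_neg]
  congr 1; abel

theorem lTensor_translate_xi_canonGroup (i : Fin n) :
    (translate (xi i)).lTensor _ (canonGroup n) = 0 := by
  simp [canonGroup]

theorem K_mul_canonOdd (l : List (Fin n)) :
    K n ⊗ₜ 1 * (translate (K n)).lTensor _ (canonOdd l) = canonOdd l * K n ⊗ₜ 1 := by
  induction l with
  | nil => simp [canonOdd, Algebra.TensorProduct.one_def]
  | cons i l ih =>
    have h : (K n ⊗ₜ 1 : HDual n) * (translate (K n)).lTensor _ (1 + (K n * xi i) ⊗ₜ xibar i) =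
        (1 + (K n * xi i) ⊗ₜ xibar i) * K n ⊗ₜ 1 := by
      simp only [Algebra.TensorProduct.one_def, map_add, LinearMap.lTensor_tmul, translate_K_one,
        translate_K_xibar, mul_add, add_mul, Algebra.TensorProduct.tmul_mul_tmul, one_mul, mul_one,
        ← mul_assoc, K_mul_K]
      rw [K_mul_xi, neg_mul, mul_assoc, K_mul_K, mul_one, neg_tmul, tmul_neg]
    simp only [canonOdd, List.map_cons, List.prod_cons] at ih ⊢
    rw [lTensor_translate_K_mul, ← mul_assoc, h, mul_assoc, ih, mul_assoc]

theorem Kxi_mul_canonOdd (i : Fin n) (l : List (Fin n)) :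
    (K n * xi i) ⊗ₜ 1 * canonOdd l =
      (translate (K n)).lTensor _ (canonOdd l) * (K n * xi i) ⊗ₜ 1 := by
  induction l with
  | nil => simp [canonOdd, Algebra.TensorProduct.one_def]
  | cons j l ih =>
    have h : ((K n * xi i) ⊗ₜ 1 : HDual n) * (1 + (K n * xi j) ⊗ₜ xibar j) =
        (translate (K n)).lTensor _ (1 + (K n * xi j) ⊗ₜ xibar j) * (K n * xi i) ⊗ₜ 1 := by
      have key : ∀ a b : Fin n, K n * xi a * (K n * xi b) = -(xi a * xi b) := by
        intro a b
        rw [K_mul_xi, neg_mul, mul_assoc, ← mul_assoc (K n), K_mul_K, one_mul]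
      simp only [Algebra.TensorProduct.one_def, map_add, LinearMap.lTensor_tmul, translate_K_one,
        translate_K_xibar, mul_add, add_mul, Algebra.TensorProduct.tmul_mul_tmul, one_mul, mul_one,
        key]
      rw [xi_mul_xi i j, neg_neg, tmul_neg, neg_tmul, neg_neg]
    simp only [canonOdd, List.map_cons, List.prod_cons] at ih ⊢
    rw [lTensor_translate_K_mul, ← mul_assoc, h, mul_assoc, ih, mul_assoc]

/-- Right translation by `ξᵢ` acts on the product `∏ (1 + K ξᵢ ⊗ ξ̄ᵢ)` as a skew derivation, which
only sees the factor with index `i`. -/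
theorem lTensor_translate_xi_canonOdd (i : Fin n) (l : List (Fin n)) (hl : l.Nodup) :
    (translate (xi i)).lTensor _ (canonOdd l) =
      if i ∈ l then (translate (K n)).lTensor _ (canonOdd l) * (K n * xi i) ⊗ₜ 1 else 0 := by
  induction l with
  | nil => simp [canonOdd, Algebra.TensorProduct.one_def]
  | cons j l ih =>
    obtain ⟨hj, hl⟩ := List.nodup_cons.mp hl
    have ih := ih hl
    have hK := Kxi_mul_canonOdd i l
    have hx : (translate (xi i)).lTensor _ (1 + (K n * xi j) ⊗ₜ xibar j : HDual n) =
        if i = j then (K n * xi j) ⊗ₜ 1 else 0 := by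
      rw [Algebra.TensorProduct.one_def, map_add, LinearMap.lTensor_tmul, LinearMap.lTensor_tmul,
        translate_xi_one, translate_xi_xibar, tmul_zero, zero_add]
      split_ifs <;> simp
    have hc : canonOdd (j :: l) = (1 + (K n * xi j) ⊗ₜ xibar j) * canonOdd l := by
      simp [canonOdd]
    rw [hc, lTensor_translate_xi_mul, lTensor_translate_K_mul, hx, ih]
    by_cases hij : i = j
    · subst hij
      have key : (K n * xi i) * (K n * xi i) = 0 := by
        rw [K_mul_xi, neg_mul_neg, mul_assoc, ← mul_assoc (K n), K_mul_xi, neg_mul, mul_neg,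
          mul_assoc, K_mul_K, mul_one, xi_mul_self, neg_zero]
      simp only [hj, if_true, if_false, mul_zero, zero_add, List.mem_cons_self]
      rw [mul_assoc, ← hK, ← mul_assoc, Algebra.TensorProduct.one_def, map_add, add_mul]
      simp [key]
    · simp only [hij, if_false, zero_mul, add_zero, List.mem_cons, false_or]
      split_ifs
      · rw [mul_assoc]
      · rw [mul_zero]

theorem lTensor_translate_K_canon :
    (translate (K n)).lTensor _ (canon n) = canon n * K n ⊗ₜ 1 := by
  rw [canon, lTensor_translate_K_mul, lTensor_translate_K_canonGroup, mul_assoc, K_mul_canonOdd, mul_assoc]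

theorem lTensor_translate_xi_canon (i : Fin n) :
    (translate (xi i)).lTensor _ (canon n) = canon n * xi i ⊗ₜ 1 := by
  rw [canon, lTensor_translate_xi_mul, lTensor_translate_xi_canonGroup, zero_mul, add_zero,
    lTensor_translate_K_canonGroup, lTensor_translate_xi_canonOdd i _ (List.nodup_finRange n),
    if_pos (List.mem_finRange i), mul_assoc, ← mul_assoc (K n ⊗ₜ 1), K_mul_canonOdd, mul_assoc,
    mul_assoc]
  congr 2
  rw [Algebra.TensorProduct.tmul_mul_tmul, ← mul_assoc, K_mul_K, one_mul, one_mul]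

/-- Evaluation of the second leg of an element of `𝒦ₙ ⊗ 𝒦ₙ^*`. -/
def evalSnd (a : NicholsAlgebra n) : HDual n →ₗ[ℂ] NicholsAlgebra n :=
  (TensorProduct.rid ℂ _).toLinearMap ∘ₗ LinearMap.lTensor _
    ((LinearMap.applyₗ a : (NicholsAlgebra n →ₗ[ℂ] ℂ) →ₗ[ℂ] ℂ) ∘ₗ
      (DualNichols.equivDual n).toLinearMap)

theorem evalSnd_tmul (a b : NicholsAlgebra n) (φ : DualNichols n) :
    evalSnd a (b ⊗ₜ φ) = φ.eval a • b := by
  simp only [evalSnd, LinearMap.comp_apply, LinearMap.lTensor_tmul, LinearEquiv.coe_coe,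
    TensorProduct.rid_tmul]
  rfl

theorem evalSnd_mul (a b : NicholsAlgebra n) (t : HDual n) :
    evalSnd (a * b) t = evalSnd a ((translate b).lTensor _ t) := by
  induction t using TensorProduct.induction_on with
  | zero => simp
  | add s t hs ht => simp only [map_add, hs, ht]
  | tmul c φ => rw [LinearMap.lTensor_tmul, evalSnd_tmul, evalSnd_tmul, translate_eval]

theorem evalSnd_mul_tmul_one (a b : NicholsAlgebra n) (t : HDual n) :
    evalSnd a (t * b ⊗ₜ 1) = evalSnd a t * b := by
  induction t using TensorProduct.induction_on with
  | zero => simp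
  | add s t hs ht => simp only [add_mul, map_add, hs, ht]
  | tmul c φ =>
    rw [Algebra.TensorProduct.tmul_mul_tmul, mul_one, evalSnd_tmul, evalSnd_tmul, smul_mul_assoc]

theorem evalSnd_one_mul (s t : HDual n) :
    evalSnd 1 (s * t) = evalSnd 1 s * evalSnd 1 t := by
  induction s using TensorProduct.induction_on with
  | zero => simp
  | add a b ha hb => simp only [add_mul, map_add, ha, hb]
  | tmul a φ =>
    induction t using TensorProduct.induction_on with
    | zero => simp
    | add a b ha hb => simp only [mul_add, map_add, ha, hb]
    | tmul b ψ => simp [evalSnd_tmul, conv_apply_one, smul_smul, mul_comm]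

/-- The second leg of the product formula is dual to the first one: both sides behave in the same
way under right multiplication of `a` by the generators, and agree for `a = 1`. -/
theorem evalSnd_canon (a : NicholsAlgebra n) : evalSnd a (canon n) = a := by
  let ev : NicholsAlgebra n →ₗ[ℂ] HDual n →ₗ[ℂ] NicholsAlgebra n :=
    { toFun := evalSnd
      map_add' := fun a b => by
        apply TensorProduct.ext'
        intro c φ
        rw [LinearMap.add_apply, evalSnd_tmul, evalSnd_tmul, evalSnd_tmul, ← add_smul]
        congr 1
        exact map_add φ.eval a b
      map_smul' := fun r a => by
        apply TensorProduct.ext'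
        intro c φ
        rw [LinearMap.smul_apply, evalSnd_tmul, evalSnd_tmul, smul_smul]
        congr 1
        exact map_smul φ.eval r a }
  have := nichols_mem_of_mul_right (LinearMap.ker (ev.flip (canon n) - LinearMap.id)) ?_ ?_ ?_ a
  · exact sub_eq_zero.mp this
  · change evalSnd 1 (canon n) - 1 = 0
    have hl : ∀ l : List (Fin n), evalSnd 1 (canonOdd l) = 1 := by
      intro l
      induction l with
      | nil => simp [canonOdd, Algebra.TensorProduct.one_def, evalSnd_tmul, dual_one_apply]
      | cons i l ih =>
        simp only [canonOdd, List.map_cons, List.prod_cons] at ih ⊢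
        rw [evalSnd_one_mul, ih]
        simp [Algebra.TensorProduct.one_def, evalSnd_tmul, dual_one_apply, xibar_apply]
    rw [canon, evalSnd_one_mul, hl, mul_one, canonGroup]
    simp only [map_smul, map_add, map_sub, evalSnd_tmul, dual_one_apply, kbar_apply, map_one,
      Bialgebra.counit_one, one_smul]
    rw [add_sub_cancel_right, ← two_smul ℂ, smul_smul]
    norm_num
  · intro a (ha : evalSnd a (canon n) - a = 0)
    change evalSnd (a * K n) (canon n) - a * K n = 0
    rw [evalSnd_mul, lTensor_translate_K_canon, evalSnd_mul_tmul_one, sub_eq_zero.mp ha, sub_self]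
  · intro i a (ha : evalSnd a (canon n) - a = 0)
    change evalSnd (a * xi i) (canon n) - a * xi i = 0
    rw [evalSnd_mul, lTensor_translate_xi_canon, evalSnd_mul_tmul_one, sub_eq_zero.mp ha, sub_self]

/-- The generators `K̄`, `ξ̄ᵢ` of `𝒦ₙ^*`, as a set. -/
def dualGens (n : ℕ) : Set (DualNichols n) := insert (kbar n) (Set.range xibar)

/-- Each functional is a slice of the canonical element, which lies in `𝒦ₙ ⊗ B` for the
subalgebra `B` generated by `K̄` and the `ξ̄ᵢ`. -/
theorem adjoin_dualGens : Algebra.adjoin ℂ (dualGens n) = ⊤ := by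
  set B := Algebra.adjoin ℂ (dualGens n) with hB
  rw [eq_top_iff]
  rintro φ -
  let T : Subalgebra ℂ (HDual n) :=
    (Algebra.TensorProduct.map (AlgHom.id ℂ (NicholsAlgebra n)) B.val).range
  have htm : ∀ (a : NicholsAlgebra n) (ψ : DualNichols n), ψ ∈ B → a ⊗ₜ ψ ∈ T :=
    fun a ψ hψ => ⟨a ⊗ₜ ⟨ψ, hψ⟩, by simp⟩
  have hk : kbar n ∈ B := Algebra.subset_adjoin (Set.mem_insert _ _)
  have hx : ∀ i, xibar i ∈ B :=
    fun i => Algebra.subset_adjoin (Set.mem_insert_of_mem _ ⟨i, rfl⟩)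
  have hmem : canon n ∈ T := by
    refine T.mul_mem (T.smul_mem (T.sub_mem (T.add_mem (T.add_mem ?_ ?_) ?_) ?_) _) ?_
    · exact htm _ _ B.one_mem
    · exact htm _ _ hk
    · exact htm _ _ B.one_mem
    · exact htm _ _ hk
    · refine T.list_prod_mem ?_
      intro t ht
      obtain ⟨i, -, rfl⟩ := List.mem_map.mp ht
      exact T.add_mem T.one_mem (htm _ _ (hx i))
  obtain ⟨t, ht⟩ := hmem
  have key : ∀ t : NicholsAlgebra n ⊗[ℂ] B, ∃ ψ ∈ B, ∀ a, φ.eval (evalSnd a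
      (Algebra.TensorProduct.map (AlgHom.id ℂ (NicholsAlgebra n)) B.val t)) = ψ.eval a := by
    intro t
    induction t using TensorProduct.induction_on with
    | zero => exact ⟨0, B.zero_mem, fun a => by simp; rfl⟩
    | add s t hs ht =>
      obtain ⟨ψ, h1, h2⟩ := hs
      obtain ⟨χ, h3, h4⟩ := ht
      refine ⟨ψ + χ, B.add_mem h1 h3, fun a => ?_⟩
      rw [map_add, map_add]
      exact (map_add φ.eval _ _).trans (congrArg₂ _ (h2 a) (h4 a))
    | tmul b ψ =>
      refine ⟨φ.eval b • ψ.1, B.smul_mem ψ.2 _, fun a => ?_⟩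
      rw [Algebra.TensorProduct.map_tmul, evalSnd_tmul]
      refine (map_smul φ.eval _ _).trans ?_
      rw [smul_eq_mul, mul_comm]
      rfl
  obtain ⟨ψ, h1, h2⟩ := key t
  have : φ = ψ := dual_ext fun a => by
    have h3 : Algebra.TensorProduct.map (AlgHom.id ℂ (NicholsAlgebra n)) B.val t = canon n := ht
    rw [← h2, h3, evalSnd_canon]
  rw [this]
  exact h1

/-- The product formula for the canonical element of `𝒦ₙ ⊗ 𝒦ₙ^*`. -/
theorem coevaluation_eq_canon :
    map .id (DualNichols.equivDual n).symm.toLinearMap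
      (coevaluation ℂ (NicholsAlgebra n) 1) = canon n := by
  let b := Module.finBasis ℂ (NicholsAlgebra n)
  have hco : ∀ a, evalSnd a (map .id
      (DualNichols.equivDual n).symm.toLinearMap
      (coevaluation ℂ (NicholsAlgebra n) 1)) = a := by
    intro a
    rw [coevaluation_apply_one]
    simp only [map_sum, map_tmul, evalSnd_tmul]
    exact (Module.Basis.ofVectorSpace ℂ (NicholsAlgebra n)).sum_repr a
  have hinj : ∀ t : HDual n, (∀ a, evalSnd a t = 0) → t = 0 := by
    intro t ht
    apply (LinearEquiv.lTensor (NicholsAlgebra n)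
      (DualNichols.equivDual n) ≪≫ₗ TensorProduct.comm ℂ _ _ ≪≫ₗ
      dualTensorHomEquivOfBasis (N := NicholsAlgebra n) b).injective
    rw [map_zero]
    ext a
    rw [LinearMap.zero_apply, ← ht a]
    clear ht
    induction t using TensorProduct.induction_on with
    | zero => simp
    | add s t hs ht => simp only [map_add, LinearMap.add_apply, hs, ht]
    | tmul c φ =>
      rw [evalSnd_tmul]
      simp [dualTensorHomEquivOfBasis]
      rfl
  rw [← sub_eq_zero]
  apply hinj
  intro a
  rw [map_sub, hco, evalSnd_canon, sub_self]

end

section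

variable {n : ℕ}

/-! ### Generators and relations of the Drinfeld double -/

/-- The Drinfeld double of `𝒦ₙ`. -/
abbrev Dbl (n : ℕ) : Type := DrinfeldDouble ℂ (NicholsAlgebra n)

/-- The element `φ ⊗ h` of the double. -/
def elt (φ : DualNichols n) : NicholsAlgebra n →ₗ[ℂ] Dbl n :=
  DrinfeldDouble.mk (show DualAlg ℂ (NicholsAlgebra n) from φ)

theorem elt_add (φ ψ : DualNichols n) (h : NicholsAlgebra n) :
    elt (φ + ψ) h = elt φ h + elt ψ h :=
  LinearMap.congr_fun (map_add (DrinfeldDouble.mk (k := ℂ) (H := NicholsAlgebra n)) _ _) h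

theorem elt_smul (r : ℂ) (φ : DualNichols n) (h : NicholsAlgebra n) :
    elt (r • φ) h = r • elt φ h :=
  LinearMap.congr_fun (map_smul (DrinfeldDouble.mk (k := ℂ) (H := NicholsAlgebra n)) _ _) h

theorem dbl_mem (P : Submodule ℂ (Dbl n)) (h : ∀ φ a, elt φ a ∈ P) (x : Dbl n) : x ∈ P := by
  refine TensorProduct.induction_on
    (motive := fun x : DualAlg ℂ (NicholsAlgebra n) ⊗[ℂ] NicholsAlgebra n => x ∈ P)
    x P.zero_mem (fun φ a => h φ a) (fun a b ha hb => P.add_mem ha hb)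

theorem dbl_hom_ext {V : Type*} [AddCommGroup V] [Module ℂ V] {f g : Dbl n →ₗ[ℂ] V}
    (h : ∀ φ a, f (elt φ a) = g (elt φ a)) : f = g := by
  ext x
  exact sub_eq_zero.mp (dbl_mem (LinearMap.ker (f - g)) (fun φ a => sub_eq_zero.mpr (h φ a)) x)

theorem ofHopf_mul_elt (h a : NicholsAlgebra n) (φ : DualNichols n) :
    ofHopf h * elt φ a = tripleAct ℂ (NicholsAlgebra n) (map comul .id (comul h))
      ((show DualAlg ℂ (NicholsAlgebra n) from φ) ⊗ₜ a) := by
  refine (mk_mul_mk 1 (show DualAlg ℂ (NicholsAlgebra n) from φ) h a).trans ?_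
  rw [map_one]
  rfl

/-- The inclusion `𝒦ₙ → D` as a homomorphism of algebras. -/
def ofH (n : ℕ) : NicholsAlgebra n →ₐ[ℂ] Dbl n :=
  AlgHom.ofLinearMap (ofHopf (k := ℂ) (H := NicholsAlgebra n)) rfl (by
    intro a b
    have h1 : (ofHopf b : Dbl n) = rightMul b (1 ⊗ₜ 1) := by
      rw [rightMul_tmul, one_mul]; rfl
    have h2 : (ofHopf a : Dbl n) * (1 : Dbl n) =
        mulLeftMap ℂ (NicholsAlgebra n) (1 ⊗ₜ a) (1 ⊗ₜ 1) := rfl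
    have h3 : (ofHopf a : Dbl n) * (ofHopf b : Dbl n) =
        mulLeftMap ℂ (NicholsAlgebra n) (1 ⊗ₜ a) (rightMul b (1 ⊗ₜ 1)) := by
      rw [← h1]; rfl
    rw [h3, mulLeftMap_rightMul_apply, ← h2, mul_one]
    rfl)

/-- The inclusion `𝒦ₙ^* → D` as a homomorphism of algebras. -/
def ofHd (n : ℕ) : DualNichols n →ₐ[ℂ] Dbl n :=
  AlgHom.ofLinearMap
    { toFun := fun φ => ofDual (show DualAlg ℂ (NicholsAlgebra n) from φ)
      map_add' := fun φ ψ => map_add (ofDual (k := ℂ) (H := NicholsAlgebra n)) _ _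
      map_smul' := fun r φ => map_smul (ofDual (k := ℂ) (H := NicholsAlgebra n)) _ _ } rfl (by
    intro φ ψ
    refine Eq.symm ((mk_mul_mk (show DualAlg ℂ (NicholsAlgebra n) from φ)
      (show DualAlg ℂ (NicholsAlgebra n) from ψ) 1 1).trans ?_)
    rw [Bialgebra.comul_one, Algebra.TensorProduct.one_def, map_tmul, Bialgebra.comul_one]
    change dualMulLeft ℂ (NicholsAlgebra n) _
      (tripleAct ℂ (NicholsAlgebra n) 1 (_ ⊗ₜ 1)) = _
    rw [map_one]
    rfl)

theorem elt_eq (φ : DualNichols n) (a : NicholsAlgebra n) : elt φ a = ofHd n φ * ofH n a :=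
  (ofDual_mul_ofHopf _ _).symm

theorem ofHd_mul_elt (φ ψ : DualNichols n) (a : NicholsAlgebra n) :
    ofHd n φ * elt ψ a = elt (φ * ψ) a := by
  rw [elt_eq, elt_eq, map_mul, mul_assoc]

/-- The left translation `φ ↦ φ(S⁻¹(a) -)` of functionals. -/
def coTranslate (a : NicholsAlgebra n) : DualNichols n →ₗ[ℂ] DualNichols n where
  toFun φ := actL ℂ (NicholsAlgebra n) a φ
  map_add' φ ψ := map_add (actL ℂ (NicholsAlgebra n) a) φ ψ
  map_smul' r φ := map_smul (actL ℂ (NicholsAlgebra n) a) r φ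

theorem coTranslate_eval (a b : NicholsAlgebra n) (φ : DualNichols n) :
    (coTranslate a φ).eval b = φ.eval (AntipodeInverse.inv (k := ℂ) a * b) := rfl

theorem inv_K : AntipodeInverse.inv (k := ℂ) (K n) = K n := by
  change antipodeLin n (antipodeLin n (antipodeLin n (K n))) = _
  simp only [antipodeLin_K]

theorem inv_xi (i : Fin n) : AntipodeInverse.inv (k := ℂ) (xi i) = K n * xi i := by
  change antipodeLin n (antipodeLin n (antipodeLin n (xi i))) = _
  simp only [antipodeLin_xi, map_neg, antipodeLin_mul, antipodeLin_K]
  rw [K_mul_xi]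
  simp only [mul_neg, neg_neg, mul_assoc, K_mul_K, mul_one]
  rw [K_mul_xi]

theorem translate_one_apply (φ : DualNichols n) : translate 1 φ = φ :=
  LinearMap.congr_fun (map_one (actR ℂ (NicholsAlgebra n))) φ

theorem coTranslate_one_apply (φ : DualNichols n) : coTranslate 1 φ = φ :=
  LinearMap.congr_fun (map_one (actL ℂ (NicholsAlgebra n))) φ

theorem translate_mul (a b : NicholsAlgebra n) (φ : DualNichols n) :
    translate (a * b) φ = translate a (translate b φ) :=
  LinearMap.congr_fun (map_mul (actR ℂ (NicholsAlgebra n)) a b) φ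

theorem translate_neg (a : NicholsAlgebra n) (φ : DualNichols n) :
    translate (-a) φ = -translate a φ :=
  LinearMap.congr_fun (map_neg (actR ℂ (NicholsAlgebra n)) a) φ

theorem translate_coTranslate (a b : NicholsAlgebra n) (φ : DualNichols n) :
    translate a (coTranslate b φ) = coTranslate b (translate a φ) :=
  LinearMap.congr_fun (actR_comm_actL ℂ (NicholsAlgebra n) a b) φ

theorem K_mul_elt (a : NicholsAlgebra n) (φ : DualNichols n) :
    ofH n (K n) * elt φ a = elt (translate (K n) (coTranslate (K n) φ)) (K n * a) := by
  refine (ofHopf_mul_elt (K n) a φ).trans ?_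
  rw [comul_K, map_tmul, comul_K, LinearMap.id_apply]
  exact tripleAct_tmul ..

theorem xi_mul_elt (i : Fin n) (a : NicholsAlgebra n) (φ : DualNichols n) :
    ofH n (xi i) * elt φ a = elt (translate (K n) (coTranslate (xi i) φ)) (K n * a) +
      elt (translate (K n) φ) (xi i * a) + elt (translate (xi i) φ) a := by
  refine (ofHopf_mul_elt (xi i) a φ).trans ?_
  rw [comul_xi, map_add, map_tmul, map_tmul, comul_K, comul_xi,
    LinearMap.id_apply, LinearMap.id_apply, add_tmul, ← add_assoc, map_add, map_add,
    LinearMap.add_apply, LinearMap.add_apply]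
  have h1 := coTranslate_one_apply φ
  refine congrArg₂ _ (congrArg₂ _ ?_ ?_) ?_
  · exact tripleAct_tmul ..
  · refine (tripleAct_tmul ..).trans ?_
    exact congrArg (fun ψ => elt (translate (K n) ψ) (xi i * a)) h1
  · refine (tripleAct_tmul ..).trans ?_
    rw [one_mul]
    exact congrArg (fun ψ => elt (translate (xi i) ψ) a) h1

/-- The generator `K` of the double. -/
def gK (n : ℕ) : Dbl n := ofH n (K n)

/-- The generator `K̄` of the double. -/
def gKb (n : ℕ) : Dbl n := ofHd n (kbar n)

/-- The generator `ξᵢ` of the double. -/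
def gx (i : Fin n) : Dbl n := ofH n (xi i)

/-- The generator `ξ̄ᵢ` of the double. -/
def gy (i : Fin n) : Dbl n := ofHd n (xibar i)

theorem elt_neg (φ : DualNichols n) (a : NicholsAlgebra n) : elt (-φ) a = -elt φ a := by
  rw [elt_eq, elt_eq, map_neg, neg_mul]

theorem ofHd_eq_elt (φ : DualNichols n) : ofHd n φ = elt φ 1 := rfl
theorem ofH_eq_elt (a : NicholsAlgebra n) : ofH n a = elt 1 a := rfl

theorem coTranslate_K_kbar : coTranslate (K n) (kbar n) = -kbar n := by
  apply dual_ext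
  intro a
  rw [coTranslate_eval, inv_K]
  change signHom n (K n * a) = -signHom n a
  simp

theorem coTranslate_K_xibar (i : Fin n) : coTranslate (K n) (xibar i) = xibar i := by
  apply dual_ext
  intro a
  rw [coTranslate_eval, inv_K, xibar_apply, xibar_apply, xibarLin_mul]
  simp [counit_K]

theorem coTranslate_xi_kbar (i : Fin n) : coTranslate (xi i) (kbar n) = 0 := by
  apply dual_ext
  intro a
  rw [coTranslate_eval, inv_xi, kbar_apply, map_mul, map_mul, signHom_xi, mul_zero, zero_mul]
  rfl

theorem coTranslate_xi_xibar (i j : Fin n) :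
    coTranslate (xi i) (xibar j) = if i = j then kbar n else 0 := by
  apply dual_ext
  intro a
  rw [coTranslate_eval, inv_xi, xibar_apply, xibarLin_mul, xibarLin_mul, Bialgebra.counit_mul,
    counit_xi, counit_K, xibarLin_xi, xibarLin_K]
  split_ifs
  · simp [kbar_apply]
  · simp; rfl

theorem gK_mul_gK : gK n * gK n = 1 := by rw [gK, ← map_mul, K_mul_K, map_one]
theorem gKb_mul_gKb : gKb n * gKb n = 1 := by rw [gKb, ← map_mul, kbar_mul_kbar, map_one]
theorem gK_mul_gx (i : Fin n) : gK n * gx i = -(gx i * gK n) := by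
  rw [gK, gx, ← map_mul, K_mul_xi, map_neg, map_mul]
theorem gKb_mul_gy (i : Fin n) : gKb n * gy i = -(gy i * gKb n) := by
  rw [gKb, gy, ← map_mul, kbar_mul_xibar, map_neg, map_mul]
theorem gx_mul_gx (i j : Fin n) : gx i * gx j = -(gx j * gx i) := by
  rw [gx, gx, ← map_mul, xi_mul_xi, map_neg, map_mul]
theorem gy_mul_gy (i j : Fin n) : gy i * gy j = -(gy j * gy i) := by
  rw [gy, gy, ← map_mul, xibar_mul_xibar, map_neg, map_mul]
theorem gx_mul_self (i : Fin n) : gx i * gx i = 0 := by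
  rw [gx, ← map_mul, xi_mul_self, map_zero]
theorem gy_mul_self (i : Fin n) : gy i * gy i = 0 := by
  rw [gy, ← map_mul, xibar_mul_self, map_zero]

theorem gK_mul_gKb : gK n * gKb n = gKb n * gK n := by
  rw [gKb, ofHd_eq_elt, gK, K_mul_elt, coTranslate_K_kbar, map_neg, translate_K_kbar, neg_neg,
    mul_one, elt_eq, ← ofHd_eq_elt]

theorem gK_mul_gy (i : Fin n) : gK n * gy i = -(gy i * gK n) := by
  rw [gy, ofHd_eq_elt, gK, K_mul_elt, coTranslate_K_xibar, translate_K_xibar, elt_neg,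
    mul_one, elt_eq, ← ofHd_eq_elt]

theorem gx_mul_gKb (i : Fin n) : gx i * gKb n = -(gKb n * gx i) := by
  rw [gKb, ofHd_eq_elt, gx, xi_mul_elt, coTranslate_xi_kbar, map_zero, translate_K_kbar,
    translate_xi_kbar, elt_neg, mul_one, mul_one, elt_eq, elt_eq, elt_eq, elt_eq]
  simp

theorem gx_mul_gy (i j : Fin n) :
    gx i * gy j = -(gy j * gx i) + if i = j then 1 - gKb n * gK n else 0 := by
  rw [gy, ofHd_eq_elt, gx, xi_mul_elt, coTranslate_xi_xibar, translate_K_xibar,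
    translate_xi_xibar, elt_neg, mul_one, mul_one]
  split_ifs
  · rw [translate_K_kbar, elt_neg, elt_eq, elt_eq, elt_eq, elt_eq, gKb, gK]
    simp only [map_one, mul_one]
    abel
  · rw [map_zero, elt_eq, elt_eq, elt_eq, elt_eq]
    simp

/-- The generators of the double, as a set. -/
def dblGens (n : ℕ) : Set (Dbl n) :=
  insert (gK n) (insert (gKb n) (Set.range gx ∪ Set.range gy))

theorem ofH_mem_adjoin (a : NicholsAlgebra n) : ofH n a ∈ Algebra.adjoin ℂ (dblGens n) := by
  have : (⊤ : Subalgebra ℂ (NicholsAlgebra n)) ≤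
      (Algebra.adjoin ℂ (dblGens n)).comap (ofH n) := by
    rw [← adjoin_nicholsGens]
    refine Algebra.adjoin_le ?_
    rintro _ (rfl | ⟨i, rfl⟩)
    · exact Algebra.subset_adjoin (Set.mem_insert _ _)
    · exact Algebra.subset_adjoin (Or.inr (Or.inr (Or.inl ⟨i, rfl⟩)))
  exact this trivial

theorem ofHd_mem_adjoin (φ : DualNichols n) : ofHd n φ ∈ Algebra.adjoin ℂ (dblGens n) := by
  have : (⊤ : Subalgebra ℂ (DualNichols n)) ≤
      (Algebra.adjoin ℂ (dblGens n)).comap (ofHd n) := by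
    rw [← adjoin_dualGens]
    refine Algebra.adjoin_le ?_
    rintro _ (rfl | ⟨i, rfl⟩)
    · exact Algebra.subset_adjoin (Or.inr (Set.mem_insert _ _))
    · exact Algebra.subset_adjoin (Or.inr (Or.inr (Or.inr ⟨i, rfl⟩)))
  exact this trivial

theorem adjoin_dblGens : Algebra.adjoin ℂ (dblGens n) = ⊤ := by
  rw [eq_top_iff]
  rintro x -
  refine dbl_mem (Subalgebra.toSubmodule (Algebra.adjoin ℂ (dblGens n))) (fun φ a => ?_) x
  rw [elt_eq]
  exact Subalgebra.mul_mem _ (ofHd_mem_adjoin φ) (ofH_mem_adjoin a)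

/-! ### Multiplicative linear maps out of the double -/

/-- A linear map out of the double that is multiplicative on `𝒦ₙ^*` and on `𝒦ₙ`, compatible with
`φ ⊗ h = φ h`, and respects the four straightening relations between the generators of the two
subalgebras, is multiplicative. -/
theorem map_mul_of_relations {B : Type*} [Ring B] [Algebra ℂ B] (f : Dbl n →ₗ[ℂ] B)
    (hH : ∀ a b, f (ofH n (a * b)) = f (ofH n a) * f (ofH n b))
    (hD : ∀ φ ψ, f (ofHd n (φ * ψ)) = f (ofHd n φ) * f (ofHd n ψ))
    (hmk : ∀ φ a, f (elt φ a) = f (ofHd n φ) * f (ofH n a))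
    (h1 : f 1 = 1)
    (hKK : f (gK n) * f (gKb n) = f (gKb n) * f (gK n))
    (hKy : ∀ i, f (gK n) * f (gy i) = -(f (gy i) * f (gK n)))
    (hxK : ∀ i, f (gx i) * f (gKb n) = -(f (gKb n) * f (gx i)))
    (hxy : ∀ i j, f (gx i) * f (gy j) =
      -(f (gy j) * f (gx i)) + if i = j then 1 - f (gKb n) * f (gK n) else 0)
    (a b : Dbl n) : f (a * b) = f a * f b := by
  have hDmul : ∀ φ z, f (ofHd n φ * z) = f (ofHd n φ) * f z := by
    intro φ z
    refine dbl_mem (LinearMap.eqLocus (f ∘ₗ LinearMap.mulLeft ℂ (ofHd n φ))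
      (LinearMap.mulLeft ℂ (f (ofHd n φ)) ∘ₗ f)) (fun ψ a => ?_) z
    change f (ofHd n φ * elt ψ a) = f (ofHd n φ) * f (elt ψ a)
    rw [ofHd_mul_elt, hmk, hmk, hD, mul_assoc]
  -- to prove that `f` respects left multiplication by `g`, it is enough to do so on `𝒦ₙ`
  -- and to move `g` past `K̄` and the `ξ̄ᵢ`
  have main : ∀ g : Dbl n, (∀ a, f (g * ofH n a) = f g * f (ofH n a)) →
      (∀ z, f (g * z) = f g * f z → f (g * (gKb n * z)) = f g * f (gKb n * z)) →
      (∀ i z, f (g * z) = f g * f z → f (g * (gy i * z)) = f g * f (gy i * z)) →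
      ∀ z, f (g * z) = f g * f z := by
    intro g h1 h2 h3
    have key : ∀ φ : DualNichols n, ∀ a, f (g * (ofHd n φ * ofH n a)) =
        f g * f (ofHd n φ * ofH n a) := by
      intro φ a
      refine mem_of_mul_left_mem adjoin_dualGens
        (LinearMap.eqLocus (f ∘ₗ LinearMap.mulLeft ℂ g ∘ₗ LinearMap.mulRight ℂ (ofH n a) ∘ₗ
          (ofHd n).toLinearMap)
          (LinearMap.mulLeft ℂ (f g) ∘ₗ f ∘ₗ LinearMap.mulRight ℂ (ofH n a) ∘ₗ
          (ofHd n).toLinearMap)) ?_ ?_ φ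
      · change f (g * (ofHd n 1 * ofH n a)) = f g * f (ofHd n 1 * ofH n a)
        rw [map_one, one_mul, h1]
      · rintro s (rfl | ⟨i, rfl⟩) φ hφ
        · change f (g * (ofHd n (kbar n * φ) * ofH n a)) =
            f g * f (ofHd n (kbar n * φ) * ofH n a)
          rw [map_mul (ofHd n), mul_assoc]
          exact h2 _ hφ
        · change f (g * (ofHd n (xibar i * φ) * ofH n a)) =
            f g * f (ofHd n (xibar i * φ) * ofH n a)
          rw [map_mul (ofHd n), mul_assoc]
          exact h3 _ _ hφ
    intro z
    refine dbl_mem (LinearMap.eqLocus (f ∘ₗ LinearMap.mulLeft ℂ g)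
      (LinearMap.mulLeft ℂ (f g) ∘ₗ f)) (fun φ a => ?_) z
    change f (g * elt φ a) = f g * f (elt φ a)
    rw [elt_eq, key]
  have hKmul : ∀ z, f (gK n * z) = f (gK n) * f z := by
    refine main _ (fun a => ?_) (fun z hz => ?_) (fun i z hz => ?_)
    · rw [gK, ← map_mul, hH]
    · rw [← mul_assoc, gK_mul_gKb, mul_assoc, gKb, hDmul, hDmul, hz, ← mul_assoc, ← mul_assoc]
      exact congrArg (· * f z) hKK.symm
    · rw [← mul_assoc, gK_mul_gy, neg_mul, map_neg, mul_assoc, gy, hDmul, hDmul, hz,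
        ← mul_assoc, ← mul_assoc, ← neg_mul]
      exact congrArg (· * f z) (hKy i).symm
  have hxmul : ∀ j z, f (gx j * z) = f (gx j) * f z := by
    intro j
    refine main _ (fun a => ?_) (fun z hz => ?_) (fun i z hz => ?_)
    · rw [gx, ← map_mul, hH]
    · rw [← mul_assoc, gx_mul_gKb, neg_mul, map_neg, mul_assoc, gKb, hDmul, hDmul, hz,
        ← mul_assoc, ← mul_assoc, ← neg_mul]
      exact congrArg (· * f z) (hxK j).symm
    · have h4 : f (gy i * z) = f (gy i) * f z := hDmul _ _
      have h5 : f (gy i * (gx j * z)) = f (gy i) * f (gx j * z) := hDmul _ _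
      have h6 : f (gKb n * (gK n * z)) = f (gKb n) * f (gK n * z) := hDmul _ _
      rw [← mul_assoc, gx_mul_gy, add_mul, neg_mul, mul_assoc, map_add, map_neg, h4, h5, hz,
        ← mul_assoc, ← mul_assoc, hxy, add_mul, neg_mul]
      congr 1
      split_ifs
      · rw [sub_mul, map_sub, one_mul, mul_assoc, h6, hKmul, sub_mul, one_mul, mul_assoc]
      · simp
  let S : Subalgebra ℂ (Dbl n) :=
    { carrier := {a | ∀ z, f (a * z) = f a * f z}
      mul_mem' := fun {a b} ha hb z => by rw [mul_assoc, ha, hb, ha, mul_assoc]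
      add_mem' := fun {a b} ha hb z => by rw [add_mul, map_add, ha, hb, map_add, add_mul]
      algebraMap_mem' := fun r z => by
        rw [← Algebra.smul_def, Algebra.algebraMap_eq_smul_one, map_smul, map_smul, h1,
          smul_one_mul] }
  have hS : S = ⊤ := by
    rw [eq_top_iff, ← adjoin_dblGens]
    refine Algebra.adjoin_le ?_
    rintro _ (rfl | rfl | ⟨i, rfl⟩ | ⟨i, rfl⟩)
    exacts [hKmul, hDmul _, hxmul i, hDmul _]
  have ha : a ∈ S := by rw [hS]; trivial
  exact ha b

end

section

variable {n : ℕ}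

/-! ### The comultiplication of the dual -/

/-- The comultiplication of `𝒦ₙ^*`. -/
def coD (n : ℕ) : DualNichols n →ₗ[ℂ] DualNichols n ⊗[ℂ] DualNichols n where
  toFun φ := comulDual ℂ (NicholsAlgebra n) (show DualAlg ℂ (NicholsAlgebra n) from φ)
  map_add' _ _ := map_add (comulDual ℂ (NicholsAlgebra n)) _ _
  map_smul' _ _ := map_smul (comulDual ℂ (NicholsAlgebra n)) _ _

/-- Evaluation of the second leg: `φ ⊗ ψ ↦ (a ↦ ψ(a) φ)`. -/
def slice (n : ℕ) :
    DualNichols n ⊗[ℂ] DualNichols n →ₗ[ℂ] NicholsAlgebra n →ₗ[ℂ] DualNichols n :=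
  TensorProduct.lift (LinearMap.mk₂ ℂ (fun φ ψ => ψ.eval.smulRight φ)
    (fun _ _ _ => LinearMap.ext fun _ => smul_add _ _ _)
    (fun _ _ _ => LinearMap.ext fun _ => smul_comm _ _ _)
    (fun _ _ _ => LinearMap.ext fun _ => add_smul _ _ _)
    (fun _ _ _ => LinearMap.ext fun _ => mul_smul _ _ _))

theorem slice_tmul (φ ψ : DualNichols n) (a : NicholsAlgebra n) :
    slice n (φ ⊗ₜ ψ) a = ψ.eval a • φ := rfl

/-- Pairing of `𝒦ₙ^* ⊗ 𝒦ₙ^*` with `a ⊗ b`. -/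
theorem slice_eval (t : DualNichols n ⊗[ℂ] DualNichols n) (a b : NicholsAlgebra n) :
    (slice n t b).eval a = TensorProduct.dualDistrib ℂ (NicholsAlgebra n) (NicholsAlgebra n)
      (map (DualNichols.equivDual n).toLinearMap (DualNichols.equivDual n).toLinearMap t)
      (a ⊗ₜ b) := by
  induction t with
  | zero => simp; rfl
  | add s t hs ht =>
    rw [map_add, map_add, map_add, LinearMap.add_apply, LinearMap.add_apply, ← hs, ← ht]
    rfl
  | tmul φ ψ =>
    rw [slice_tmul, map_tmul, TensorProduct.dualDistrib_apply, mul_comm]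
    rfl

theorem slice_injective : Function.Injective (slice n) := by
  intro s t h
  have hinj : Function.Injective
      (map (DualNichols.equivDual n).toLinearMap (DualNichols.equivDual n).toLinearMap) :=
    (TensorProduct.congr (DualNichols.equivDual n) (DualNichols.equivDual n)).injective
  apply hinj
  apply (TensorProduct.dualDistribEquiv ℂ (NicholsAlgebra n) (NicholsAlgebra n)).injective
  apply TensorProduct.ext'
  intro a b
  have h1 := slice_eval s a b
  rw [h, slice_eval] at h1
  exact h1.symm

theorem slice_coD (φ : DualNichols n) (a : NicholsAlgebra n) :
    slice n (coD n φ) a = translate a φ := by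
  apply dual_ext
  intro b
  rw [slice_eval]
  exact comulDual_spec (show DualAlg ℂ (NicholsAlgebra n) from φ) b a

theorem slice_mul (s t : DualNichols n ⊗[ℂ] DualNichols n) (a : NicholsAlgebra n) :
    slice n (s * t) a =
      LinearMap.mul' ℂ (DualNichols n) (map (slice n s) (slice n t) (comul a)) := by
  induction s with
  | zero => simp
  | add s s' hs hs' =>
    simp only [add_mul, map_add, LinearMap.add_apply, hs, hs', map_add_left]
  | tmul φ ψ =>
    induction t with
    | zero => simp
    | add s s' hs hs' =>
      simp only [mul_add, map_add, LinearMap.add_apply, hs, hs', map_add_right]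
    | tmul φ' ψ' =>
      rw [Algebra.TensorProduct.tmul_mul_tmul, slice_tmul]
      have h : (ψ * ψ').eval a = LinearMap.mul' ℂ ℂ (map ψ.eval ψ'.eval (comul a)) :=
        LinearMap.convMul_apply _ _ _
      rw [h]
      generalize comul (R := ℂ) a = u
      induction u with
      | zero => simp
      | add u v hu hv => rw [map_add, map_add, add_smul, hu, hv, map_add, map_add]
      | tmul p q =>
        simp only [map_tmul, LinearMap.mul'_apply, slice_tmul, smul_mul_smul_comm]

theorem translate_conv (a : NicholsAlgebra n) (φ ψ : DualNichols n) :
    translate a (φ * ψ) =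
      LinearMap.mul' ℂ (DualNichols n) (map (slice n (coD n φ)) (slice n (coD n ψ)) (comul a)) := by
  refine (actR_conv a φ ψ).trans ?_
  generalize comul (R := ℂ) a = u
  induction u with
  | zero => simp; rfl
  | add u v hu hv => rw [map_add, map_add, hu, hv, map_add, map_add]; rfl
  | tmul p q =>
    rw [map_tmul, map_tmul, LinearMap.mul'_apply, slice_coD, slice_coD]
    rfl

theorem coD_mul (φ ψ : DualNichols n) : coD n (φ * ψ) = coD n φ * coD n ψ := by
  apply slice_injective
  ext1 a
  rw [slice_mul, slice_coD, translate_conv]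

theorem coD_one : coD n 1 = 1 ⊗ₜ 1 := by
  apply slice_injective
  ext1 a
  rw [slice_coD, slice_tmul, translate_one, dual_one_apply]

theorem coD_kbar : coD n (kbar n) = kbar n ⊗ₜ kbar n := by
  apply slice_injective
  ext1 a
  rw [slice_coD, slice_tmul, kbar_apply]
  apply dual_ext
  intro b
  change signHom n (b * a) = signHom n a • signHom n b
  rw [map_mul, smul_eq_mul, mul_comm]

theorem coD_xibar (i : Fin n) :
    coD n (xibar i) = 1 ⊗ₜ xibar i + xibar i ⊗ₜ kbar n := by
  apply slice_injective
  ext1 a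
  rw [slice_coD, map_add, LinearMap.add_apply, slice_tmul, slice_tmul, kbar_apply, xibar_apply]
  apply dual_ext
  intro b
  change xibarLin i (b * a) = xibarLin i a • (1 : DualNichols n).eval b +
    signHom n a • xibarLin i b
  rw [xibarLin_mul, dual_one_apply, smul_eq_mul, smul_eq_mul]
  ring

/-! ### The Hopf algebra structure of the double -/

/-- The homomorphism `φ ⊗ ψ ↦ ψ ⊗ φ` from `𝒦ₙ^* ⊗ 𝒦ₙ^*` to `D ⊗ D`. -/
def dualTwo (n : ℕ) : DualNichols n ⊗[ℂ] DualNichols n →ₐ[ℂ] Dbl n ⊗[ℂ] Dbl n :=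
  (Algebra.TensorProduct.map (ofHd n) (ofHd n)).comp
    (Algebra.TensorProduct.comm ℂ (DualNichols n) (DualNichols n)).toAlgHom

/-- The inclusion of `𝒦ₙ ⊗ 𝒦ₙ` in `D ⊗ D`. -/
def hopfTwo (n : ℕ) : NicholsAlgebra n ⊗[ℂ] NicholsAlgebra n →ₐ[ℂ] Dbl n ⊗[ℂ] Dbl n :=
  Algebra.TensorProduct.map (ofH n) (ofH n)

theorem dualTwo_tmul (φ ψ : DualNichols n) : dualTwo n (φ ⊗ₜ ψ) = ofHd n ψ ⊗ₜ ofHd n φ := rfl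
theorem hopfTwo_tmul (a b : NicholsAlgebra n) : hopfTwo n (a ⊗ₜ b) = ofH n a ⊗ₜ ofH n b := rfl

theorem comulD_elt_eq_map (φ : DualNichols n) (a : NicholsAlgebra n) :
    comulD (elt φ a) = (TensorProduct.tensorTensorTensorComm ℂ (DualAlg ℂ (NicholsAlgebra n))
        (DualAlg ℂ (NicholsAlgebra n)) (NicholsAlgebra n) (NicholsAlgebra n)
        ((TensorProduct.comm ℂ _ _
          (comulDual ℂ (NicholsAlgebra n) (show DualAlg ℂ (NicholsAlgebra n) from φ))) ⊗ₜ
          comul a)) := rfl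

theorem elt_tmul_elt (φ ψ : DualNichols n) (a b : NicholsAlgebra n) :
    elt φ a ⊗ₜ[ℂ] elt ψ b = (ofHd n φ ⊗ₜ[ℂ] ofHd n ψ) * (ofH n a ⊗ₜ[ℂ] ofH n b) := by
  rw [Algebra.TensorProduct.tmul_mul_tmul, ← elt_eq, ← elt_eq]

/-- The comultiplication of the double is multiplicative on `φ ⊗ h = φ h`. -/
theorem comulD_elt (φ : DualNichols n) (a : NicholsAlgebra n) :
    comulD (elt φ a) = dualTwo n (coD n φ) * hopfTwo n (comul a) := by
  have key : ∀ (t : DualAlg ℂ (NicholsAlgebra n) ⊗[ℂ] DualAlg ℂ (NicholsAlgebra n))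
      (u : NicholsAlgebra n ⊗[ℂ] NicholsAlgebra n),
      TensorProduct.tensorTensorTensorComm ℂ (DualAlg ℂ (NicholsAlgebra n))
        (DualAlg ℂ (NicholsAlgebra n)) (NicholsAlgebra n) (NicholsAlgebra n)
        ((TensorProduct.comm ℂ _ _ t) ⊗ₜ u) =
      dualTwo n (show DualNichols n ⊗[ℂ] DualNichols n from t) * hopfTwo n u := by
    intro t u
    induction t with
    | zero =>
      rw [map_zero, zero_tmul, map_zero]
      exact ((congrArg (· * hopfTwo n u) (map_zero (dualTwo n))).trans (zero_mul _)).symm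
    | add s t hs ht =>
      rw [map_add, add_tmul, map_add, hs, ht]
      exact ((congrArg (· * hopfTwo n u) (map_add (dualTwo n) _ _)).trans (add_mul _ _ _)).symm
    | tmul φ ψ =>
      induction u with
      | zero =>
        rw [tmul_zero, map_zero]
        exact ((congrArg (dualTwo n _ * ·) (map_zero (hopfTwo n))).trans (mul_zero _)).symm
      | add s t hs ht =>
        rw [tmul_add, map_add, hs, ht]
        exact ((congrArg (dualTwo n _ * ·) (map_add (hopfTwo n) _ _)).trans (mul_add _ _ _)).symm
      | tmul a b =>
        rw [TensorProduct.comm_tmul, TensorProduct.tensorTensorTensorComm_tmul]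
        exact elt_tmul_elt ψ φ a b
  exact (comulD_elt_eq_map φ a).trans (key _ _)

theorem comulD_ofH (a : NicholsAlgebra n) : comulD (ofH n a) = hopfTwo n (comul a) := by
  rw [ofH_eq_elt, comulD_elt, coD_one, ← Algebra.TensorProduct.one_def, map_one, one_mul]

theorem comulD_ofHd (φ : DualNichols n) : comulD (ofHd n φ) = dualTwo n (coD n φ) := by
  rw [ofHd_eq_elt, comulD_elt, Bialgebra.comul_one, map_one, mul_one]

theorem comulD_gK : comulD (gK n) = gK n ⊗ₜ gK n := by
  rw [gK, comulD_ofH, comul_K, hopfTwo_tmul]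
theorem comulD_gKb : comulD (gKb n) = gKb n ⊗ₜ gKb n := by
  rw [gKb, comulD_ofHd, coD_kbar, dualTwo_tmul]
theorem comulD_gx (i : Fin n) : comulD (gx i) = gK n ⊗ₜ gx i + gx i ⊗ₜ 1 := by
  rw [gx, comulD_ofH, comul_xi, map_add, hopfTwo_tmul, hopfTwo_tmul, map_one, gK]
theorem comulD_gy (i : Fin n) : comulD (gy i) = gy i ⊗ₜ 1 + gKb n ⊗ₜ gy i := by
  rw [gy, comulD_ofHd, coD_xibar, map_add, dualTwo_tmul, dualTwo_tmul, map_one, gKb]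

theorem comulD_one : comulD (1 : Dbl n) = 1 := by
  rw [← map_one (ofH n), comulD_ofH, Bialgebra.comul_one, map_one]

section tensorRelations

variable {A : Type*} [Ring A] [Algebra ℂ A] {K Kb x y : A}

theorem comul_relation_Ky (hKK : K * Kb = Kb * K) (hKy : K * y = -(y * K)) :
    (K ⊗ₜ[ℂ] K) * (y ⊗ₜ[ℂ] 1 + Kb ⊗ₜ[ℂ] y) = -((y ⊗ₜ[ℂ] 1 + Kb ⊗ₜ[ℂ] y) * (K ⊗ₜ[ℂ] K)) := by
  simp only [mul_add, add_mul, Algebra.TensorProduct.tmul_mul_tmul, one_mul, mul_one, hKK, hKy,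
    tmul_neg, neg_tmul, neg_add]

theorem comul_relation_xKb (hKK : K * Kb = Kb * K) (hxK : x * Kb = -(Kb * x)) :
    (K ⊗ₜ[ℂ] x + x ⊗ₜ[ℂ] 1) * (Kb ⊗ₜ[ℂ] Kb) = -((Kb ⊗ₜ[ℂ] Kb) * (K ⊗ₜ[ℂ] x + x ⊗ₜ[ℂ] 1)) := by
  simp only [mul_add, add_mul, Algebra.TensorProduct.tmul_mul_tmul, one_mul, mul_one, hKK, hxK,
    tmul_neg, neg_tmul, neg_add]

theorem comul_relation_xy (p : Prop) [Decidable p]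
    (hKK : K * Kb = Kb * K) (hKy : K * y = -(y * K)) (hxK : x * Kb = -(Kb * x))
    (hxy : x * y = -(y * x) + if p then 1 - Kb * K else 0) :
    (K ⊗ₜ[ℂ] x + x ⊗ₜ[ℂ] 1) * (y ⊗ₜ[ℂ] 1 + Kb ⊗ₜ[ℂ] y) =
      -((y ⊗ₜ[ℂ] 1 + Kb ⊗ₜ[ℂ] y) * (K ⊗ₜ[ℂ] x + x ⊗ₜ[ℂ] 1)) +
        if p then 1 - (Kb ⊗ₜ[ℂ] Kb) * (K ⊗ₜ[ℂ] K) else 0 := by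
  simp only [mul_add, add_mul, Algebra.TensorProduct.tmul_mul_tmul, one_mul, mul_one, hKK, hKy,
    hxK, hxy, tmul_add, add_tmul, tmul_neg, neg_tmul]
  split_ifs
  · simp only [tmul_sub, sub_tmul, Algebra.TensorProduct.one_def]
    abel
  · simp only [tmul_zero, zero_tmul]
    abel

theorem antipode_relation_xy (p : Prop) [Decidable p]
    (hKK : K * Kb = Kb * K) (hK : K * K = 1) (hKb : Kb * Kb = 1)
    (hKy : K * y = -(y * K)) (hxK : x * Kb = -(Kb * x))
    (hxy : x * y = -(y * x) + if p then 1 - Kb * K else 0) :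
    -(Kb * y) * -(K * x) = -(-(K * x) * -(Kb * y)) + if p then 1 - K * Kb else 0 := by
  have e1 : -(Kb * y) * -(K * x) = -(Kb * K * (y * x)) := by
    rw [neg_mul_neg, mul_assoc, ← mul_assoc y, ← neg_eq_iff_eq_neg.mpr hKy]
    simp only [neg_mul, mul_neg, mul_assoc]
  have e2 : -(K * x) * -(Kb * y) = -(Kb * K * (x * y)) := by
    rw [neg_mul_neg, mul_assoc, ← mul_assoc x, hxK, ← hKK]
    simp only [neg_mul, mul_neg, mul_assoc]
  rw [e1, e2, hxy, hKK]
  have e3 : Kb * K * (Kb * K) = 1 := by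
    rw [mul_assoc, ← mul_assoc K, hKK, mul_assoc, hK, mul_one, hKb]
  split_ifs
  · rw [mul_add, mul_sub, e3, mul_one, mul_neg]
    abel
  · simp

end tensorRelations

theorem comulD_mul (a b : Dbl n) : comulD (a * b) = comulD a * comulD b := by
  refine map_mul_of_relations (comulD : Dbl n →ₗ[ℂ] Dbl n ⊗[ℂ] Dbl n)
    ?_ ?_ ?_ ?_ ?_ ?_ ?_ ?_ a b
  · intro a b
    rw [comulD_ofH, comulD_ofH, comulD_ofH, Bialgebra.comul_mul, map_mul]
  · intro φ ψ
    rw [comulD_ofHd, comulD_ofHd, comulD_ofHd, coD_mul, map_mul]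
  · intro φ a
    rw [comulD_ofH, comulD_ofHd, comulD_elt]
  · exact comulD_one
  · rw [comulD_gK, comulD_gKb, Algebra.TensorProduct.tmul_mul_tmul,
      Algebra.TensorProduct.tmul_mul_tmul, gK_mul_gKb]
  · intro i
    rw [comulD_gK, comulD_gy]
    exact comul_relation_Ky gK_mul_gKb (gK_mul_gy i)
  · intro i
    rw [comulD_gKb, comulD_gx]
    exact comul_relation_xKb gK_mul_gKb (gx_mul_gKb i)
  · intro i j
    rw [comulD_gKb, comulD_gx, comulD_gy, comulD_gK]
    exact comul_relation_xy (i = j) gK_mul_gKb (gK_mul_gy j) (gx_mul_gKb i) (gx_mul_gy i j)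

/-- The antipode `φ ↦ φ ∘ S⁻¹` of `𝒦ₙ^{*cop}`. -/
def dualS (n : ℕ) : DualNichols n →ₗ[ℂ] DualNichols n where
  toFun φ := (toConv (φ.eval ∘ₗ AntipodeInverse.inv (k := ℂ)) : DualAlg ℂ (NicholsAlgebra n))
  map_add' _ _ := rfl
  map_smul' _ _ := rfl

theorem dualS_eval (φ : DualNichols n) (a : NicholsAlgebra n) :
    (dualS n φ).eval a = φ.eval (AntipodeInverse.inv (k := ℂ) a) := rfl

theorem dualS_mul (φ ψ : DualNichols n) : dualS n (φ * ψ) = dualS n ψ * dualS n φ := by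
  apply dual_ext
  intro a
  rw [dualS_eval]
  have h : ∀ (φ ψ : DualNichols n) a,
      (φ * ψ).eval a = LinearMap.mul' ℂ ℂ (map φ.eval ψ.eval (comul a)) :=
    fun φ ψ a => LinearMap.convMul_apply _ _ _
  rw [h, h, comul_inv]
  generalize comul (R := ℂ) a = u
  induction u with
  | zero => simp
  | add u v hu hv => simp only [map_add, hu, hv]
  | tmul p q =>
    rw [TensorProduct.comm_tmul, map_tmul, map_tmul, map_tmul, LinearMap.mul'_apply,
      LinearMap.mul'_apply, mul_comm]
    rfl

theorem dualS_one : dualS n 1 = 1 := by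
  apply dual_ext
  intro a
  rw [dualS_eval, dual_one_apply, dual_one_apply, counit_inv]

theorem dualS_kbar : dualS n (kbar n) = kbar n := by
  rw [← sub_eq_zero]
  apply dual_eq_zero_of_translate _ _ (-1)
  · apply dual_ext
    intro a
    change signHom n (AntipodeInverse.inv (k := ℂ) (a * K n)) - signHom n (a * K n) =
      -1 * (signHom n (AntipodeInverse.inv (k := ℂ) a) - signHom n a)
    rw [inv_mul, inv_K, map_mul, map_mul, signHom_K]
    ring
  · intro i
    apply dual_ext
    intro a
    change signHom n (AntipodeInverse.inv (k := ℂ) (a * xi i)) - signHom n (a * xi i) = 0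
    rw [inv_mul, inv_xi, map_mul, map_mul, map_mul, signHom_xi]
    ring
  · change signHom n (AntipodeInverse.inv (k := ℂ) 1) - signHom n 1 = 0
    rw [DrinfeldDouble.inv_one, sub_self]

theorem signHom_inv (a : NicholsAlgebra n) :
    signHom n (AntipodeInverse.inv (k := ℂ) a) = signHom n a := by
  rw [← kbar_apply, ← dualS_eval, dualS_kbar, kbar_apply]

theorem dualS_xibar (i : Fin n) : dualS n (xibar i) = -(kbar n * xibar i) := by
  rw [← add_eq_zero_iff_eq_neg]
  apply dual_eq_zero_of_translate _ _ 1
  · rw [map_add, translate_K_mul, translate_K_kbar, translate_K_xibar, neg_mul_neg, one_smul]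
    congr 1
    apply dual_ext
    intro a
    rw [translate_eval, dualS_eval, dualS_eval, inv_mul, inv_K, xibar_apply, xibar_apply,
      xibarLin_mul, counit_K, xibarLin_K]
    ring
  · intro j
    rw [map_add, translate_xi_mul, translate_K_kbar, translate_xi_kbar, translate_xi_xibar,
      zero_mul, add_zero]
    have : translate (xi j) (dualS n (xibar i)) = if j = i then kbar n else 0 := by
      apply dual_ext
      intro a
      rw [translate_eval, dualS_eval, inv_mul, inv_xi, xibar_apply, xibarLin_mul,
        xibarLin_mul, Bialgebra.counit_mul, counit_xi, counit_K, xibarLin_xi, xibarLin_K,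
        signHom_inv]
      split_ifs
      · rw [kbar_apply]; ring
      · simp; rfl
    rw [this]
    split_ifs <;> simp
  · change (dualS n (xibar i)).eval 1 + (kbar n * xibar i).eval 1 = 0
    rw [conv_apply_one, dualS_eval, DrinfeldDouble.inv_one, xibar_apply, xibarLin_one]
    ring

theorem antipodeD_elt (φ : DualNichols n) (a : NicholsAlgebra n) :
    antipodeD (elt φ a) = ofH n (antipodeLin n a) * ofHd n (dualS n φ) := rfl

theorem antipodeD_ofH (a : NicholsAlgebra n) :
    antipodeD (ofH n a) = ofH n (antipodeLin n a) := by
  rw [ofH_eq_elt, antipodeD_elt, dualS_one, map_one, mul_one]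

theorem antipodeD_ofHd (φ : DualNichols n) :
    antipodeD (ofHd n φ) = ofHd n (dualS n φ) := by
  rw [ofHd_eq_elt, antipodeD_elt, antipodeLin_one, map_one, one_mul]

theorem antipodeD_gK : antipodeD (gK n) = gK n := by
  rw [gK, antipodeD_ofH, antipodeLin_K]
theorem antipodeD_gKb : antipodeD (gKb n) = gKb n := by
  rw [gKb, antipodeD_ofHd, dualS_kbar]
theorem antipodeD_gx (i : Fin n) : antipodeD (gx i) = -(gK n * gx i) := by
  rw [gx, antipodeD_ofH, antipodeLin_xi, map_neg, map_mul, gK]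
theorem antipodeD_gy (i : Fin n) : antipodeD (gy i) = -(gKb n * gy i) := by
  rw [gy, antipodeD_ofHd, dualS_xibar, map_neg, map_mul, gKb]

theorem antipodeD_one : antipodeD (1 : Dbl n) = 1 := by
  rw [← map_one (ofH n), antipodeD_ofH, antipodeLin_one]

theorem antipodeD_mul (a b : Dbl n) : antipodeD (a * b) = antipodeD b * antipodeD a := by
  have := map_mul_of_relations ((MulOpposite.opLinearEquiv ℂ).toLinearMap ∘ₗ
    (antipodeD : Dbl n →ₗ[ℂ] Dbl n)) ?_ ?_ ?_ ?_ ?_ ?_ ?_ ?_ a b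
  · exact MulOpposite.op_injective this
  · intro a b
    simp only [LinearMap.comp_apply, LinearEquiv.coe_coe, MulOpposite.coe_opLinearEquiv]
    rw [← MulOpposite.op_mul, antipodeD_ofH, antipodeD_ofH, antipodeD_ofH, antipodeLin_mul,
      map_mul]
  · intro a b
    simp only [LinearMap.comp_apply, LinearEquiv.coe_coe, MulOpposite.coe_opLinearEquiv]
    rw [← MulOpposite.op_mul, antipodeD_ofHd, antipodeD_ofHd, antipodeD_ofHd, dualS_mul,
      map_mul]
  · intro φ a
    simp only [LinearMap.comp_apply, LinearEquiv.coe_coe, MulOpposite.coe_opLinearEquiv]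
    rw [← MulOpposite.op_mul, antipodeD_ofHd, antipodeD_ofH, antipodeD_elt]
  · simp only [LinearMap.comp_apply, LinearEquiv.coe_coe, MulOpposite.coe_opLinearEquiv]
    rw [antipodeD_one, MulOpposite.op_one]
  · simp only [LinearMap.comp_apply, LinearEquiv.coe_coe, MulOpposite.coe_opLinearEquiv]
    rw [← MulOpposite.op_mul, ← MulOpposite.op_mul, antipodeD_gK, antipodeD_gKb, gK_mul_gKb]
  · intro i
    simp only [LinearMap.comp_apply, LinearEquiv.coe_coe, MulOpposite.coe_opLinearEquiv]
    rw [← MulOpposite.op_mul, ← MulOpposite.op_mul, antipodeD_gK, antipodeD_gy,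
      ← MulOpposite.op_neg, neg_mul, mul_neg, neg_neg, mul_assoc, ← mul_assoc (gK n),
      gK_mul_gKb, mul_assoc, gK_mul_gy]
    simp only [mul_neg]
  · intro i
    simp only [LinearMap.comp_apply, LinearEquiv.coe_coe, MulOpposite.coe_opLinearEquiv]
    rw [← MulOpposite.op_mul, ← MulOpposite.op_mul, antipodeD_gKb, antipodeD_gx,
      ← MulOpposite.op_neg, neg_mul, mul_neg, neg_neg, mul_assoc, ← mul_assoc (gKb n),
      ← gK_mul_gKb, mul_assoc, gx_mul_gKb]
    simp only [mul_neg]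
  · intro i j
    simp only [LinearMap.comp_apply, LinearEquiv.coe_coe, MulOpposite.coe_opLinearEquiv]
    rw [← MulOpposite.op_mul, ← MulOpposite.op_mul, ← MulOpposite.op_mul, antipodeD_gK,
      antipodeD_gKb, antipodeD_gx, antipodeD_gy,
      antipode_relation_xy (i = j) gK_mul_gKb gK_mul_gK gKb_mul_gKb
        (gK_mul_gy j) (gx_mul_gKb i) (gx_mul_gy i j)]
    split_ifs <;> rfl

theorem counitD_elt (φ : DualNichols n) (a : NicholsAlgebra n) :
    counitD (elt φ a) = φ.eval 1 * counit (R := ℂ) a := rfl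

theorem counitD_gK : counitD (gK n) = 1 := by
  rw [gK, ofH_eq_elt, counitD_elt, counit_K, dual_one_apply]; simp
theorem counitD_gKb : counitD (gKb n) = 1 := by
  rw [gKb, ofHd_eq_elt, counitD_elt, kbar_apply]; simp
theorem counitD_gx (i : Fin n) : counitD (gx i) = 0 := by
  rw [gx, ofH_eq_elt, counitD_elt, counit_xi, mul_zero]
theorem counitD_gy (i : Fin n) : counitD (gy i) = 0 := by
  rw [gy, ofHd_eq_elt, counitD_elt, xibar_apply, xibarLin_one, zero_mul]
theorem counitD_one : counitD (1 : Dbl n) = 1 := by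
  rw [← map_one (ofH n), ofH_eq_elt, counitD_elt, dual_one_apply]; simp

theorem counitD_mul (a b : Dbl n) : counitD (a * b) = counitD a * counitD b := by
  refine map_mul_of_relations (counitD : Dbl n →ₗ[ℂ] ℂ) ?_ ?_ ?_ ?_ ?_ ?_ ?_ ?_ a b
  · intro a b
    simp only [ofH_eq_elt, counitD_elt, Bialgebra.counit_mul, dual_one_apply,
      Bialgebra.counit_one, one_mul]
  · intro φ ψ
    simp only [ofHd_eq_elt, counitD_elt, conv_apply_one, Bialgebra.counit_one, mul_one]
  · intro φ a
    simp only [ofH_eq_elt, ofHd_eq_elt, counitD_elt, dual_one_apply, Bialgebra.counit_one,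
      mul_one, one_mul]
  · exact counitD_one
  · exact mul_comm _ _
  · intro i; rw [counitD_gy]; ring
  · intro i; rw [counitD_gx]; ring
  · intro i j
    rw [counitD_gy, counitD_gx, counitD_gK, counitD_gKb]
    simp

/-- The map `a ⊗ b ↦ a S(b)`. -/
def mulS (n : ℕ) : Dbl n ⊗[ℂ] Dbl n →ₗ[ℂ] Dbl n :=
  LinearMap.mul' ℂ (Dbl n) ∘ₗ LinearMap.lTensor (Dbl n) antipodeD

theorem mulS_tmul (a b : Dbl n) : mulS n (a ⊗ₜ b) = a * antipodeD b := rfl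

theorem mulS_tmul_mul (a b : Dbl n) (t : Dbl n ⊗[ℂ] Dbl n) :
    mulS n (a ⊗ₜ b * t) = a * mulS n t * antipodeD b := by
  induction t with
  | zero => rw [mul_zero, map_zero, mul_zero, zero_mul]
  | add s t hs ht => rw [mul_add, map_add, map_add, hs, ht, mul_add, add_mul]
  | tmul p q =>
    rw [Algebra.TensorProduct.tmul_mul_tmul, mulS_tmul, mulS_tmul, antipodeD_mul]
    simp only [mul_assoc]

/-- `∑ x₍₁₎ S(x₍₂₎) = ε(x) 1` in the double. -/
theorem mulS_comulD (x : Dbl n) : mulS n (comulD x) = counitD x • (1 : Dbl n) := by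
  refine mem_of_mul_left_mem (adjoin_dblGens (n := n))
    (LinearMap.eqLocus (mulS n ∘ₗ comulD) (counitD.smulRight (1 : Dbl n))) ?_ ?_ x
  · change mulS n (comulD 1) = counitD (1 : Dbl n) • (1 : Dbl n)
    rw [comulD_one, Algebra.TensorProduct.one_def, mulS_tmul, antipodeD_one, counitD_one,
      mul_one, one_smul]
  · intro g hg z hz
    change mulS n (comulD z) = counitD z • (1 : Dbl n) at hz
    change mulS n (comulD (g * z)) = counitD (g * z) • (1 : Dbl n)
    rw [comulD_mul, counitD_mul]
    rcases hg with rfl | rfl | ⟨i, rfl⟩ | ⟨i, rfl⟩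
    · rw [comulD_gK, mulS_tmul_mul, hz, antipodeD_gK, counitD_gK]
      simp [gK_mul_gK]
    · rw [comulD_gKb, mulS_tmul_mul, hz, antipodeD_gKb, counitD_gKb]
      simp [gKb_mul_gKb]
    · rw [comulD_gx, add_mul, map_add, mulS_tmul_mul, mulS_tmul_mul, hz, antipodeD_gx,
        antipodeD_one, counitD_gx]
      simp [← mul_assoc, gK_mul_gK]
    · rw [comulD_gy, add_mul, map_add, mulS_tmul_mul, mulS_tmul_mul, hz, antipodeD_gy,
        antipodeD_one, counitD_gy]
      simp [← mul_assoc, gKb_mul_gKb]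

end

section

/-! ### One pair of odd generators -/

section pair

variable {A : Type*} [Ring A]

/-- The relations between `K`, the central element `c = K̄ K` and one pair `x = ξᵢ`, `y = ξ̄ᵢ` of
odd generators of the double. -/
structure PairRel (K c x y : A) : Prop where
  K_sq : K * K = 1
  c_sq : c * c = 1
  K_c : K * c = c * K
  x_c : x * c = c * x
  y_c : y * c = c * y
  K_x : K * x = -(x * K)
  K_y : K * y = -(y * K)
  x_sq : x * x = 0
  y_sq : y * y = 0
  x_y : x * y = -(y * x) + (1 - c)

namespace PairRel

variable {K c x y : A}

/-- The relations as rewriting rules that bring every word to the order `c`, `y`, `x`, `K`. -/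
theorem rules (h : PairRel K c x y) :
    (K * K = 1 ∧ c * c = 1 ∧ K * c = c * K ∧ x * c = c * x ∧ y * c = c * y ∧
      K * x = -(x * K) ∧ K * y = -(y * K) ∧ x * x = 0 ∧ y * y = 0 ∧
      x * y = -(y * x) + (1 - c)) ∧
    (∀ z, K * (K * z) = z) ∧ (∀ z, c * (c * z) = z) ∧ (∀ z, K * (c * z) = c * (K * z)) ∧
    (∀ z, x * (c * z) = c * (x * z)) ∧ (∀ z, y * (c * z) = c * (y * z)) ∧
    (∀ z, K * (x * z) = -(x * (K * z))) ∧ (∀ z, K * (y * z) = -(y * (K * z))) ∧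
    (∀ z, x * (x * z) = 0) ∧ (∀ z, y * (y * z) = 0) ∧
    (∀ z, x * (y * z) = -(y * (x * z)) + (z - c * z)) := by
  obtain ⟨h1, h2, h3, h4, h5, h6, h7, h8, h9, h10⟩ := h
  refine ⟨⟨h1, h2, h3, h4, h5, h6, h7, h8, h9, h10⟩, ?_, ?_, ?_, ?_, ?_, ?_, ?_, ?_, ?_, ?_⟩ <;>
    intro z <;> rw [← mul_assoc]
  · rw [h1, one_mul]
  · rw [h2, one_mul]
  · rw [h3, mul_assoc]
  · rw [h4, mul_assoc]
  · rw [h5, mul_assoc]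
  · rw [h6, neg_mul, mul_assoc]
  · rw [h7, neg_mul, mul_assoc]
  · rw [h8, zero_mul]
  · rw [h9, zero_mul]
  · rw [h10, add_mul, neg_mul, mul_assoc, sub_mul, one_mul]

end PairRel

variable [Algebra ℂ A]

/-- The twisted commutator `z ↦ a (K z K) - z a`. For `a = ξᵢ, ξ̄ᵢ` it describes the action
`z ↦ ∑ S(a₍₂₎) z a₍₁₎`. -/
def twistedComm (K a : A) : A →ₗ[ℂ] A :=
  LinearMap.mulLeft ℂ a ∘ₗ LinearMap.mulLeft ℂ K ∘ₗ LinearMap.mulRight ℂ K -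
    LinearMap.mulRight ℂ a

theorem twistedComm_apply (K a z : A) : twistedComm K a z = a * (K * (z * K)) - z * a := rfl

/-- The composite of the twisted commutators with `x` and `y`. -/
def pairComm (K x y : A) : A →ₗ[ℂ] A := twistedComm K y ∘ₗ twistedComm K x

theorem pairComm_apply (K x y z : A) :
    pairComm K x y z = twistedComm K y (twistedComm K x z) := rfl

variable {K c x y : A}

theorem pairComm_one (h : PairRel K c x y) : pairComm K x y 1 = 0 := by
  simp only [pairComm_apply, twistedComm_apply, mul_add, add_mul, mul_sub, sub_mul, neg_mul,
    mul_neg, mul_assoc, mul_one, one_mul, mul_zero, zero_mul, neg_neg, neg_zero, h.rules]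
  abel

theorem pairComm_x (h : PairRel K c x y) : pairComm K x y x = 0 := by
  simp only [pairComm_apply, twistedComm_apply, mul_add, add_mul, mul_sub, sub_mul, neg_mul,
    mul_neg, mul_assoc, mul_one, one_mul, mul_zero, zero_mul, neg_neg, neg_zero, h.rules]
  abel

theorem pairComm_y (h : PairRel K c x y) : pairComm K x y y = 0 := by
  simp only [pairComm_apply, twistedComm_apply, mul_add, add_mul, mul_sub, sub_mul, neg_mul,
    mul_neg, mul_assoc, mul_one, one_mul, mul_zero, zero_mul, neg_neg, neg_zero, h.rules]
  abel

theorem pairComm_yx (h : PairRel K c x y) :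
    pairComm K x y (y * x) = (-2 : ℂ) • (1 - c) := by
  simp only [pairComm_apply, twistedComm_apply, mul_add, add_mul, mul_sub, sub_mul, neg_mul,
    mul_neg, mul_assoc, mul_one, one_mul, mul_zero, zero_mul, neg_neg, neg_zero, h.rules]
  module

theorem pairComm_K (h : PairRel K c x y) :
    pairComm K x y K = (2 : ℂ) • ((x * y - y * x) * K) := by
  simp only [pairComm_apply, twistedComm_apply, mul_add, add_mul, mul_sub, sub_mul, neg_mul,
    mul_neg, mul_assoc, mul_one, one_mul, mul_zero, zero_mul, neg_neg, neg_zero, h.rules]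
  module

theorem pairComm_xK (h : PairRel K c x y) : pairComm K x y (x * K) = 0 := by
  simp only [pairComm_apply, twistedComm_apply, mul_add, add_mul, mul_sub, sub_mul, neg_mul,
    mul_neg, mul_assoc, mul_one, one_mul, mul_zero, zero_mul, neg_neg, neg_zero, h.rules]
  abel

theorem pairComm_yK (h : PairRel K c x y) : pairComm K x y (y * K) = 0 := by
  simp only [pairComm_apply, twistedComm_apply, mul_add, add_mul, mul_sub, sub_mul, neg_mul,
    mul_neg, mul_assoc, mul_one, one_mul, mul_zero, zero_mul, neg_neg, neg_zero, h.rules]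
  abel

theorem pairComm_yxK (h : PairRel K c x y) :
    pairComm K x y (y * x * K) = (1 - c) * ((x * y - y * x) * K) := by
  simp only [pairComm_apply, twistedComm_apply, mul_add, add_mul, mul_sub, sub_mul, neg_mul,
    mul_neg, mul_assoc, mul_one, one_mul, mul_zero, zero_mul, neg_neg, neg_zero, h.rules]
  abel

/-- `b` commutes with `a` up to conjugation by `K`. -/
def TwistedCommute (K a b : A) : Prop := a * (K * (b * K)) = b * a

theorem twistedComm_left_mul {a b : A} (hK : K * K = 1) (hb : TwistedCommute K a b) (m : A) :
    twistedComm K a (b * m) = b * twistedComm K a m := by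
  have h1 : K * (b * m * K) = K * (b * K) * (K * (m * K)) := by
    simp only [mul_assoc]
    rw [← mul_assoc K K, hK, one_mul]
  rw [twistedComm_apply, twistedComm_apply, mul_sub, h1, ← mul_assoc a, hb]
  simp only [mul_assoc]

theorem twistedComm_right_mul {a b : A} (hK : K * b = b * K) (ha : a * b = b * a) (m : A) :
    twistedComm K a (m * b) = twistedComm K a m * b := by
  rw [twistedComm_apply, twistedComm_apply, sub_mul]
  simp only [mul_assoc, ha, hK]

theorem twistedCommute_of_odd {a b : A} (hK : K * K = 1) (h1 : K * b = -(b * K))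
    (h2 : a * b = -(b * a)) : TwistedCommute K a b := by
  unfold TwistedCommute
  rw [← mul_assoc K, h1, neg_mul, mul_assoc, hK, mul_one, mul_neg, h2, neg_neg]

theorem twistedCommute_of_central {a b : A} (hK : K * K = 1) (hb : ∀ z, b * z = z * b) :
    TwistedCommute K a b := by
  unfold TwistedCommute
  rw [hb K, ← mul_assoc K, hK, one_mul, hb]

end pair

/-! ### Algebras with the relations of the double -/

/-- The relations of the double of `𝒦ₙ`: `K` is the group-like element of `𝒦ₙ`, `c = K̄ K` is the
central group-like element, `x i = ξᵢ` and `y i = ξ̄ᵢ`. -/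
structure DoubleRel {A : Type*} [Ring A] {n : ℕ} (K c : A) (x y : Fin n → A) : Prop where
  K_sq : K * K = 1
  c_sq : c * c = 1
  c_comm : ∀ a, c * a = a * c
  K_x : ∀ i, K * x i = -(x i * K)
  K_y : ∀ i, K * y i = -(y i * K)
  x_sq : ∀ i, x i * x i = 0
  y_sq : ∀ i, y i * y i = 0
  x_x : ∀ i j, x i * x j = -(x j * x i)
  y_y : ∀ i j, y i * y j = -(y j * y i)
  x_y : ∀ i j, i ≠ j → x i * y j = -(y j * x i)
  x_y_self : ∀ i, x i * y i = -(y i * x i) + (1 - c)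

section double

variable {A : Type*} [Ring A] [Algebra ℂ A] {n : ℕ} {K c : A} {x y : Fin n → A}

theorem DoubleRel.pair (h : DoubleRel K c x y) (i : Fin n) : PairRel K c (x i) (y i) :=
  ⟨h.K_sq, h.c_sq, (h.c_comm _).symm, (h.c_comm _).symm, (h.c_comm _).symm, h.K_x i, h.K_y i,
    h.x_sq i, h.y_sq i, h.x_y_self i⟩

/-- The even element `w = x y - y x` of a pair of odd generators. -/
def pairW (x y : Fin n → A) (i : Fin n) : A := x i * y i - y i * x i

/-- The product of the elements `wᵢ` for `i` in a list. -/
def prodW (x y : Fin n → A) (l : List (Fin n)) : A := (l.map (pairW x y)).prod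

theorem prodW_cons (i : Fin n) (l : List (Fin n)) :
    prodW x y (i :: l) = pairW x y i * prodW x y l := by simp [prodW]

theorem odd_comm_odd_mul_odd {R : Type*} [Ring R] {a p q : R} (hp : a * p = -(p * a))
    (hq : a * q = -(q * a)) : a * (p * q) = p * q * a := by
  rw [← mul_assoc, hp, neg_mul, mul_assoc, hq, mul_neg, neg_neg, mul_assoc]

theorem DoubleRel.K_comm_pairW (h : DoubleRel K c x y) (i : Fin n) :
    K * pairW x y i = pairW x y i * K := by
  rw [pairW, mul_sub, sub_mul, odd_comm_odd_mul_odd (h.K_x i) (h.K_y i),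
    odd_comm_odd_mul_odd (h.K_y i) (h.K_x i)]

theorem DoubleRel.y_x (h : DoubleRel K c x y) {i j : Fin n} (hij : i ≠ j) :
    y i * x j = -(x j * y i) := by rw [h.x_y j i hij.symm, neg_neg]

theorem DoubleRel.x_comm_pairW (h : DoubleRel K c x y) {i j : Fin n} (hij : i ≠ j) :
    x i * pairW x y j = pairW x y j * x i := by
  rw [pairW, mul_sub, sub_mul, odd_comm_odd_mul_odd (h.x_x i j) (h.x_y i j hij),
    odd_comm_odd_mul_odd (h.x_y i j hij) (h.x_x i j)]

theorem DoubleRel.y_comm_pairW (h : DoubleRel K c x y) {i j : Fin n} (hij : i ≠ j) :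
    y i * pairW x y j = pairW x y j * y i := by
  rw [pairW, mul_sub, sub_mul, odd_comm_odd_mul_odd (h.y_x hij) (h.y_y i j),
    odd_comm_odd_mul_odd (h.y_y i j) (h.y_x hij)]

theorem comm_listProd {R ι : Type*} [Monoid R] {a : R} {f : ι → R} {l : List ι}
    (h : ∀ i ∈ l, a * f i = f i * a) : a * (l.map f).prod = (l.map f).prod * a := by
  induction l with
  | nil => simp
  | cons i l ih =>
    rw [List.map_cons, List.prod_cons, ← mul_assoc, h i (by simp), mul_assoc,
      ih fun j hj => h j (by simp [hj]), mul_assoc]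

theorem DoubleRel.K_comm_prodW (h : DoubleRel K c x y) (l : List (Fin n)) :
    K * prodW x y l = prodW x y l * K := comm_listProd fun i _ => h.K_comm_pairW i

theorem DoubleRel.x_comm_prodW (h : DoubleRel K c x y) {i : Fin n} {l : List (Fin n)}
    (hi : i ∉ l) : x i * prodW x y l = prodW x y l * x i :=
  comm_listProd fun j hj => h.x_comm_pairW (by rintro rfl; exact hi hj)

theorem DoubleRel.y_comm_prodW (h : DoubleRel K c x y) {i : Fin n} {l : List (Fin n)}
    (hi : i ∉ l) : y i * prodW x y l = prodW x y l * y i :=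
  comm_listProd fun j hj => h.y_comm_pairW (by rintro rfl; exact hi hj)

/-! ### Normal forms -/

/-- The span of the words `∏ᵢ bᵢ · g` with `bᵢ ∈ {1, xᵢ, yᵢ, yᵢ xᵢ}` for `i` in the list and
`g ∈ {1, c, K, c K}`. -/
def normalForms (K c : A) (x y : Fin n → A) : List (Fin n) → Submodule ℂ A
  | [] => Submodule.span ℂ {1, c, K, c * K}
  | i :: l => normalForms K c x y l ⊔
      ((normalForms K c x y l).map (LinearMap.mulLeft ℂ (x i)) ⊔
        ((normalForms K c x y l).map (LinearMap.mulLeft ℂ (y i)) ⊔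
          (normalForms K c x y l).map (LinearMap.mulLeft ℂ (y i * x i))))

theorem normalForms_nil_le {P : Submodule ℂ A} (h1 : 1 ∈ P) (hc : c ∈ P) (hK : K ∈ P)
    (hcK : c * K ∈ P) : normalForms K c x y [] ≤ P := by
  rw [normalForms, Submodule.span_le]
  rintro z (rfl | rfl | rfl | rfl) <;> assumption

theorem normalForms_cons_le {P : Submodule ℂ A} {i : Fin n} {l : List (Fin n)}
    (h : ∀ m ∈ normalForms K c x y l, m ∈ P ∧ x i * m ∈ P ∧ y i * m ∈ P ∧ y i * x i * m ∈ P) :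
    normalForms K c x y (i :: l) ≤ P := by
  rw [normalForms]
  refine sup_le (fun m hm => (h m hm).1) (sup_le ?_ (sup_le ?_ ?_))
  · rintro _ ⟨m, hm, rfl⟩; exact (h m hm).2.1
  · rintro _ ⟨m, hm, rfl⟩; exact (h m hm).2.2.1
  · rintro _ ⟨m, hm, rfl⟩; exact (h m hm).2.2.2

theorem mem_normalForms_cons {i : Fin n} {l : List (Fin n)} {m : A}
    (hm : m ∈ normalForms K c x y l) :
    m ∈ normalForms K c x y (i :: l) ∧ x i * m ∈ normalForms K c x y (i :: l) ∧
      y i * m ∈ normalForms K c x y (i :: l) ∧ y i * x i * m ∈ normalForms K c x y (i :: l) := by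
  rw [normalForms]
  refine ⟨Submodule.mem_sup_left hm, ?_, ?_, ?_⟩
  · exact Submodule.mem_sup_right (Submodule.mem_sup_left ⟨m, hm, rfl⟩)
  · exact Submodule.mem_sup_right (Submodule.mem_sup_right (Submodule.mem_sup_left ⟨m, hm, rfl⟩))
  · exact Submodule.mem_sup_right (Submodule.mem_sup_right (Submodule.mem_sup_right ⟨m, hm, rfl⟩))

theorem one_mem_normalForms (l : List (Fin n)) : (1 : A) ∈ normalForms K c x y l := by
  induction l with
  | nil => exact Submodule.subset_span (by simp)
  | cons i l ih => exact (mem_normalForms_cons ih).1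

theorem DoubleRel.c_mul_mem (h : DoubleRel K c x y) {l : List (Fin n)} {m : A}
    (hm : m ∈ normalForms K c x y l) : c * m ∈ normalForms K c x y l := by
  suffices normalForms K c x y l ≤
      (normalForms K c x y l).comap (LinearMap.mulLeft ℂ c) from this hm
  clear hm
  induction l with
  | nil =>
    apply normalForms_nil_le <;>
      simp only [Submodule.mem_comap, LinearMap.mulLeft_apply, mul_one, ← mul_assoc, h.c_sq,
        one_mul] <;>
      exact Submodule.subset_span (by simp)
  | cons i l ih =>
    refine normalForms_cons_le fun m hm => ?_
    have := mem_normalForms_cons (i := i) (ih hm)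
    simp only [LinearMap.mulLeft_apply] at this
    simp only [Submodule.mem_comap, LinearMap.mulLeft_apply]
    simpa only [← mul_assoc, ← h.c_comm] using this

theorem DoubleRel.K_mul_mem (h : DoubleRel K c x y) {l : List (Fin n)} {m : A}
    (hm : m ∈ normalForms K c x y l) : K * m ∈ normalForms K c x y l := by
  suffices normalForms K c x y l ≤
      (normalForms K c x y l).comap (LinearMap.mulLeft ℂ K) from this hm
  clear hm
  induction l with
  | nil =>
    apply normalForms_nil_le <;>
      simp only [Submodule.mem_comap, LinearMap.mulLeft_apply, mul_one, ← mul_assoc, ← h.c_comm K,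
        h.K_sq] <;>
      (try simp only [mul_assoc, h.K_sq, mul_one]) <;>
      exact Submodule.subset_span (by simp)
  | cons i l ih =>
    refine normalForms_cons_le fun m hm => ?_
    obtain ⟨h1, h2, h3, h4⟩ := mem_normalForms_cons (i := i) (ih hm)
    simp only [LinearMap.mulLeft_apply] at h1 h2 h3 h4
    refine ⟨h1, ?_, ?_, ?_⟩ <;> simp only [Submodule.mem_comap, LinearMap.mulLeft_apply]
    · rw [← mul_assoc, h.K_x, neg_mul, mul_assoc]
      exact Submodule.neg_mem _ h2
    · rw [← mul_assoc, h.K_y, neg_mul, mul_assoc]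
      exact Submodule.neg_mem _ h3
    · rw [← mul_assoc, odd_comm_odd_mul_odd (h.K_y i) (h.K_x i), mul_assoc]
      exact h4

/-- The span of the normal forms is stable under left multiplication by `xⱼ`: the letter moves
past the other pairs up to sign and is absorbed in its own pair. -/
theorem DoubleRel.x_mul_mem (h : DoubleRel K c x y) {j : Fin n} {l : List (Fin n)} (hj : j ∈ l)
    {m : A} (hm : m ∈ normalForms K c x y l) : x j * m ∈ normalForms K c x y l := by
  suffices normalForms K c x y l ≤
      (normalForms K c x y l).comap (LinearMap.mulLeft ℂ (x j)) from this hm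
  clear hm
  induction l with
  | nil => simp at hj
  | cons i l ih =>
    refine normalForms_cons_le fun m hm => ?_
    by_cases hij : j = i
    · subst hij
      obtain ⟨h1, h2, h3, h4⟩ := mem_normalForms_cons (i := j) hm
      obtain ⟨h1', h2', -, -⟩ := mem_normalForms_cons (i := j) (h.c_mul_mem hm)
      refine ⟨h2, ?_, ?_, ?_⟩ <;> simp only [Submodule.mem_comap, LinearMap.mulLeft_apply]
      · rw [← mul_assoc, h.x_sq, zero_mul]
        exact Submodule.zero_mem _
      · rw [← mul_assoc, h.x_y_self, add_mul, neg_mul, sub_mul, one_mul]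
        exact Submodule.add_mem _ (Submodule.neg_mem _ h4) (Submodule.sub_mem _ h1 h1')
      · have : x j * (y j * x j * m) = x j * m - x j * (c * m) := by
          simp only [mul_assoc, (h.pair j).rules, mul_zero, neg_zero, zero_add]
        rw [this]
        exact Submodule.sub_mem _ h2 h2'
    · have hjl : j ∈ l := by simpa [hij] using hj
      obtain ⟨h1, h2, h3, h4⟩ := mem_normalForms_cons (i := i) (ih hjl hm)
      simp only [LinearMap.mulLeft_apply] at h1 h2 h3 h4
      refine ⟨h1, ?_, ?_, ?_⟩ <;> simp only [Submodule.mem_comap, LinearMap.mulLeft_apply]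
      · rw [← mul_assoc, h.x_x, neg_mul, mul_assoc]
        exact Submodule.neg_mem _ h2
      · rw [← mul_assoc, h.x_y j i hij, neg_mul, mul_assoc]
        exact Submodule.neg_mem _ h3
      · rw [← mul_assoc, odd_comm_odd_mul_odd (h.x_y j i hij) (h.x_x j i), mul_assoc]
        exact h4

theorem DoubleRel.y_mul_mem (h : DoubleRel K c x y) {j : Fin n} {l : List (Fin n)} (hj : j ∈ l)
    {m : A} (hm : m ∈ normalForms K c x y l) : y j * m ∈ normalForms K c x y l := by
  suffices normalForms K c x y l ≤
      (normalForms K c x y l).comap (LinearMap.mulLeft ℂ (y j)) from this hm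
  clear hm
  induction l with
  | nil => simp at hj
  | cons i l ih =>
    refine normalForms_cons_le fun m hm => ?_
    by_cases hij : j = i
    · subst hij
      obtain ⟨h1, h2, h3, h4⟩ := mem_normalForms_cons (i := j) hm
      refine ⟨h3, ?_, ?_, ?_⟩ <;>
        simp only [Submodule.mem_comap, LinearMap.mulLeft_apply, ← mul_assoc, h.y_sq, zero_mul]
      · exact h4
      · exact Submodule.zero_mem _
      · exact Submodule.zero_mem _
    · have hjl : j ∈ l := by simpa [hij] using hj
      obtain ⟨h1, h2, h3, h4⟩ := mem_normalForms_cons (i := i) (ih hjl hm)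
      simp only [LinearMap.mulLeft_apply] at h1 h2 h3 h4
      refine ⟨h1, ?_, ?_, ?_⟩ <;> simp only [Submodule.mem_comap, LinearMap.mulLeft_apply]
      · rw [← mul_assoc, h.y_x hij, neg_mul, mul_assoc]
        exact Submodule.neg_mem _ h2
      · rw [← mul_assoc, h.y_y j i, neg_mul, mul_assoc]
        exact Submodule.neg_mem _ h3
      · rw [← mul_assoc, odd_comm_odd_mul_odd (h.y_y j i) (h.y_x hij), mul_assoc]
        exact h4

/-- The normal forms span an algebra generated by `K`, `c`, the `xᵢ` and the `yᵢ`. -/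
theorem DoubleRel.normalForms_eq_top (h : DoubleRel K c x y)
    (hgen : Algebra.adjoin ℂ (insert K (insert c (Set.range x ∪ Set.range y))) = ⊤) :
    normalForms K c x y (List.finRange n) = ⊤ := by
  rw [eq_top_iff]
  rintro a -
  refine mem_of_mul_left_mem hgen _ (one_mem_normalForms _) ?_ a
  rintro g (rfl | rfl | ⟨i, rfl⟩ | ⟨i, rfl⟩) m hm
  · exact h.K_mul_mem hm
  · exact h.c_mul_mem hm
  · exact h.x_mul_mem (List.mem_finRange i) hm
  · exact h.y_mul_mem (List.mem_finRange i) hm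

end double

end

section

section higman

variable {A : Type*} [Ring A] [Algebra ℂ A] {n : ℕ} {K c : A} {x y : Fin n → A}

/-! ### The image of the iterated twisted commutators -/

/-- The composite of the maps `pairComm` for the pairs in a list. -/
def listComm (K : A) (x y : Fin n → A) : List (Fin n) → A →ₗ[ℂ] A
  | [] => LinearMap.id
  | i :: l => pairComm K (x i) (y i) ∘ₗ listComm K x y l

theorem listComm_cons (i : Fin n) (l : List (Fin n)) (z : A) :
    listComm K x y (i :: l) z = pairComm K (x i) (y i) (listComm K x y l z) := rfl

theorem pairComm_left_mul {a a' b : A} (hK : K * K = 1) (h1 : TwistedCommute K a b)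
    (h2 : TwistedCommute K a' b) (m : A) : pairComm K a a' (b * m) = b * pairComm K a a' m := by
  rw [pairComm_apply, twistedComm_left_mul hK h1, twistedComm_left_mul hK h2, pairComm_apply]

theorem pairComm_right_mul {a a' b : A} (hK : K * b = b * K) (h1 : a * b = b * a)
    (h2 : a' * b = b * a') (m : A) : pairComm K a a' (m * b) = pairComm K a a' m * b := by
  rw [pairComm_apply, twistedComm_right_mul hK h1, twistedComm_right_mul hK h2, pairComm_apply]

theorem listComm_left_mul {b : A} (hK : K * K = 1) {l : List (Fin n)}
    (hx : ∀ i ∈ l, TwistedCommute K (x i) b) (hy : ∀ i ∈ l, TwistedCommute K (y i) b) (m : A) :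
    listComm K x y l (b * m) = b * listComm K x y l m := by
  induction l with
  | nil => rfl
  | cons i l ih =>
    rw [listComm_cons, ih (fun j hj => hx j (by simp [hj])) (fun j hj => hy j (by simp [hj])),
      pairComm_left_mul hK (hx i (by simp)) (hy i (by simp)), listComm_cons]

theorem listComm_central_mul {b : A} (hK : K * K = 1) (hb : ∀ z, b * z = z * b)
    (l : List (Fin n)) (m : A) : listComm K x y l (b * m) = b * listComm K x y l m :=
  listComm_left_mul hK (fun _ _ => twistedCommute_of_central hK hb)
    (fun _ _ => twistedCommute_of_central hK hb) m

theorem DoubleRel.twistedCommute (h : DoubleRel K c x y) {i j : Fin n} (hij : i ≠ j) :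
    (TwistedCommute K (x i) (x j) ∧ TwistedCommute K (y i) (x j)) ∧
      TwistedCommute K (x i) (y j) ∧ TwistedCommute K (y i) (y j) :=
  ⟨⟨twistedCommute_of_odd h.K_sq (h.K_x j) (h.x_x i j),
    twistedCommute_of_odd h.K_sq (h.K_x j) (h.y_x hij)⟩,
    twistedCommute_of_odd h.K_sq (h.K_y j) (h.x_y i j hij),
    twistedCommute_of_odd h.K_sq (h.K_y j) (h.y_y i j)⟩

/-- The iterated twisted commutators over `l` do not see the letters of a pair outside `l`. -/
theorem DoubleRel.listComm_mul (h : DoubleRel K c x y) {j : Fin n} {l : List (Fin n)}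
    (hj : j ∉ l) (m : A) :
    listComm K x y l (x j * m) = x j * listComm K x y l m ∧
      listComm K x y l (y j * m) = y j * listComm K x y l m ∧
      listComm K x y l (y j * x j * m) = y j * x j * listComm K x y l m := by
  have hne : ∀ i ∈ l, i ≠ j := by rintro i hi rfl; exact hj hi
  have h1 : ∀ m, listComm K x y l (x j * m) = x j * listComm K x y l m :=
    listComm_left_mul h.K_sq (fun i hi => (h.twistedCommute (hne i hi)).1.1)
      (fun i hi => (h.twistedCommute (hne i hi)).1.2)
  have h2 : ∀ m, listComm K x y l (y j * m) = y j * listComm K x y l m :=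
    listComm_left_mul h.K_sq (fun i hi => (h.twistedCommute (hne i hi)).2.1)
      (fun i hi => (h.twistedCommute (hne i hi)).2.2)
  exact ⟨h1 m, h2 m, by rw [mul_assoc, h2, h1, mul_assoc]⟩

/-- The span of `1 - c`, `K W` and `c K W`, where `W` is the product of the `wᵢ`. -/
def higmanSpan (K c : A) (x y : Fin n → A) (l : List (Fin n)) : Submodule ℂ A :=
  Submodule.span ℂ {1 - c, K * prodW x y l, c * (K * prodW x y l)}

/-- The span of `1`, `c`, `K W` and `c K W`, where `W` is the product of the `wᵢ`. -/
def preHigmanSpan (K c : A) (x y : Fin n → A) (l : List (Fin n)) : Submodule ℂ A :=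
  Submodule.span ℂ {1, c, K * prodW x y l, c * (K * prodW x y l)}

theorem higmanSpan_le_pre (l : List (Fin n)) :
    higmanSpan K c x y l ≤ preHigmanSpan K c x y l := by
  rw [higmanSpan, Submodule.span_le]
  rintro z (rfl | rfl | rfl)
  · exact Submodule.sub_mem _ (Submodule.subset_span (by simp)) (Submodule.subset_span (by simp))
  · exact Submodule.subset_span (by simp)
  · exact Submodule.subset_span (by simp)

theorem DoubleRel.c_mul_mem_higmanSpan (h : DoubleRel K c x y) {l : List (Fin n)} {z : A}
    (hz : z ∈ higmanSpan K c x y l) : c * z ∈ higmanSpan K c x y l := by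
  suffices higmanSpan K c x y l ≤ (higmanSpan K c x y l).comap (LinearMap.mulLeft ℂ c) from
    this hz
  conv_lhs => rw [higmanSpan]
  rw [Submodule.span_le]
  rintro z (rfl | rfl | rfl) <;>
    simp only [SetLike.mem_coe, Submodule.mem_comap, LinearMap.mulLeft_apply]
  · rw [mul_sub, mul_one, h.c_sq, ← neg_sub]
    exact Submodule.neg_mem _ (Submodule.subset_span (by simp))
  · exact Submodule.subset_span (by simp)
  · rw [← mul_assoc, h.c_sq, one_mul]
    exact Submodule.subset_span (by simp)

theorem DoubleRel.pairComm_right_prodW (h : DoubleRel K c x y) {j : Fin n} {l : List (Fin n)}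
    (hj : j ∉ l) (m : A) : pairComm K (x j) (y j) (m * prodW x y l) =
      pairComm K (x j) (y j) m * prodW x y l :=
  pairComm_right_mul (h.K_comm_prodW l) (h.x_comm_prodW hj) (h.y_comm_prodW hj) m

theorem DoubleRel.pairW_mul_K_mul (h : DoubleRel K c x y) (j : Fin n) (l : List (Fin n)) :
    (x j * y j - y j * x j) * K * prodW x y l = K * prodW x y (j :: l) := by
  rw [prodW_cons, ← mul_assoc K, h.K_comm_pairW, pairW]

/-- Of the words in one pair, only `y x`, `K` and `y x K` survive the twisted commutators with that
pair. -/
theorem DoubleRel.pairComm_mem_of_base (h : DoubleRel K c x y) {j : Fin n} {l : List (Fin n)}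
    (hj : j ∉ l) {z : A} (hz : z = 1 ∨ z = K * prodW x y l) :
    pairComm K (x j) (y j) z ∈ higmanSpan K c x y (j :: l) ∧
      pairComm K (x j) (y j) (x j * z) ∈ higmanSpan K c x y (j :: l) ∧
      pairComm K (x j) (y j) (y j * z) ∈ higmanSpan K c x y (j :: l) ∧
      pairComm K (x j) (y j) (y j * x j * z) ∈ higmanSpan K c x y (j :: l) := by
  have h1 : 1 - c ∈ higmanSpan K c x y (j :: l) := Submodule.subset_span (by simp)
  have h2 : K * prodW x y (j :: l) ∈ higmanSpan K c x y (j :: l) :=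
    Submodule.subset_span (by simp)
  rcases hz with rfl | rfl
  · simp only [mul_one]
    rw [pairComm_one (h.pair j), pairComm_x (h.pair j), pairComm_y (h.pair j),
      pairComm_yx (h.pair j)]
    exact ⟨Submodule.zero_mem _, Submodule.zero_mem _, Submodule.zero_mem _,
      Submodule.smul_mem _ _ h1⟩
  · simp only [← mul_assoc]
    rw [h.pairComm_right_prodW hj, h.pairComm_right_prodW hj, h.pairComm_right_prodW hj,
      h.pairComm_right_prodW hj, pairComm_K (h.pair j), pairComm_xK (h.pair j),
      pairComm_yK (h.pair j), pairComm_yxK (h.pair j), zero_mul, smul_mul_assoc,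
      mul_assoc (1 - c), h.pairW_mul_K_mul, sub_mul, one_mul]
    exact ⟨Submodule.smul_mem _ _ h2, Submodule.zero_mem _, Submodule.zero_mem _,
      Submodule.sub_mem _ h2 (h.c_mul_mem_higmanSpan h2)⟩

theorem DoubleRel.pairComm_mem (h : DoubleRel K c x y) {j : Fin n} {l : List (Fin n)}
    (hj : j ∉ l) {z : A} (hz : z ∈ preHigmanSpan K c x y l) :
    pairComm K (x j) (y j) z ∈ higmanSpan K c x y (j :: l) ∧
      pairComm K (x j) (y j) (x j * z) ∈ higmanSpan K c x y (j :: l) ∧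
      pairComm K (x j) (y j) (y j * z) ∈ higmanSpan K c x y (j :: l) ∧
      pairComm K (x j) (y j) (y j * x j * z) ∈ higmanSpan K c x y (j :: l) := by
  have hc : ∀ z, (pairComm K (x j) (y j) z ∈ higmanSpan K c x y (j :: l) ∧
      pairComm K (x j) (y j) (x j * z) ∈ higmanSpan K c x y (j :: l) ∧
      pairComm K (x j) (y j) (y j * z) ∈ higmanSpan K c x y (j :: l) ∧
      pairComm K (x j) (y j) (y j * x j * z) ∈ higmanSpan K c x y (j :: l)) →
      (pairComm K (x j) (y j) (c * z) ∈ higmanSpan K c x y (j :: l) ∧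
      pairComm K (x j) (y j) (x j * (c * z)) ∈ higmanSpan K c x y (j :: l) ∧
      pairComm K (x j) (y j) (y j * (c * z)) ∈ higmanSpan K c x y (j :: l) ∧
      pairComm K (x j) (y j) (y j * x j * (c * z)) ∈ higmanSpan K c x y (j :: l)) := by
    intro z hz
    have e : ∀ b : A, b * (c * z) = c * (b * z) := fun b => by
      rw [← mul_assoc, ← h.c_comm, mul_assoc]
    have hP : ∀ m, pairComm K (x j) (y j) (c * m) = c * pairComm K (x j) (y j) m :=
      pairComm_left_mul h.K_sq (twistedCommute_of_central h.K_sq h.c_comm)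
        (twistedCommute_of_central h.K_sq h.c_comm)
    rw [e, e, e, hP, hP, hP, hP]
    exact ⟨h.c_mul_mem_higmanSpan hz.1, h.c_mul_mem_higmanSpan hz.2.1,
      h.c_mul_mem_higmanSpan hz.2.2.1, h.c_mul_mem_higmanSpan hz.2.2.2⟩
  induction hz using Submodule.span_induction with
  | mem z hz =>
    rcases hz with rfl | rfl | rfl | rfl
    · exact h.pairComm_mem_of_base hj (Or.inl rfl)
    · simpa only [mul_one] using hc 1 (h.pairComm_mem_of_base hj (Or.inl rfl))
    · exact h.pairComm_mem_of_base hj (Or.inr rfl)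
    · exact hc _ (h.pairComm_mem_of_base hj (Or.inr rfl))
  | zero =>
    simp only [mul_zero, map_zero]
    exact ⟨Submodule.zero_mem _, Submodule.zero_mem _, Submodule.zero_mem _,
      Submodule.zero_mem _⟩
  | add a b _ _ ha hb =>
    simp only [mul_add, map_add]
    exact ⟨Submodule.add_mem _ ha.1 hb.1, Submodule.add_mem _ ha.2.1 hb.2.1,
      Submodule.add_mem _ ha.2.2.1 hb.2.2.1, Submodule.add_mem _ ha.2.2.2 hb.2.2.2⟩
  | smul r a _ ha =>
    simp only [mul_smul_comm, map_smul]
    exact ⟨Submodule.smul_mem _ _ ha.1, Submodule.smul_mem _ _ ha.2.1,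
      Submodule.smul_mem _ _ ha.2.2.1, Submodule.smul_mem _ _ ha.2.2.2⟩

/-- The induction step for the image of the iterated twisted commutators: the new pair replaces the
span of `1` and `c` by that of `1 - c`, and lengthens `W` by one factor. -/
theorem DoubleRel.listComm_cons_mem (h : DoubleRel K c x y) {j : Fin n} {l : List (Fin n)}
    (hj : j ∉ l)
    (ih : ∀ m ∈ normalForms K c x y l, listComm K x y l m ∈ preHigmanSpan K c x y l) {m : A}
    (hm : m ∈ normalForms K c x y (j :: l)) :
    listComm K x y (j :: l) m ∈ higmanSpan K c x y (j :: l) := by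
  suffices normalForms K c x y (j :: l) ≤
      (higmanSpan K c x y (j :: l)).comap (listComm K x y (j :: l)) from this hm
  refine normalForms_cons_le fun m hm => ?_
  simp only [Submodule.mem_comap, listComm_cons, (h.listComm_mul hj m).1,
    (h.listComm_mul hj m).2.1, (h.listComm_mul hj m).2.2]
  exact h.pairComm_mem hj (ih m hm)

theorem DoubleRel.listComm_mem_pre (h : DoubleRel K c x y) {l : List (Fin n)} (hl : l.Nodup)
    {m : A} (hm : m ∈ normalForms K c x y l) :
    listComm K x y l m ∈ preHigmanSpan K c x y l := by
  induction l generalizing m with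
  | nil =>
    change m ∈ _
    rw [preHigmanSpan, prodW, List.map_nil, List.prod_nil, mul_one]
    exact hm
  | cons j l ih =>
    rw [List.nodup_cons] at hl
    exact higmanSpan_le_pre _ (h.listComm_cons_mem hl.1 (fun m hm => ih hl.2 hm) hm)

theorem DoubleRel.listComm_mem (h : DoubleRel K c x y) {l : List (Fin n)} (hl : l.Nodup)
    (hl0 : l ≠ []) {m : A} (hm : m ∈ normalForms K c x y l) :
    listComm K x y l m ∈ higmanSpan K c x y l := by
  cases l with
  | nil => exact absurd rfl hl0
  | cons j l =>
    rw [List.nodup_cons] at hl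
    exact h.listComm_cons_mem hl.1 (fun m hm => h.listComm_mem_pre hl.2 hm) hm

theorem DoubleRel.listComm_K (h : DoubleRel K c x y) {l : List (Fin n)} (hl : l.Nodup) :
    listComm K x y l K = (2 ^ l.length : ℂ) • (K * prodW x y l) := by
  induction l with
  | nil => simp [listComm, prodW]
  | cons j l ih =>
    rw [List.nodup_cons] at hl
    rw [listComm_cons, ih hl.2, map_smul, h.pairComm_right_prodW hl.1, pairComm_K (h.pair j),
      smul_mul_assoc, h.pairW_mul_K_mul, smul_smul, List.length_cons, pow_succ]

theorem DoubleRel.one_sub_c_mul_self (h : DoubleRel K c x y) :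
    (1 - c) * (1 - c) = (2 : ℂ) • (1 - c) := by
  rw [mul_sub, mul_one, sub_mul, one_mul, h.c_sq]
  module

/-- The element `1 - c` is the image of a multiple of `∏ᵢ yᵢ xᵢ (1 - c)`. -/
theorem DoubleRel.exists_listComm_eq (h : DoubleRel K c x y) {l : List (Fin n)} (hl : l.Nodup) :
    ∃ p, listComm K x y l p = 1 - c := by
  induction l with
  | nil => exact ⟨1 - c, rfl⟩
  | cons j l ih =>
    rw [List.nodup_cons] at hl
    obtain ⟨p, hp⟩ := ih hl.2
    have hc : ∀ z, (1 - c) * z = z * (1 - c) := fun z => by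
      rw [sub_mul, mul_sub, one_mul, mul_one, h.c_comm]
    -- `y x` goes to `-2 (1 - c)`, and the square of `1 - c` contributes another factor `2`
    refine ⟨(-(1 / 4) : ℂ) • (y j * x j * p), ?_⟩
    rw [map_smul, listComm_cons, (h.listComm_mul hl.1 p).2.2, hp, ← hc,
      pairComm_left_mul h.K_sq (twistedCommute_of_central h.K_sq hc)
        (twistedCommute_of_central h.K_sq hc), pairComm_yx (h.pair j), mul_smul_comm,
      h.one_sub_c_mul_self]
    module

/-- The sum of the iterated twisted commutator and its conjugate by `K`. -/
def averagedComm (K : A) (x y : Fin n → A) (l : List (Fin n)) : A →ₗ[ℂ] A :=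
  (LinearMap.id + LinearMap.mulLeft ℂ K ∘ₗ LinearMap.mulRight ℂ K) ∘ₗ listComm K x y l

theorem averagedComm_apply (l : List (Fin n)) (z : A) :
    averagedComm K x y l z = listComm K x y l z + K * (listComm K x y l z * K) := rfl

theorem averagedComm_central_mul {b : A} (hK : K * K = 1) (hb : ∀ z, b * z = z * b)
    (l : List (Fin n)) (m : A) : averagedComm K x y l (b * m) = b * averagedComm K x y l m := by
  rw [averagedComm_apply, averagedComm_apply, listComm_central_mul hK hb, mul_add, mul_assoc b,
    ← mul_assoc K b, ← hb K, mul_assoc b]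

theorem DoubleRel.conj_of_mem_higmanSpan (h : DoubleRel K c x y) {l : List (Fin n)} {z : A}
    (hz : z ∈ higmanSpan K c x y l) : K * (z * K) = z := by
  suffices higmanSpan K c x y l ≤ LinearMap.eqLocus
      (LinearMap.mulLeft ℂ K ∘ₗ LinearMap.mulRight ℂ K) LinearMap.id from this hz
  rw [higmanSpan, Submodule.span_le]
  have hW : K * (K * prodW x y l * K) = K * prodW x y l := by
    rw [mul_assoc, ← h.K_comm_prodW, ← mul_assoc K K, h.K_sq, one_mul]
  rintro z (rfl | rfl | rfl)
  · change K * ((1 - c) * K) = 1 - c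
    rw [sub_mul, one_mul, h.c_comm, mul_sub, ← mul_assoc, h.K_sq, one_mul]
  · exact hW
  · change K * (c * (K * prodW x y l) * K) = c * (K * prodW x y l)
    rw [h.c_comm, ← mul_assoc, ← mul_assoc, mul_assoc (K * _), h.c_comm, ← mul_assoc,
      mul_assoc K, hW]

/-- The image of the averaged commutators over all pairs. -/
theorem DoubleRel.range_averagedComm (h : DoubleRel K c x y) {l : List (Fin n)} (hl : l.Nodup)
    (hl0 : l ≠ []) (htop : normalForms K c x y l = ⊤) :
    LinearMap.range (averagedComm K x y l) = higmanSpan K c x y l := by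
  have hmem : ∀ z, listComm K x y l z ∈ higmanSpan K c x y l := fun z =>
    h.listComm_mem hl hl0 (by rw [htop]; trivial)
  have heq : ∀ z, averagedComm K x y l z = (2 : ℂ) • listComm K x y l z := fun z => by
    rw [averagedComm_apply, h.conj_of_mem_higmanSpan (hmem z), two_smul]
  apply le_antisymm
  · rintro _ ⟨z, rfl⟩
    rw [heq]
    exact Submodule.smul_mem _ _ (hmem z)
  · rw [higmanSpan, Submodule.span_le]
    have hW : K * prodW x y l ∈ LinearMap.range (averagedComm K x y l) := by
      refine ⟨((1 / 2 : ℂ) * (2 ^ l.length)⁻¹) • K, ?_⟩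
      rw [heq, map_smul, h.listComm_K hl, smul_smul, smul_smul]
      have : (2 : ℂ) * (1 / 2) * (2 ^ l.length)⁻¹ * 2 ^ l.length = 1 := by
        field_simp
      rw [← mul_assoc, this, one_smul]
    rintro z (rfl | rfl | rfl)
    · obtain ⟨p, hp⟩ := h.exists_listComm_eq hl
      exact ⟨(1 / 2 : ℂ) • p, by rw [heq, map_smul, hp, smul_smul]; norm_num⟩
    · exact hW
    · obtain ⟨p, hp⟩ := hW
      exact ⟨c * p, by rw [averagedComm_central_mul h.K_sq h.c_comm, hp]⟩

end higman

end

section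

/-! ### The inverse of the `R`-matrix -/

section lists

variable {R ι : Type*} [Monoid R]

theorem prod_map_mul_of_commute {f g : ι → R} {l : List ι} (hl : l.Nodup)
    (h : ∀ i j, i ≠ j → g i * f j = f j * g i) :
    (l.map f).prod * (l.map g).prod = (l.map fun i => f i * g i).prod := by
  induction l with
  | nil => simp
  | cons i l ih =>
    rw [List.nodup_cons] at hl
    have h1 : g i * (l.map f).prod = (l.map f).prod * g i :=
      comm_listProd fun j hj => h i j (by rintro rfl; exact hl.1 hj)
    simp only [List.map_cons, List.prod_cons]
    rw [← ih hl.2, mul_assoc, ← mul_assoc _ (g i), ← h1]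
    simp only [mul_assoc]

theorem semiconj_listProd {a : R} {f g : ι → R} (h : ∀ i, a * f i = g i * a) (l : List ι) :
    a * (l.map f).prod = (l.map g).prod * a := by
  induction l with
  | nil => simp
  | cons i l ih =>
    simp only [List.map_cons, List.prod_cons]
    rw [← mul_assoc, h, mul_assoc, ih, mul_assoc]

end lists

section tensor

variable {A : Type*} [Ring A] [Algebra ℂ A]

theorem tmul_comm_of_anticommute {a b a' b' : A} (h1 : a * a' = -(a' * a))
    (h2 : b * b' = -(b' * b)) :
    (a ⊗ₜ[ℂ] b) * (a' ⊗ₜ[ℂ] b') = (a' ⊗ₜ[ℂ] b') * (a ⊗ₜ[ℂ] b) := by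
  rw [Algebra.TensorProduct.tmul_mul_tmul, h1, h2, neg_tmul, tmul_neg, neg_neg,
    Algebra.TensorProduct.tmul_mul_tmul]

theorem tmul_comm_of_commute {a b a' b' : A} (h1 : a * a' = a' * a)
    (h2 : b * b' = b' * b) :
    (a ⊗ₜ[ℂ] b) * (a' ⊗ₜ[ℂ] b') = (a' ⊗ₜ[ℂ] b') * (a ⊗ₜ[ℂ] b) := by
  rw [Algebra.TensorProduct.tmul_mul_tmul, h1, h2, Algebra.TensorProduct.tmul_mul_tmul]

/-- The factor of the `R`-matrix that comes from the group-like elements. -/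
def rGroup (K c : A) : A ⊗[ℂ] A :=
  (1 / 2 : ℂ) • (1 ⊗ₜ 1 + 1 ⊗ₜ (c * K) + K ⊗ₜ 1 - K ⊗ₜ (c * K))

/-- The flip of `rGroup`. -/
def rGroupFlip (K c : A) : A ⊗[ℂ] A :=
  (1 / 2 : ℂ) • (1 ⊗ₜ 1 + (c * K) ⊗ₜ 1 + 1 ⊗ₜ K - (c * K) ⊗ₜ K)

/-- The factor `F = 1 - K x ⊗ y - y K ⊗ x c + x y ⊗ y x c` of `R⁻¹ R₂₁⁻¹` that belongs to one pair
of odd generators. -/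
def rFactor (K c x y : A) : A ⊗[ℂ] A :=
  1 ⊗ₜ 1 - (K * x) ⊗ₜ y - (y * K) ⊗ₜ (x * c) + (x * y) ⊗ₜ (y * x * c)

variable {K c x y : A}

theorem PairRel.rGroup_mul_self (h : PairRel K c x y) : rGroup K c * rGroup K c = 1 := by
  simp only [rGroup, smul_mul_smul_comm, mul_add, add_mul, mul_sub, sub_mul,
    Algebra.TensorProduct.tmul_mul_tmul, mul_one, one_mul, mul_assoc, h.rules,
    Algebra.TensorProduct.one_def]
  module

theorem PairRel.rGroupFlip_mul_self (h : PairRel K c x y) :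
    rGroupFlip K c * rGroupFlip K c = 1 := by
  simp only [rGroupFlip, smul_mul_smul_comm, mul_add, add_mul, mul_sub, sub_mul,
    Algebra.TensorProduct.tmul_mul_tmul, mul_one, one_mul, mul_assoc, h.rules,
    Algebra.TensorProduct.one_def]
  module

theorem PairRel.rGroup_mul_flip_odd (h : PairRel K c x y) :
    rGroup K c * (1 - y ⊗ₜ (K * x)) = (1 - (y * K) ⊗ₜ (x * c)) * rGroup K c := by
  simp only [rGroup, smul_mul_assoc, mul_smul_comm, mul_add, add_mul, mul_sub, sub_mul,
    Algebra.TensorProduct.tmul_mul_tmul, mul_one, one_mul, mul_assoc, h.rules, mul_neg, neg_mul,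
    neg_tmul, tmul_neg, neg_neg]
  module

theorem PairRel.rFactor_eq (h : PairRel K c x y) :
    (1 - (K * x) ⊗ₜ y) * (1 - (y * K) ⊗ₜ (x * c)) = rFactor K c x y := by
  simp only [rFactor, mul_add, add_mul, mul_sub, sub_mul,
    Algebra.TensorProduct.tmul_mul_tmul, mul_one, one_mul, mul_assoc, h.rules, mul_neg, neg_mul,
    neg_tmul, tmul_neg, neg_neg, Algebra.TensorProduct.one_def, sub_tmul, tmul_sub, tmul_add,
    add_tmul]
  module

/-- The product `R₀ R₀'` of the group-like factors of `R` and `R₂₁` on the part `c = -1` of the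
second leg. -/
theorem PairRel.rGroup_mul_one_sub (h : PairRel K c x y) :
    rGroup K c * rGroupFlip K c * (1 ⊗ₜ (1 - c)) =
      (1 / 2 : ℂ) • (((1 + c) * K) ⊗ₜ (1 - c) + ((1 - c) * K) ⊗ₜ (K * (1 - c))) := by
  simp only [rGroup, rGroupFlip, smul_mul_assoc, mul_smul_comm, mul_add, add_mul, mul_sub, sub_mul,
    Algebra.TensorProduct.tmul_mul_tmul, mul_one, one_mul, mul_assoc, h.rules, sub_tmul, tmul_sub,
    tmul_add, add_tmul]
  module

/-- The product `R₀ R₀'` of the group-like factors of `R` and `R₂₁` on the part `c = 1` of the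
second leg. -/
theorem PairRel.rGroup_mul_one_add (h : PairRel K c x y) :
    rGroup K c * rGroupFlip K c * (1 ⊗ₜ (1 + c)) =
      (1 / 2 : ℂ) • ((1 + c) ⊗ₜ (1 + c) + (1 - c) ⊗ₜ (K * (1 + c))) := by
  simp only [rGroup, rGroupFlip, smul_mul_assoc, mul_smul_comm, mul_add, add_mul, mul_sub, sub_mul,
    Algebra.TensorProduct.tmul_mul_tmul, mul_one, one_mul, mul_assoc, h.rules, sub_tmul, tmul_sub,
    tmul_add, add_tmul]
  module

/-- The part of `F (1 ⊗ w)` that survives a cointegral is the last summand: the first one contains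
no `x` and the second one no `y` in the second leg. -/
theorem PairRel.rFactor_mul_w (h : PairRel K c x y) :
    rFactor K c x y * (1 ⊗ₜ (x * y - y * x)) =
      (1 ⊗ₜ (1 - c) - (K * x) ⊗ₜ (y * (1 - c))) + -((y * K) ⊗ₜ (x * (1 - c))) +
        ((x * y) ⊗ₜ (y * x * (1 - c)) - (2 : ℂ) • 1 ⊗ₜ (y * x)) := by
  simp only [rFactor, mul_add, add_mul, mul_sub, sub_mul,
    Algebra.TensorProduct.tmul_mul_tmul, mul_one, one_mul, mul_assoc, h.rules, mul_neg, neg_mul,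
    neg_tmul, tmul_neg, neg_neg, sub_tmul, tmul_sub, tmul_add, add_tmul, mul_zero, tmul_zero,
    neg_zero]
  module

theorem PairRel.rFactor_mul_w_one_add (h : PairRel K c x y) :
    rFactor K c x y * (1 ⊗ₜ ((x * y - y * x) * (1 + c))) = 1 ⊗ₜ ((x * y - y * x) * (1 + c)) := by
  simp only [rFactor, mul_add, add_mul, mul_sub, sub_mul,
    Algebra.TensorProduct.tmul_mul_tmul, mul_one, one_mul, mul_assoc, h.rules, mul_neg, neg_mul,
    neg_tmul, tmul_neg, neg_neg, sub_tmul, tmul_sub, tmul_add, add_tmul, mul_zero, tmul_zero,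
    neg_zero]
  module

end tensor

section double

variable {A : Type*} [Ring A] [Algebra ℂ A] {n : ℕ} {K c : A} {x y : Fin n → A}

/-- `∏ᵢ (1 - K xᵢ ⊗ yᵢ)`, the inverse of the odd factor of `R`. -/
def rOddInv (K : A) (x y : Fin n → A) : A ⊗[ℂ] A :=
  ((List.finRange n).map fun i => 1 - (K * x i) ⊗ₜ[ℂ] y i).prod

/-- `∏ᵢ (1 - yᵢ ⊗ K xᵢ)`, the inverse of the odd factor of `R₂₁`. -/
def rOddInvFlip (K : A) (x y : Fin n → A) : A ⊗[ℂ] A :=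
  ((List.finRange n).map fun i => 1 - y i ⊗ₜ[ℂ] (K * x i)).prod

theorem DoubleRel.Kx_mul_Kx (h : DoubleRel K c x y) (i j : Fin n) :
    K * x i * (K * x j) = -(K * x j * (K * x i)) := by
  have key : ∀ i j, K * x i * (K * x j) = -(x i * x j) := by
    intro i j
    rw [h.K_x, neg_mul, mul_assoc, ← mul_assoc K, h.K_sq, one_mul]
  rw [key, key, h.x_x]

theorem commute_one_sub {R : Type*} [Ring R] {a b : R} (h : a * b = b * a) :
    (1 - a) * (1 - b) = (1 - b) * (1 - a) := by
  simp only [mul_sub, sub_mul, mul_one, one_mul, h]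
  abel

theorem commute_one_sub_add {R : Type*} [Ring R] {a b : R} (h : a * b = b * a) :
    (1 - a) * (1 + b) = (1 + b) * (1 - a) := by
  simp only [mul_sub, sub_mul, mul_add, add_mul, mul_one, one_mul, h]
  abel

theorem one_add_mul_one_sub {R : Type*} [Ring R] {a : R} (h : a * a = 0) :
    (1 + a) * (1 - a) = 1 := by
  simp only [mul_sub, add_mul, mul_one, one_mul, h]
  abel

theorem one_sub_mul_one_add {R : Type*} [Ring R] {a : R} (h : a * a = 0) :
    (1 - a) * (1 + a) = 1 := by
  simp only [mul_add, sub_mul, mul_one, one_mul, h]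
  abel

theorem prod_one_add_mul_prod_one_sub {R ι : Type*} [Ring R] {f : ι → R} {l : List ι}
    (hl : l.Nodup) (h0 : ∀ i, f i * f i = 0) (h : ∀ i j, f i * f j = f j * f i) :
    (l.map fun i => 1 + f i).prod * (l.map fun i => 1 - f i).prod = 1 ∧
      (l.map fun i => 1 - f i).prod * (l.map fun i => 1 + f i).prod = 1 := by
  constructor
  · rw [prod_map_mul_of_commute hl fun i j _ => commute_one_sub_add (h i j)]
    simp [one_add_mul_one_sub, h0]
  · rw [prod_map_mul_of_commute hl fun i j _ => (commute_one_sub_add (h j i)).symm]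
    simp [one_sub_mul_one_add, h0]

/-- The `R`-matrix of the double in terms of generators. -/
def rMat (K c : A) (x y : Fin n → A) : A ⊗[ℂ] A :=
  rGroup K c * ((List.finRange n).map fun i => 1 + (K * x i) ⊗ₜ[ℂ] y i).prod

/-- The flip of the `R`-matrix of the double in terms of generators. -/
def rMatFlip (K c : A) (x y : Fin n → A) : A ⊗[ℂ] A :=
  rGroupFlip K c * ((List.finRange n).map fun i => 1 + y i ⊗ₜ[ℂ] (K * x i)).prod

theorem inverse_of_involution_mul {R : Type*} [Ring R] {g p q : R} (hg : g * g = 1)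
    (h : p * q = 1 ∧ q * p = 1) :
    g * p * (q * g) = 1 ∧ q * g * (g * p) = 1 := by
  constructor
  · rw [mul_assoc, ← mul_assoc p, h.1, one_mul, hg]
  · rw [mul_assoc, ← mul_assoc g, hg, one_mul, h.2]

theorem DoubleRel.rMat_inverse (h : DoubleRel K c x y) (i : Fin n) :
    rMat K c x y * (rOddInv K x y * rGroup K c) = 1 ∧
      rOddInv K x y * rGroup K c * rMat K c x y = 1 := by
  refine inverse_of_involution_mul (h.pair i).rGroup_mul_self
    (prod_one_add_mul_prod_one_sub (List.nodup_finRange n) ?_ ?_)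
  · intro i
    rw [Algebra.TensorProduct.tmul_mul_tmul, h.y_sq, tmul_zero]
  · intro i j
    exact tmul_comm_of_anticommute (h.Kx_mul_Kx i j) (h.y_y i j)

theorem DoubleRel.rMatFlip_inverse (h : DoubleRel K c x y) (i : Fin n) :
    rMatFlip K c x y * (rOddInvFlip K x y * rGroupFlip K c) = 1 ∧
      rOddInvFlip K x y * rGroupFlip K c * rMatFlip K c x y = 1 := by
  refine inverse_of_involution_mul (h.pair i).rGroupFlip_mul_self
    (prod_one_add_mul_prod_one_sub (List.nodup_finRange n) ?_ ?_)
  · intro i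
    rw [Algebra.TensorProduct.tmul_mul_tmul, h.y_sq, zero_tmul]
  · intro i j
    exact tmul_comm_of_anticommute (h.y_y i j) (h.Kx_mul_Kx i j)

/-- The product of the factors `Fᵢ` over a list. -/
def prodF (K c : A) (x y : Fin n → A) (l : List (Fin n)) : A ⊗[ℂ] A :=
  (l.map fun i => rFactor K c (x i) (y i)).prod

theorem DoubleRel.Kx_mul_yK (h : DoubleRel K c x y) {i j : Fin n} (hij : i ≠ j) :
    y i * K * (K * x j) = -(K * x j * (y i * K)) ∧
      x i * c * y j = -(y j * (x i * c)) := by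
  constructor
  · rw [mul_assoc, ← mul_assoc K, h.K_sq, one_mul, h.K_x, neg_mul, neg_neg, mul_assoc,
      ← mul_assoc K, h.K_y, neg_mul, mul_assoc, h.K_sq, mul_one, mul_neg, h.y_x hij]
  · rw [mul_assoc, h.c_comm, ← mul_assoc, h.x_y i j hij, neg_mul, mul_assoc]

/-- The inverse of `R₂₁ R`. -/
theorem DoubleRel.rInv_mul_rInvFlip (h : DoubleRel K c x y) :
    rOddInv K x y * rGroup K c * (rOddInvFlip K x y * rGroupFlip K c) =
      prodF K c x y (List.finRange n) * (rGroup K c * rGroupFlip K c) := by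
  have h1 : rGroup K c * rOddInvFlip K x y =
      ((List.finRange n).map fun i => 1 - (y i * K) ⊗ₜ[ℂ] (x i * c)).prod * rGroup K c :=
    semiconj_listProd (fun i => (h.pair i).rGroup_mul_flip_odd) _
  have h2 : rOddInv K x y *
      ((List.finRange n).map fun i => 1 - (y i * K) ⊗ₜ[ℂ] (x i * c)).prod =
      prodF K c x y (List.finRange n) := by
    rw [rOddInv, prod_map_mul_of_commute (List.nodup_finRange n), prodF]
    · simp only [(h.pair _).rFactor_eq]
    · intro i j hij
      exact commute_one_sub (tmul_comm_of_anticommute (h.Kx_mul_yK hij).1 (h.Kx_mul_yK hij).2)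
  rw [mul_assoc, ← mul_assoc (rGroup K c), h1, ← h2]
  simp only [mul_assoc]

end double

end

section

/-! ### Evaluation of a cointegral -/

section commutant

variable {R : Type*} [Ring R] [Algebra ℂ R]

/-- The elements whose left multiplication commutes with a linear map. -/
def leftCommutant (f : R →ₗ[ℂ] R) : Subalgebra ℂ R where
  carrier := {a | ∀ z, f (a * z) = a * f z}
  mul_mem' := fun {a b} ha hb z => by rw [mul_assoc, ha, hb, mul_assoc]
  add_mem' := fun {a b} ha hb z => by rw [add_mul, map_add, ha, hb, add_mul]
  algebraMap_mem' := fun r z => by rw [← Algebra.smul_def, map_smul, ← Algebra.smul_def]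

theorem tmul_mem_leftCommutant {f : R →ₗ[ℂ] R} {b : R} (hb : b ∈ leftCommutant f) (a : R) :
    a ⊗ₜ[ℂ] b ∈ leftCommutant (f.lTensor R) := by
  intro z
  induction z with
  | zero => simp
  | add s t hs ht => rw [mul_add, map_add, hs, ht, map_add, mul_add]
  | tmul p q =>
    rw [Algebra.TensorProduct.tmul_mul_tmul, LinearMap.lTensor_tmul, hb, LinearMap.lTensor_tmul,
      Algebra.TensorProduct.tmul_mul_tmul]

/-- If `f` vanishes on `P i` and on `Q i` for all `i`, then in `f (p ∏ᵢ (aᵢ + bᵢ + tᵢ) z)`, where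
`aᵢ ∈ P i`, `bᵢ ∈ Q i` and everything else lies in all `P i` and `Q i`, only the `tᵢ` count. -/
theorem map_prod_eq_of_vanish {ι M : Type*} [AddCommGroup M] [Module ℂ M] (f : R →ₗ[ℂ] M)
    {P Q : ι → Subalgebra ℂ R} (hP : ∀ i, ∀ z ∈ P i, f z = 0) (hQ : ∀ i, ∀ z ∈ Q i, f z = 0)
    {a b t : ι → R} (ha : ∀ i, a i ∈ P i) (hb : ∀ i, b i ∈ Q i)
    (ho : ∀ i j, i ≠ j → a i + b i + t i ∈ P j ∧ a i + b i + t i ∈ Q j)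
    (ht : ∀ i j, i ≠ j → t i ∈ P j ∧ t i ∈ Q j)
    {l : List ι} (hl : l.Nodup) {p z : R}
    (hp : ∀ i ∈ l, p ∈ P i ∧ p ∈ Q i) (hz : ∀ i, z ∈ P i ∧ z ∈ Q i) :
    f (p * (l.map fun i => a i + b i + t i).prod * z) = f (p * (l.map t).prod * z) := by
  induction l generalizing p with
  | nil => rfl
  | cons i l ih =>
    rw [List.nodup_cons] at hl
    have hne : ∀ j ∈ l, i ≠ j := by rintro j hj rfl; exact hl.1 hj
    simp only [List.map_cons, List.prod_cons]
    set r := (l.map fun i => a i + b i + t i).prod with hr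
    have hrP : r ∈ P i := Subalgebra.list_prod_mem _ fun s hs => by
      obtain ⟨j, hj, rfl⟩ := List.mem_map.mp hs
      exact (ho j i (hne j hj).symm).1
    have hrQ : r ∈ Q i := Subalgebra.list_prod_mem _ fun s hs => by
      obtain ⟨j, hj, rfl⟩ := List.mem_map.mp hs
      exact (ho j i (hne j hj).symm).2
    have e : p * ((a i + b i + t i) * r) * z =
        p * (a i) * r * z + p * (b i) * r * z + p * t i * r * z := by
      simp only [add_mul, mul_add, mul_assoc]
    have hpi := hp i (by simp)
    rw [e, map_add, map_add,
      hP i _ (mul_mem (mul_mem (mul_mem hpi.1 (ha i)) hrP) (hz i).1),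
      hQ i _ (mul_mem (mul_mem (mul_mem hpi.2 (hb i)) hrQ) (hz i).2), zero_add, zero_add,
      ih hl.2, mul_assoc p]
    intro j hj
    have hpj := hp j (by simp [hj])
    exact ⟨mul_mem hpj.1 (ht i j (hne j hj)).1, mul_mem hpj.2 (ht i j (hne j hj)).2⟩

end commutant

section cointegral

variable {A : Type*} [Ring A] [Algebra ℂ A] {n : ℕ}

/-- What is needed of a left cointegral `l` of the double: it is invariant under an operator `sg`
and vanishes on the images of operators `d i` and `e i`, which are skew derivations with
respect to left multiplication by `x i` and `y i`. -/
structure CointegralRel (K c : A) (x y : Fin n → A) (l : A →ₗ[ℂ] ℂ) (sg : A →ₗ[ℂ] A)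
    (d e : Fin n → A →ₗ[ℂ] A) : Prop where
  l_sg : ∀ z, l (sg z) = l z
  l_d : ∀ i z, l (d i z) = 0
  l_e : ∀ i z, l (e i z) = 0
  sg_one : sg 1 = 1
  d_one : ∀ i, d i 1 = 0
  e_one : ∀ i, e i 1 = 0
  sg_K : ∀ z, sg (K * z) = -(K * sg z)
  sg_c : ∀ z, sg (c * z) = c * sg z
  sg_x : ∀ i z, sg (x i * z) = -(x i * sg z)
  sg_y : ∀ i z, sg (y i * z) = -(y i * sg z)
  d_K : ∀ i, K ∈ leftCommutant (d i)
  d_c : ∀ i, c ∈ leftCommutant (d i)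
  d_y : ∀ i j, y j ∈ leftCommutant (d i)
  d_x : ∀ i j, i ≠ j → x j ∈ leftCommutant (d i)
  d_x_self : ∀ i z, d i (x i * z) = x i * d i z + sg z
  e_K : ∀ i, K ∈ leftCommutant (e i)
  e_c : ∀ i, c ∈ leftCommutant (e i)
  e_x : ∀ i j, x j ∈ leftCommutant (e i)
  e_y : ∀ i j, i ≠ j → y j ∈ leftCommutant (e i)
  e_y_self : ∀ i z, e i (y i * z) = y i * e i z + sg z

variable {K c : A} {x y : Fin n → A} {l : A →ₗ[ℂ] ℂ} {sg : A →ₗ[ℂ] A} {d e : Fin n → A →ₗ[ℂ] A}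

/-- The map `id ⊗ l`. -/
def sliceRight (l : A →ₗ[ℂ] ℂ) : A ⊗[ℂ] A →ₗ[ℂ] A :=
  (TensorProduct.rid ℂ A).toLinearMap ∘ₗ l.lTensor A

theorem sliceRight_tmul (l : A →ₗ[ℂ] ℂ) (a b : A) : sliceRight l (a ⊗ₜ b) = l b • a := by
  simp [sliceRight]

theorem sliceRight_lTensor (f : A →ₗ[ℂ] A) (hf : ∀ z, l (f z) = 0) (t : A ⊗[ℂ] A) :
    sliceRight l (f.lTensor A t) = 0 := by
  induction t with
  | zero => simp
  | add s t hs ht => rw [map_add, map_add, hs, ht, add_zero]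
  | tmul a b => rw [LinearMap.lTensor_tmul, sliceRight_tmul, hf, zero_smul]

/-- A cointegral vanishes on the words without `xᵢ`, because `z = dᵢ (z xᵢ)` for such a word `z`. -/
theorem CointegralRel.apply_eq_zero_d (h : CointegralRel K c x y l sg d e) (i : Fin n) (z : A)
    (hz : z ∈ leftCommutant (d i)) : l z = 0 := by
  have h1 : d i (z * x i) = z := by
    rw [hz, ← mul_one (x i), h.d_x_self, h.d_one, h.sg_one, mul_zero, zero_add, mul_one]
  rw [← h1, h.l_d]

theorem CointegralRel.apply_eq_zero_e (h : CointegralRel K c x y l sg d e) (i : Fin n) (z : A)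
    (hz : z ∈ leftCommutant (e i)) : l z = 0 := by
  have h1 : e i (z * y i) = z := by
    rw [hz, ← mul_one (y i), h.e_y_self, h.e_one, h.sg_one, mul_zero, zero_add, mul_one]
  rw [← h1, h.l_e]

theorem CointegralRel.slice_eq_zero_d (h : CointegralRel K c x y l sg d e) (i : Fin n)
    (t : A ⊗[ℂ] A) (ht : t ∈ leftCommutant ((d i).lTensor A)) : sliceRight l t = 0 := by
  have h1 : (d i).lTensor A (t * (1 ⊗ₜ x i)) = t := by
    rw [ht, LinearMap.lTensor_tmul, ← mul_one (x i), h.d_x_self, h.d_one, h.sg_one, mul_zero,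
      zero_add, ← Algebra.TensorProduct.one_def, mul_one]
  rw [← h1, sliceRight_lTensor _ (h.l_d i)]

theorem CointegralRel.slice_eq_zero_e (h : CointegralRel K c x y l sg d e) (i : Fin n)
    (t : A ⊗[ℂ] A) (ht : t ∈ leftCommutant ((e i).lTensor A)) : sliceRight l t = 0 := by
  have h1 : (e i).lTensor A (t * (1 ⊗ₜ y i)) = t := by
    rw [ht, LinearMap.lTensor_tmul, ← mul_one (y i), h.e_y_self, h.e_one, h.sg_one, mul_zero,
      zero_add, ← Algebra.TensorProduct.one_def, mul_one]
  rw [← h1, sliceRight_lTensor _ (h.l_e i)]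

/-- The product of the elements `yᵢ xᵢ` over a list. -/
def prodYX (x y : Fin n → A) (l : List (Fin n)) : A := (l.map fun i => y i * x i).prod

/-- The product of the elements `xᵢ yᵢ` over a list. -/
def prodXY (x y : Fin n → A) (l : List (Fin n)) : A := (l.map fun i => x i * y i).prod

theorem CointegralRel.yx_mem_sg (h : CointegralRel K c x y l sg d e) (i : Fin n) :
    y i * x i ∈ leftCommutant sg := fun z => by
  rw [mul_assoc, h.sg_y, h.sg_x, mul_neg, neg_neg, mul_assoc]

theorem CointegralRel.prodYX_mem_sg (h : CointegralRel K c x y l sg d e) (s : List (Fin n)) :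
    prodYX x y s ∈ leftCommutant sg := Subalgebra.list_prod_mem _ fun z hz => by
  obtain ⟨i, -, rfl⟩ := List.mem_map.mp hz
  exact h.yx_mem_sg i

/-- An odd power of `K` makes a product of pairs odd under `sg`, so that a cointegral vanishes on
it. -/
theorem CointegralRel.apply_prodYX_mul_K (h : CointegralRel K c x y l sg d e)
    (s : List (Fin n)) {z : A} (hz : z ∈ leftCommutant sg) : l (prodYX x y s * (K * z)) = 0 := by
  have h1 : sg (prodYX x y s * (K * z)) = -(prodYX x y s * (K * z)) := by
    have h2 := hz 1
    rw [mul_one, h.sg_one, mul_one] at h2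
    rw [h.prodYX_mem_sg, h.sg_K, h2, mul_neg]
  have h3 := h.l_sg (prodYX x y s * (K * z))
  rw [h1, map_neg] at h3
  exact self_eq_neg.mp h3.symm

/-- A cointegral is determined by its value on `∏ᵢ yᵢ xᵢ`. -/
theorem CointegralRel.apply_prodYX_ne_zero (h : CointegralRel K c x y l sg d e)
    (htop : normalForms K c x y (List.finRange n) = ⊤) (hl : l ≠ 0)
    (hc : l (prodYX x y (List.finRange n) * c) = 0) : l (prodYX x y (List.finRange n)) ≠ 0 := by
  intro h0
  apply hl
  -- normal forms over `t` commute with the skew derivations of the indices outside `t`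
  have hmem : ∀ t : List (Fin n), ∀ i ∉ t, normalForms K c x y t ≤
      Subalgebra.toSubmodule (leftCommutant (d i) ⊓ leftCommutant (e i)) := by
    intro t
    induction t with
    | nil =>
      intro i _
      have hcm : c ∈ leftCommutant (d i) ⊓ leftCommutant (e i) := ⟨h.d_c i, h.e_c i⟩
      have hKm : K ∈ leftCommutant (d i) ⊓ leftCommutant (e i) := ⟨h.d_K i, h.e_K i⟩
      exact normalForms_nil_le (Subalgebra.one_mem _) hcm hKm (Subalgebra.mul_mem _ hcm hKm)
    | cons j t ih =>
      intro i hi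
      have hij : i ≠ j := by rintro rfl; simp at hi
      have hit : i ∉ t := by intro hit; simp [hit] at hi
      have hx : x j ∈ leftCommutant (d i) ⊓ leftCommutant (e i) := ⟨h.d_x i j hij, h.e_x i j⟩
      have hy : y j ∈ leftCommutant (d i) ⊓ leftCommutant (e i) := ⟨h.d_y i j, h.e_y i j hij⟩
      refine normalForms_cons_le fun m hm => ?_
      have hm' : m ∈ leftCommutant (d i) ⊓ leftCommutant (e i) := ih i hit hm
      exact ⟨hm', Subalgebra.mul_mem _ hx hm', Subalgebra.mul_mem _ hy hm',
        Subalgebra.mul_mem _ (mul_mem hy hx) hm'⟩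
  -- a word that lacks a letter is annihilated, so each pair in turn contributes its factor `y x`
  have key : ∀ s t : List (Fin n), (s ++ t).Nodup → s ++ t = List.finRange n →
      normalForms K c x y t ≤ LinearMap.ker (l ∘ₗ LinearMap.mulLeft ℂ (prodYX x y s)) := by
    intro s t
    induction t generalizing s with
    | nil =>
      intro _ hs
      rw [List.append_nil] at hs
      subst hs
      apply normalForms_nil_le
      · change l (prodYX x y _ * 1) = 0
        rw [mul_one, h0]
      · exact hc
      · change l (prodYX x y _ * K) = 0
        rw [← mul_one K]
        exact h.apply_prodYX_mul_K _ (one_mem _)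
      · change l (prodYX x y _ * (c * K)) = 0
        have h1 : sg (prodYX x y (List.finRange n) * (c * K)) =
            -(prodYX x y (List.finRange n) * (c * K)) := by
          rw [h.prodYX_mem_sg, h.sg_c, ← mul_one K, h.sg_K, h.sg_one, mul_neg, mul_neg]
        have h3 := h.l_sg (prodYX x y (List.finRange n) * (c * K))
        rw [h1, map_neg] at h3
        exact self_eq_neg.mp h3.symm
    | cons i t ih =>
      intro hnd hs
      have hit : i ∉ t := (List.nodup_cons.mp (List.Nodup.of_append_right hnd)).1
      have his : i ∉ s := fun his => by
        have := List.disjoint_of_nodup_append hnd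
        exact this his (by simp)
      have hsP : prodYX x y s ∈ leftCommutant (d i) ⊓ leftCommutant (e i) :=
        Subalgebra.list_prod_mem _ fun z hz => by
          obtain ⟨j, hj, rfl⟩ := List.mem_map.mp hz
          have hij : i ≠ j := by rintro rfl; exact his hj
          exact ⟨mul_mem (h.d_y i j) (h.d_x i j hij), mul_mem (h.e_y i j hij) (h.e_x i j)⟩
      refine normalForms_cons_le fun m hm => ?_
      have hm' := hmem t i hit hm
      refine ⟨?_, ?_, ?_, ?_⟩
      · exact h.apply_eq_zero_d i _ (mul_mem hsP.1 hm'.1)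
      · exact h.apply_eq_zero_e i _ (mul_mem hsP.2 (mul_mem (h.e_x i i) hm'.2))
      · exact h.apply_eq_zero_d i _ (mul_mem hsP.1 (mul_mem (h.d_y i i) hm'.1))
      · have h1 := ih (s ++ [i]) (by simpa using hnd) (by simpa using hs) hm
        change l (prodYX x y (s ++ [i]) * m) = 0 at h1
        change l (prodYX x y s * (y i * x i * m)) = 0
        rw [← h1]
        simp [prodYX, mul_assoc]
  have h1 := key [] (List.finRange n) (List.nodup_finRange n) rfl
  rw [htop] at h1
  ext z
  have h2 : l (prodYX x y [] * z) = 0 := h1 (Submodule.mem_top (x := z))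
  simpa [prodYX] using h2

end cointegral

end

section

/-! ### The values of the Lyubashenko–Majid map `S` -/

section products

variable {A : Type*} [Ring A] [Algebra ℂ A] {n : ℕ} {K c : A} {x y : Fin n → A}

theorem prodXY_cons (i : Fin n) (l : List (Fin n)) :
    prodXY x y (i :: l) = x i * y i * prodXY x y l := by simp [prodXY]

theorem prodYX_cons (i : Fin n) (l : List (Fin n)) :
    prodYX x y (i :: l) = y i * x i * prodYX x y l := by simp [prodYX]

theorem DoubleRel.one_add_c_comm (h : DoubleRel K c x y) (z : A) :
    (1 + c) * z = z * (1 + c) := by rw [add_mul, mul_add, one_mul, mul_one, h.c_comm]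

theorem DoubleRel.one_sub_c_comm (h : DoubleRel K c x y) (z : A) :
    (1 - c) * z = z * (1 - c) := by rw [sub_mul, mul_sub, one_mul, mul_one, h.c_comm]

theorem DoubleRel.prodW_mul_one_add (h : DoubleRel K c x y) (l : List (Fin n)) :
    prodW x y l * (1 + c) = (2 ^ l.length : ℂ) • (prodXY x y l * (1 + c)) ∧
      prodW x y l * (1 + c) = ((-2) ^ l.length : ℂ) • (prodYX x y l * (1 + c)) := by
  induction l with
  | nil => simp [prodW, prodXY, prodYX]
  | cons i l ih =>
    have e1 : pairW x y i * (1 + c) = (2 : ℂ) • (x i * y i * (1 + c)) := by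
      simp only [pairW, sub_mul, mul_add, add_mul, mul_one, mul_assoc, (h.pair i).rules, mul_sub,
        neg_mul, mul_neg, one_mul]
      module
    have e2 : pairW x y i * (1 + c) = (-2 : ℂ) • (y i * x i * (1 + c)) := by
      simp only [pairW, sub_mul, mul_add, add_mul, mul_one, mul_assoc, (h.pair i).rules, mul_sub,
        neg_mul, mul_neg, one_mul]
      module
    constructor
    · rw [prodW_cons, mul_assoc, ih.1, mul_smul_comm, ← h.one_add_c_comm, ← mul_assoc, e1,
        smul_mul_assoc, smul_smul, List.length_cons, pow_succ, prodXY_cons, mul_assoc,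
        h.one_add_c_comm]
      simp only [mul_assoc]
    · rw [prodW_cons, mul_assoc, ih.2, mul_smul_comm, ← h.one_add_c_comm, ← mul_assoc, e2,
        smul_mul_assoc, smul_smul, List.length_cons, pow_succ, prodYX_cons, mul_assoc,
        h.one_add_c_comm]
      simp only [mul_assoc]

theorem DoubleRel.K_comm_prodYX (h : DoubleRel K c x y) (l : List (Fin n)) :
    K * prodYX x y l = prodYX x y l * K :=
  comm_listProd fun i _ => odd_comm_odd_mul_odd (h.K_y i) (h.K_x i)

theorem DoubleRel.c_pow_even (h : DoubleRel K c x y) {m : ℕ} (hm : Even m) : c ^ m = 1 := by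
  obtain ⟨k, rfl⟩ := hm
  rw [← two_mul, pow_mul, pow_two, h.c_sq, one_pow]

theorem DoubleRel.prod_top (h : DoubleRel K c x y) (l : List (Fin n)) :
    (l.map fun i => (x i * y i) ⊗ₜ[ℂ] (y i * x i * c)).prod =
      prodXY x y l ⊗ₜ (prodYX x y l * c ^ l.length) := by
  induction l with
  | nil => simp [prodXY, prodYX, Algebra.TensorProduct.one_def]
  | cons i l ih =>
    rw [List.map_cons, List.prod_cons, ih, Algebra.TensorProduct.tmul_mul_tmul, prodXY_cons,
      prodYX_cons, List.length_cons, pow_succ', mul_assoc (y i * x i), ← mul_assoc c,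
      h.c_comm (prodYX x y l)]
    simp only [mul_assoc]

theorem DoubleRel.prod_middle (h : DoubleRel K c x y) (l : List (Fin n)) :
    (l.map fun i => (x i * y i) ⊗ₜ[ℂ] (y i * x i * (1 - c)) - (2 : ℂ) • 1 ⊗ₜ (y i * x i)).prod *
        (1 ⊗ₜ (1 - c)) =
      (l.map fun i => (2 : ℂ) • (x i * y i) - (2 : ℂ) • 1).prod ⊗ₜ
        (prodYX x y l * (1 - c)) := by
  induction l with
  | nil => simp [prodYX, Algebra.TensorProduct.one_def]
  | cons i l ih =>
    have e : y i * x i * (1 - c) * (prodYX x y l * (1 - c)) =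
        (2 : ℂ) • (y i * x i * (prodYX x y l * (1 - c))) := by
      rw [mul_assoc (y i * x i), ← mul_assoc (1 - c), h.one_sub_c_comm, mul_assoc (prodYX x y l),
        h.one_sub_c_mul_self, mul_smul_comm, mul_smul_comm]
    simp only [List.map_cons, List.prod_cons]
    rw [mul_assoc, ih, sub_mul, smul_mul_assoc, Algebra.TensorProduct.tmul_mul_tmul,
      Algebra.TensorProduct.tmul_mul_tmul, e, prodYX_cons, one_mul, sub_mul, smul_mul_assoc,
      smul_mul_assoc, one_mul, sub_tmul, smul_tmul', tmul_smul, smul_tmul']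
    simp only [mul_assoc]

/-- On the part `c = -1` the relation `x y + y x = 2` turns `2 x y - 2` into `w`. -/
theorem DoubleRel.prod_middle_left (h : DoubleRel K c x y) (l : List (Fin n)) :
    (l.map fun i => (2 : ℂ) • (x i * y i) - (2 : ℂ) • 1).prod * (1 - c) =
      prodW x y l * (1 - c) := by
  induction l with
  | nil => simp [prodW]
  | cons i l ih =>
    have e1 : ((2 : ℂ) • (x i * y i) - (2 : ℂ) • 1) * (1 - c) = pairW x y i * (1 - c) := by
      simp only [pairW, sub_mul, mul_add, add_mul, mul_one, mul_assoc, (h.pair i).rules, mul_sub,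
        neg_mul, mul_neg, one_mul, smul_mul_assoc]
      module
    rw [List.map_cons, List.prod_cons, mul_assoc, ih, ← h.one_sub_c_comm, ← mul_assoc, e1,
      prodW_cons, mul_assoc, h.one_sub_c_comm, mul_assoc]

theorem one_tmul_listProd (f : Fin n → A) (l : List (Fin n)) :
    (1 : A) ⊗ₜ[ℂ] (l.map f).prod = (l.map fun i => (1 : A) ⊗ₜ[ℂ] f i).prod := by
  induction l with
  | nil => simp [Algebra.TensorProduct.one_def]
  | cons i l ih =>
    rw [List.map_cons, List.prod_cons, List.map_cons, List.prod_cons, ← ih,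
      Algebra.TensorProduct.tmul_mul_tmul, one_mul]

theorem DoubleRel.prodF_mul_prodW (h : DoubleRel K c x y) {l : List (Fin n)} (hl : l.Nodup) :
    prodF K c x y l * (1 ⊗ₜ prodW x y l) =
      (l.map fun i => rFactor K c (x i) (y i) * (1 ⊗ₜ pairW x y i)).prod := by
  rw [prodW, one_tmul_listProd, prodF, prod_map_mul_of_commute hl]
  intro i j hij
  have hx := h.x_comm_pairW hij.symm
  have hy := h.y_comm_pairW hij.symm
  have hc := (h.c_comm (pairW x y i)).symm
  have hw : ∀ b : A, pairW x y i * b = b * pairW x y i → ∀ a : A,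
      (1 ⊗ₜ[ℂ] pairW x y i) * (a ⊗ₜ b) = (a ⊗ₜ b) * (1 ⊗ₜ pairW x y i) := fun b hb a =>
    tmul_comm_of_commute (by rw [one_mul, mul_one]) hb
  have hxc : pairW x y i * (x j * c) = x j * c * pairW x y i := by
    rw [← mul_assoc, ← hx, mul_assoc, hc, mul_assoc]
  have hyx : pairW x y i * (y j * x j * c) = y j * x j * c * pairW x y i := by
    rw [mul_assoc (y j), ← mul_assoc, ← hy, mul_assoc, hxc, ← mul_assoc (y j)]
  rw [rFactor, mul_add, mul_sub, mul_sub, hw 1 (by rw [one_mul, mul_one]), hw _ hy.symm, hw _ hxc,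
    hw _ hyx, ← sub_mul, ← sub_mul, ← add_mul]

theorem DoubleRel.prodF_mul_prodW_one_add (h : DoubleRel K c x y) {l : List (Fin n)}
    (hl : l.Nodup) : prodF K c x y l * (1 ⊗ₜ prodW x y l) * (1 ⊗ₜ (1 + c)) =
      1 ⊗ₜ (prodW x y l * (1 + c)) := by
  rw [h.prodF_mul_prodW hl]
  have hc : ∀ t : A ⊗[ℂ] A, (1 ⊗ₜ (1 + c)) * t = t * (1 ⊗ₜ (1 + c)) := by
    intro t
    induction t with
    | zero => simp
    | add s t hs ht => rw [mul_add, hs, ht, add_mul]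
    | tmul a b => exact tmul_comm_of_commute (by rw [one_mul, mul_one]) (h.one_add_c_comm b)
  clear hl
  induction l with
  | nil => simp [prodW]
  | cons i l ih =>
    have e := (h.pair i).rFactor_mul_w_one_add
    rw [List.map_cons, List.prod_cons, mul_assoc, ← hc, ← mul_assoc, mul_assoc (rFactor _ _ _ _),
      Algebra.TensorProduct.tmul_mul_tmul, one_mul, pairW, e, ← pairW]
    rw [prodW_cons, ← one_mul (1 : A), ← Algebra.TensorProduct.tmul_mul_tmul, one_mul, mul_assoc,
      hc, ih, Algebra.TensorProduct.tmul_mul_tmul, one_mul, mul_assoc]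

/-- How the group-like part of the second leg moves past `K W`. -/
theorem group_mul_one_tmul {P W p q : A} (hK : K * K = 1) (hP : ∀ z, P * z = z * P)
    (hW : K * W = W * K) :
    (p ⊗ₜ[ℂ] P + q ⊗ₜ[ℂ] (K * P)) * (1 ⊗ₜ (K * W)) =
      (1 ⊗ₜ W) * ((1 ⊗ₜ P) * (p ⊗ₜ K + q ⊗ₜ 1)) := by
  simp only [add_mul, mul_add, Algebra.TensorProduct.tmul_mul_tmul, mul_one, one_mul]
  have a1 : P * (K * W) = W * (P * K) := by rw [hW, hP, hP, mul_assoc]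
  have a2 : K * P * (K * W) = W * P := by
    rw [← hP, mul_assoc, ← mul_assoc K, hK, one_mul, hP]
  rw [a1, a2]

end products

section values

variable {A : Type*} [Ring A] [Algebra ℂ A] {n : ℕ} {K c : A} {x y : Fin n → A} {l : A →ₗ[ℂ] ℂ}
  {sg : A →ₗ[ℂ] A} {d e : Fin n → A →ₗ[ℂ] A}

/-- Under `id ⊗ l` only the last summand `x y ⊗ y x c` of each factor `F` survives, because `l`
vanishes on words that lack a letter. -/
theorem CointegralRel.rFactor_slice (h : CointegralRel K c x y l sg d e) {z : A ⊗[ℂ] A}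
    (hz : ∀ i, z ∈ leftCommutant ((d i).lTensor A) ∧ z ∈ leftCommutant ((e i).lTensor A)) :
    sliceRight l (prodF K c x y (List.finRange n) * z) = sliceRight l
      (((List.finRange n).map fun i => (x i * y i) ⊗ₜ[ℂ] (y i * x i * c)).prod * z) := by
  have e1 : ∀ i, rFactor K c (x i) (y i) = (1 ⊗ₜ 1 - (K * x i) ⊗ₜ y i) +
      -((y i * K) ⊗ₜ (x i * c)) + (x i * y i) ⊗ₜ (y i * x i * c) := fun i => by
    rw [rFactor, ← sub_eq_add_neg]
  have := map_prod_eq_of_vanish (sliceRight l) (P := fun i => leftCommutant ((d i).lTensor A))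
    (Q := fun i => leftCommutant ((e i).lTensor A)) h.slice_eq_zero_d h.slice_eq_zero_e
    (a := fun i => 1 ⊗ₜ 1 - (K * x i) ⊗ₜ y i) (b := fun i => -((y i * K) ⊗ₜ (x i * c)))
    (t := fun i => (x i * y i) ⊗ₜ (y i * x i * c)) ?_ ?_ ?_ ?_ (List.nodup_finRange n)
    (p := 1) (z := z) (fun _ _ => ⟨one_mem _, one_mem _⟩) hz
  · simp only [one_mul] at this
    rw [← this, prodF]
    simp only [e1]
  · intro i
    exact sub_mem (tmul_mem_leftCommutant (one_mem _) _) (tmul_mem_leftCommutant (h.d_y i i) _)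
  · intro i
    exact neg_mem (tmul_mem_leftCommutant (mul_mem (h.e_x i i) (h.e_c i)) _)
  · intro i j hij
    have hx := h.d_x j i hij.symm
    have hy := h.e_y j i hij.symm
    exact ⟨add_mem (add_mem (sub_mem (tmul_mem_leftCommutant (one_mem _) _)
        (tmul_mem_leftCommutant (h.d_y j i) _))
        (neg_mem (tmul_mem_leftCommutant (mul_mem hx (h.d_c j)) _)))
        (tmul_mem_leftCommutant (mul_mem (mul_mem (h.d_y j i) hx) (h.d_c j)) _),
      add_mem (add_mem (sub_mem (tmul_mem_leftCommutant (one_mem _) _)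
        (tmul_mem_leftCommutant hy _))
        (neg_mem (tmul_mem_leftCommutant (mul_mem (h.e_x j i) (h.e_c j)) _)))
        (tmul_mem_leftCommutant (mul_mem (mul_mem hy (h.e_x j i)) (h.e_c j)) _)⟩
  · intro i j hij
    exact ⟨tmul_mem_leftCommutant
        (mul_mem (mul_mem (h.d_y j i) (h.d_x j i hij.symm)) (h.d_c j)) _,
      tmul_mem_leftCommutant
        (mul_mem (mul_mem (h.e_y j i hij.symm) (h.e_x j i)) (h.e_c j)) _⟩

/-- The analogue of `rFactor_slice` in the presence of the factors `w` in the second leg. -/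
theorem CointegralRel.rFactor_w_slice (h : CointegralRel K c x y l sg d e)
    (hD : DoubleRel K c x y) {z : A ⊗[ℂ] A}
    (hz : ∀ i, z ∈ leftCommutant ((d i).lTensor A) ∧ z ∈ leftCommutant ((e i).lTensor A)) :
    sliceRight l (prodF K c x y (List.finRange n) * (1 ⊗ₜ prodW x y (List.finRange n)) * z) =
      sliceRight l (((List.finRange n).map fun i => (x i * y i) ⊗ₜ[ℂ] (y i * x i * (1 - c)) -
        (2 : ℂ) • 1 ⊗ₜ (y i * x i)).prod * z) := by
  have e1 := fun i => (hD.pair i).rFactor_mul_w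
  have hdc : ∀ i, 1 - c ∈ leftCommutant (d i) := fun i => sub_mem (one_mem _) (h.d_c i)
  have hec : ∀ i, 1 - c ∈ leftCommutant (e i) := fun i => sub_mem (one_mem _) (h.e_c i)
  have := map_prod_eq_of_vanish (sliceRight l) (P := fun i => leftCommutant ((d i).lTensor A))
    (Q := fun i => leftCommutant ((e i).lTensor A)) h.slice_eq_zero_d h.slice_eq_zero_e
    (a := fun i => 1 ⊗ₜ (1 - c) - (K * x i) ⊗ₜ (y i * (1 - c)))
    (b := fun i => -((y i * K) ⊗ₜ (x i * (1 - c))))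
    (t := fun i => (x i * y i) ⊗ₜ (y i * x i * (1 - c)) - (2 : ℂ) • 1 ⊗ₜ (y i * x i))
    ?_ ?_ ?_ ?_ (List.nodup_finRange n)
    (p := 1) (z := z) (fun _ _ => ⟨one_mem _, one_mem _⟩) hz
  · simp only [one_mul] at this
    rw [← this, hD.prodF_mul_prodW (List.nodup_finRange n)]
    simp only [pairW, e1]
  · intro i
    exact sub_mem (tmul_mem_leftCommutant (hdc i) _)
      (tmul_mem_leftCommutant (mul_mem (h.d_y i i) (hdc i)) _)
  · intro i
    exact neg_mem (tmul_mem_leftCommutant (mul_mem (h.e_x i i) (hec i)) _)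
  · intro i j hij
    have hx := h.d_x j i hij.symm
    have hy := h.e_y j i hij.symm
    exact ⟨add_mem (add_mem (sub_mem (tmul_mem_leftCommutant (hdc j) _)
        (tmul_mem_leftCommutant (mul_mem (h.d_y j i) (hdc j)) _))
        (neg_mem (tmul_mem_leftCommutant (mul_mem hx (hdc j)) _)))
        (sub_mem (tmul_mem_leftCommutant (mul_mem (mul_mem (h.d_y j i) hx) (hdc j)) _)
          (Subalgebra.smul_mem _ (tmul_mem_leftCommutant (mul_mem (h.d_y j i) hx) _) _)),
      add_mem (add_mem (sub_mem (tmul_mem_leftCommutant (hec j) _)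
        (tmul_mem_leftCommutant (mul_mem hy (hec j)) _))
        (neg_mem (tmul_mem_leftCommutant (mul_mem (h.e_x j i) (hec j)) _)))
        (sub_mem (tmul_mem_leftCommutant (mul_mem (mul_mem hy (h.e_x j i)) (hec j)) _)
          (Subalgebra.smul_mem _ (tmul_mem_leftCommutant (mul_mem hy (h.e_x j i)) _) _))⟩
  · intro i j hij
    have hx := h.d_x j i hij.symm
    have hy := h.e_y j i hij.symm
    exact ⟨sub_mem (tmul_mem_leftCommutant (mul_mem (mul_mem (h.d_y j i) hx) (hdc j)) _)
        (Subalgebra.smul_mem _ (tmul_mem_leftCommutant (mul_mem (h.d_y j i) hx) _) _),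
      sub_mem (tmul_mem_leftCommutant (mul_mem (mul_mem hy (h.e_x j i)) (hec j)) _)
        (Subalgebra.smul_mem _ (tmul_mem_leftCommutant (mul_mem hy (h.e_x j i)) _) _)⟩

/-- The map `z ↦ (id ⊗ l)(R⁻¹ R₂₁⁻¹ (1 ⊗ z))`. -/
def sMap (K c : A) (x y : Fin n → A) (l : A →ₗ[ℂ] ℂ) (z : A) : A :=
  sliceRight l (prodF K c x y (List.finRange n) * (rGroup K c * rGroupFlip K c) * (1 ⊗ₜ z))

theorem CointegralRel.one_sub_c_mem_sg (h : CointegralRel K c x y l sg d e) :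
    1 - c ∈ leftCommutant sg ∧ 1 + c ∈ leftCommutant sg :=
  ⟨sub_mem (one_mem _) h.sg_c, add_mem (one_mem _) h.sg_c⟩

/-- The value of the Lyubashenko–Majid map at `1 - c`. -/
theorem CointegralRel.sMap_one_sub (h : CointegralRel K c x y l sg d e)
    (hD : DoubleRel K c x y) (hn : Even n) (i₀ : Fin n)
    (hc : l (prodYX x y (List.finRange n) * c) = 0) :
    sMap K c x y l (1 - c) = (l (prodYX x y (List.finRange n)) / 2 / 2 ^ n) •
      (K * prodW x y (List.finRange n) * (1 + c)) := by
  have hl1 : l (prodYX x y (List.finRange n) * (1 - c)) = l (prodYX x y (List.finRange n)) := by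
    rw [mul_sub, mul_one, map_sub, hc, sub_zero]
  rw [sMap, mul_assoc, (hD.pair i₀).rGroup_mul_one_sub, h.rFactor_slice, hD.prod_top,
    List.length_finRange, hD.c_pow_even hn, mul_one, mul_smul_comm, map_smul, mul_add,
    Algebra.TensorProduct.tmul_mul_tmul, Algebra.TensorProduct.tmul_mul_tmul, map_add,
    sliceRight_tmul, sliceRight_tmul, h.apply_prodYX_mul_K _ h.one_sub_c_mem_sg.1, zero_smul,
    add_zero, hl1, mul_assoc K, (hD.prodW_mul_one_add _).1, List.length_finRange, mul_smul_comm,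
    smul_smul, smul_smul]
  · rw [← mul_assoc, ← mul_assoc,
      show K * prodXY x y (List.finRange n) = prodXY x y (List.finRange n) * K from
        comm_listProd fun i _ => odd_comm_odd_mul_odd (hD.K_x i) (hD.K_y i),
      mul_assoc _ K, ← hD.one_add_c_comm K, mul_assoc]
    congr 1
    field_simp
  · intro i
    have hd : 1 - c ∈ leftCommutant (d i) := sub_mem (one_mem _) (h.d_c i)
    have he : 1 - c ∈ leftCommutant (e i) := sub_mem (one_mem _) (h.e_c i)
    exact ⟨Subalgebra.smul_mem _ (add_mem (tmul_mem_leftCommutant hd _)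
        (tmul_mem_leftCommutant (mul_mem (h.d_K i) hd) _)) _,
      Subalgebra.smul_mem _ (add_mem (tmul_mem_leftCommutant he _)
        (tmul_mem_leftCommutant (mul_mem (h.e_K i) he) _)) _⟩

/-- The element `ω (1 - c)` is an eigenvector of the Lyubashenko–Majid map. -/
theorem CointegralRel.sMap_w_one_sub (h : CointegralRel K c x y l sg d e)
    (hD : DoubleRel K c x y) (i₀ : Fin n)
    (hc : l (prodYX x y (List.finRange n) * c) = 0) :
    sMap K c x y l (K * prodW x y (List.finRange n) * (1 - c)) =
      (l (prodYX x y (List.finRange n)) / 2) •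
        (K * prodW x y (List.finRange n) * (1 - c)) := by
  set W := prodW x y (List.finRange n) with hW
  set Y := prodYX x y (List.finRange n) with hY
  have hl1 : l (Y * (1 - c)) = l Y := by rw [mul_sub, mul_one, map_sub, hc, sub_zero]
  have hKW : K * W = W * K := hD.K_comm_prodW _
  have e1 : rGroup K c * rGroupFlip K c * (1 ⊗ₜ (K * W * (1 - c))) = (1 ⊗ₜ W) *
      ((1 ⊗ₜ (1 - c)) * ((1 / 2 : ℂ) • (((1 + c) * K) ⊗ₜ K + ((1 - c) * K) ⊗ₜ 1))) := by
    have : (1 : A) ⊗ₜ[ℂ] (K * W * (1 - c)) = (1 ⊗ₜ (1 - c)) * (1 ⊗ₜ (K * W)) := by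
      rw [Algebra.TensorProduct.tmul_mul_tmul, one_mul, hD.one_sub_c_comm]
    rw [this, ← mul_assoc, (hD.pair i₀).rGroup_mul_one_sub]
    rw [smul_mul_assoc, mul_smul_comm, mul_smul_comm,
      group_mul_one_tmul hD.K_sq hD.one_sub_c_comm hKW]
  rw [sMap, mul_assoc, e1, ← mul_assoc, hW, h.rFactor_w_slice hD, ← mul_assoc, hD.prod_middle,
    mul_smul_comm, map_smul, mul_add, Algebra.TensorProduct.tmul_mul_tmul,
    Algebra.TensorProduct.tmul_mul_tmul, map_add, sliceRight_tmul, sliceRight_tmul, mul_one,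
    ← hY, hl1, mul_assoc Y, hD.one_sub_c_comm K, h.apply_prodYX_mul_K _ h.one_sub_c_mem_sg.1,
    zero_smul, zero_add, ← hD.one_sub_c_comm K, ← mul_assoc, hD.prod_middle_left, ← hW, hKW,
    smul_smul, mul_assoc, hD.one_sub_c_comm, mul_assoc]
  · congr 1
    ring
  · intro i
    have hd : 1 - c ∈ leftCommutant (d i) := sub_mem (one_mem _) (h.d_c i)
    have he : 1 - c ∈ leftCommutant (e i) := sub_mem (one_mem _) (h.e_c i)
    exact ⟨mul_mem (tmul_mem_leftCommutant hd _)
        (Subalgebra.smul_mem _ (add_mem (tmul_mem_leftCommutant (h.d_K i) _)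
          (tmul_mem_leftCommutant (one_mem _) _)) _),
      mul_mem (tmul_mem_leftCommutant he _)
        (Subalgebra.smul_mem _ (add_mem (tmul_mem_leftCommutant (h.e_K i) _)
          (tmul_mem_leftCommutant (one_mem _) _)) _)⟩

/-- The value of the Lyubashenko–Majid map at `ω (1 + c)`, on which the odd factors of the
`R`-matrices act trivially. -/
theorem CointegralRel.sMap_w_one_add (h : CointegralRel K c x y l sg d e)
    (hD : DoubleRel K c x y) (hn : Even n) (i₀ : Fin n)
    (hc : l (prodYX x y (List.finRange n) * c) = 0) :
    sMap K c x y l (K * prodW x y (List.finRange n) * (1 + c)) =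
      (2 ^ n * l (prodYX x y (List.finRange n)) / 2) • (1 - c) := by
  set W := prodW x y (List.finRange n) with hW
  set Y := prodYX x y (List.finRange n) with hY
  have hl1 : l (Y * (1 + c)) = l Y := by rw [mul_add, mul_one, map_add, hc, add_zero]
  have hKW : K * W = W * K := hD.K_comm_prodW _
  have e1 : rGroup K c * rGroupFlip K c * (1 ⊗ₜ (K * W * (1 + c))) = (1 ⊗ₜ W) *
      ((1 ⊗ₜ (1 + c)) * ((1 / 2 : ℂ) • ((1 + c) ⊗ₜ K + (1 - c) ⊗ₜ 1))) := by
    have : (1 : A) ⊗ₜ[ℂ] (K * W * (1 + c)) = (1 ⊗ₜ (1 + c)) * (1 ⊗ₜ (K * W)) := by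
      rw [Algebra.TensorProduct.tmul_mul_tmul, one_mul, hD.one_add_c_comm]
    rw [this, ← mul_assoc, (hD.pair i₀).rGroup_mul_one_add]
    rw [smul_mul_assoc, mul_smul_comm, mul_smul_comm,
      group_mul_one_tmul hD.K_sq hD.one_add_c_comm hKW]
  rw [sMap, mul_assoc, e1, ← mul_assoc, ← mul_assoc, hW,
    hD.prodF_mul_prodW_one_add (List.nodup_finRange n), ← hW, hW, (hD.prodW_mul_one_add _).2,
    List.length_finRange, ← hY, hn.neg_pow, mul_smul_comm, map_smul, mul_add,
    Algebra.TensorProduct.tmul_mul_tmul, Algebra.TensorProduct.tmul_mul_tmul, map_add,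
    sliceRight_tmul, sliceRight_tmul, mul_one, smul_mul_assoc, mul_assoc Y, hD.one_add_c_comm K,
    map_smul, h.apply_prodYX_mul_K _ h.one_sub_c_mem_sg.2, smul_zero, zero_smul, zero_add,
    map_smul, hl1, one_mul, smul_smul, smul_eq_mul]
  congr 1
  ring

end values

end

section

variable {n : ℕ}

/-! ### The double satisfies the abstract relations -/

/-- The central group-like element `c = K̄ K` of the double. -/
def gc (n : ℕ) : Dbl n := gKb n * gK n

theorem gc_mul_gK : gc n * gK n = gKb n := by rw [gc, mul_assoc, gK_mul_gK, mul_one]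

theorem gc_comm (a : Dbl n) : gc n * a = a * gc n := by
  have h : Algebra.adjoin ℂ (dblGens n) ≤ Subalgebra.centralizer ℂ {gc n} := by
    rw [Algebra.adjoin_le_iff]
    intro g hg
    rw [SetLike.mem_coe, Subalgebra.mem_centralizer_iff]
    rintro _ rfl
    rcases hg with rfl | rfl | ⟨i, rfl⟩ | ⟨i, rfl⟩
    · rw [gc, ← gK_mul_gKb, mul_assoc, ← gK_mul_gKb]
    · rw [gc, mul_assoc, gK_mul_gKb]
    · rw [gc, mul_assoc, gK_mul_gx, mul_neg, ← mul_assoc, ← mul_assoc, gx_mul_gKb, neg_mul]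
    · rw [gc, mul_assoc, gK_mul_gy, mul_neg, ← mul_assoc, gKb_mul_gy, neg_mul, neg_neg, mul_assoc]
  rw [adjoin_dblGens] at h
  exact (Subalgebra.mem_centralizer_iff ℂ).mp (h (Algebra.mem_top (x := a))) _ rfl

theorem doubleRel (n : ℕ) : DoubleRel (gK n) (gc n) (gx (n := n)) gy where
  K_sq := gK_mul_gK
  c_sq := by rw [gc, mul_assoc, ← mul_assoc (gK n), gK_mul_gKb, mul_assoc, gK_mul_gK, mul_one,
    gKb_mul_gKb]
  c_comm := gc_comm
  K_x := gK_mul_gx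
  K_y := gK_mul_gy
  x_sq := gx_mul_self
  y_sq := gy_mul_self
  x_x := gx_mul_gx
  y_y := gy_mul_gy
  x_y i j hij := by rw [gx_mul_gy, if_neg hij, add_zero]
  x_y_self i := by rw [gx_mul_gy, if_pos rfl, gc]

theorem normalForms_dbl (n : ℕ) :
    normalForms (gK n) (gc n) (gx (n := n)) gy (List.finRange n) = ⊤ := by
  apply (doubleRel n).normalForms_eq_top
  rw [eq_top_iff, ← adjoin_dblGens, Algebra.adjoin_le_iff]
  rintro g (rfl | rfl | hg)
  · exact Algebra.subset_adjoin (by simp)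
  · rw [← gc_mul_gK]
    exact mul_mem (Algebra.subset_adjoin (by simp)) (Algebra.subset_adjoin (by simp))
  · exact Algebra.subset_adjoin (Set.mem_insert_of_mem _ (Set.mem_insert_of_mem _ hg))

theorem RMatrix_eq_map_canon :
    RMatrix ℂ (NicholsAlgebra n) = Algebra.TensorProduct.map (ofH n) (ofHd n) (canon n) := by
  rw [← coevaluation_eq_canon]
  unfold RMatrix
  generalize coevaluation ℂ (NicholsAlgebra n) 1 = t
  induction t with
  | zero => rw [map_zero, map_zero]; exact (map_zero (Algebra.TensorProduct.map (ofH n) (ofHd n))).symm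
  | add s t hs ht =>
    rw [map_add, map_add, hs, ht]
    exact (map_add (Algebra.TensorProduct.map (ofH n) (ofHd n)) _ _).symm
  | tmul a f => rfl

theorem map_canon : Algebra.TensorProduct.map (ofH n) (ofHd n) (canon n) =
    rMat (gK n) (gc n) (gx (n := n)) gy := by
  rw [canon, map_mul, rMat]
  congr 1
  · rw [canonGroup, rGroup, map_smul, map_sub, map_add, map_add]
    simp only [Algebra.TensorProduct.map_tmul, map_one, gc_mul_gK]
    rfl
  · rw [canonOdd, map_list_prod, List.map_map]
    congr 1
    apply List.map_congr_left
    intro i _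
    simp only [Function.comp_apply, map_add, map_one, Algebra.TensorProduct.map_tmul, map_mul]
    rfl

theorem RMatrix_eq : RMatrix ℂ (NicholsAlgebra n) = rMat (gK n) (gc n) (gx (n := n)) gy :=
  RMatrix_eq_map_canon.trans map_canon

theorem comm_rMat {A : Type*} [Ring A] [Algebra ℂ A] (K c : A) (x y : Fin n → A) :
    Algebra.TensorProduct.comm ℂ A A (rMat K c x y) = rMatFlip K c x y := by
  rw [rMat, rMatFlip, map_mul, rGroup, rGroupFlip, map_smul, map_sub, map_add, map_add,
    map_list_prod, List.map_map]
  congr 1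

theorem RMatrix₂₁_eq :
    RMatrix₂₁ ℂ (NicholsAlgebra n) = rMatFlip (gK n) (gc n) (gx (n := n)) gy := by
  unfold RMatrix₂₁
  rw [RMatrix_eq]
  exact comm_rMat _ _ _ _

theorem inverse_RMatrix (i : Fin n) : Ring.inverse (RMatrix ℂ (NicholsAlgebra n)) =
    rOddInv (gK n) (gx (n := n)) gy * rGroup (gK n) (gc n) := by
  have h := (doubleRel n).rMat_inverse i
  rw [RMatrix_eq]
  exact Ring.inverse_unit ⟨_, _, h.1, h.2⟩

theorem inverse_RMatrix₂₁ (i : Fin n) : Ring.inverse (RMatrix₂₁ ℂ (NicholsAlgebra n)) =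
    rOddInvFlip (gK n) (gx (n := n)) gy * rGroupFlip (gK n) (gc n) := by
  have h := (doubleRel n).rMatFlip_inverse i
  rw [RMatrix₂₁_eq]
  exact Ring.inverse_unit ⟨_, _, h.1, h.2⟩

/-- The element `(R₂₁ R)⁻¹` of `D ⊗ D` in terms of generators. -/
def monodromyInv (n : ℕ) : Dbl n ⊗[ℂ] Dbl n :=
  prodF (gK n) (gc n) (gx (n := n)) gy (List.finRange n) *
    (rGroup (gK n) (gc n) * rGroupFlip (gK n) (gc n))

theorem inverse_monodromy (i : Fin n) :
    Ring.inverse (RMatrix₂₁ ℂ (NicholsAlgebra n) * RMatrix ℂ (NicholsAlgebra n)) =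
      monodromyInv n := by
  have h := (doubleRel n).rMat_inverse i
  have h' := (doubleRel n).rMatFlip_inverse i
  rw [RMatrix_eq, RMatrix₂₁_eq, monodromyInv, ← (doubleRel n).rInv_mul_rInvFlip]
  let u : (Dbl n ⊗[ℂ] Dbl n)ˣ := ⟨_, _, h'.1, h'.2⟩
  let w : (Dbl n ⊗[ℂ] Dbl n)ˣ := ⟨_, _, h.1, h.2⟩
  exact Ring.inverse_unit (u * w)

theorem commute_one_tmul {A : Type*} [Ring A] [Algebra ℂ A] {z : A} (hz : ∀ a, z * a = a * z)
    (t : A ⊗[ℂ] A) : (1 ⊗ₜ[ℂ] z) * t = t * (1 ⊗ₜ[ℂ] z) := by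
  induction t with
  | zero => simp
  | add s t hs ht => rw [mul_add, hs, ht, add_mul]
  | tmul a b => exact tmul_comm_of_commute (by rw [one_mul, mul_one]) (hz b)

/-- The Lyubashenko–Majid map on central elements. -/
theorem lyubashenkoMajidS_eq (i : Fin n) (l : Dbl n →ₗ[ℂ] ℂ) {z : Dbl n}
    (hz : ∀ a, z * a = a * z) :
    lyubashenkoMajidS l z = sMap (gK n) (gc n) (gx (n := n)) gy l z := by
  unfold lyubashenkoMajidS sMap
  rw [inverse_RMatrix i, inverse_RMatrix₂₁ i, mul_assoc, commute_one_tmul hz, ← mul_assoc,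
    (doubleRel n).rInv_mul_rInvFlip]
  rfl

/-! ### Operators on the double attached to a cointegral -/

/-- The operator `p ⊗ q` on the double. -/
def opElt (p : DualNichols n →ₗ[ℂ] DualNichols n)
    (q : NicholsAlgebra n →ₗ[ℂ] NicholsAlgebra n) : Dbl n →ₗ[ℂ] Dbl n :=
  DrinfeldDouble.liftLinear (LinearMap.mk₂ ℂ
    (fun (φ : DualAlg ℂ (NicholsAlgebra n)) a => elt (p φ) (q a))
    (fun φ ψ a => (congrArg (fun χ => elt χ (q a)) (map_add p φ ψ)).trans (elt_add _ _ _))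
    (fun r φ a => (congrArg (fun χ => elt χ (q a)) (map_smul p r φ)).trans (elt_smul _ _ _))
    (fun φ a b => by rw [map_add, map_add]) (fun r φ a => by rw [map_smul, map_smul]))

/-- The map `a ↦ ∑ f(a₍₁₎) a₍₂₎`. -/
def hSlice (f : NicholsAlgebra n →ₗ[ℂ] ℂ) : NicholsAlgebra n →ₗ[ℂ] NicholsAlgebra n :=
  (TensorProduct.lid ℂ (NicholsAlgebra n)).toLinearMap ∘ₗ f.rTensor _ ∘ₗ comul

theorem hSlice_apply (f : NicholsAlgebra n →ₗ[ℂ] ℂ) (a : NicholsAlgebra n) :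
    hSlice f a = TensorProduct.lid ℂ (NicholsAlgebra n) (f.rTensor _ (comul a)) := rfl

theorem lid_rTensor_tmul_mul (f : NicholsAlgebra n →ₗ[ℂ] ℂ) (a b : NicholsAlgebra n)
    (t : NicholsAlgebra n ⊗[ℂ] NicholsAlgebra n) :
    TensorProduct.lid ℂ (NicholsAlgebra n) (f.rTensor _ ((a ⊗ₜ b) * t)) =
      b * TensorProduct.lid ℂ (NicholsAlgebra n)
        ((f ∘ₗ LinearMap.mulLeft ℂ a).rTensor _ t) := by
  induction t with
  | zero => simp
  | add s t hs ht => simp only [mul_add, map_add, hs, ht]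
  | tmul p q => simp

theorem hSlice_K_mul (f : NicholsAlgebra n →ₗ[ℂ] ℂ) (a : NicholsAlgebra n) :
    hSlice f (K n * a) = K n * hSlice (f ∘ₗ LinearMap.mulLeft ℂ (K n)) a := by
  rw [hSlice_apply, Bialgebra.comul_mul, comul_K, lid_rTensor_tmul_mul, hSlice_apply]

theorem hSlice_xi_mul (f : NicholsAlgebra n →ₗ[ℂ] ℂ) (i : Fin n) (a : NicholsAlgebra n) :
    hSlice f (xi i * a) = xi i * hSlice (f ∘ₗ LinearMap.mulLeft ℂ (K n)) a +
      hSlice (f ∘ₗ LinearMap.mulLeft ℂ (xi i)) a := by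
  rw [hSlice_apply, Bialgebra.comul_mul, comul_xi, add_mul, map_add, map_add,
    lid_rTensor_tmul_mul, lid_rTensor_tmul_mul, one_mul, hSlice_apply, hSlice_apply]

theorem hSlice_one (f : NicholsAlgebra n →ₗ[ℂ] ℂ) : hSlice f 1 = f 1 • 1 := by
  rw [hSlice_apply, Bialgebra.comul_one, Algebra.TensorProduct.one_def]; simp

theorem hSlice_counit : hSlice (counit (R := ℂ) (A := NicholsAlgebra n)) = LinearMap.id := by
  ext a
  rw [hSlice_apply, Coalgebra.rTensor_counit_comul]
  simp

theorem hSlice_smul (r : ℂ) (f : NicholsAlgebra n →ₗ[ℂ] ℂ) (a : NicholsAlgebra n) :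
    hSlice (r • f) a = r • hSlice f a := by
  rw [hSlice_apply, LinearMap.rTensor_smul]; simp [hSlice_apply]

/-- The twist `a ↦ ∑ sgn(a₍₁₎) a₍₂₎` of `𝒦ₙ`. -/
def sgnSlice (n : ℕ) : NicholsAlgebra n →ₗ[ℂ] NicholsAlgebra n := hSlice (signHom n).toLinearMap

theorem sgnSlice_K_mul (a : NicholsAlgebra n) :
    sgnSlice n (K n * a) = -(K n * sgnSlice n a) := by
  have h : (signHom n).toLinearMap ∘ₗ LinearMap.mulLeft ℂ (K n) =
      (-1 : ℂ) • (signHom n).toLinearMap := by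
    ext a; simp [signHom_K]
  rw [sgnSlice, hSlice_K_mul, h, hSlice_smul]; simp

theorem sgnSlice_xi_mul (i : Fin n) (a : NicholsAlgebra n) :
    sgnSlice n (xi i * a) = -(xi i * sgnSlice n a) := by
  have h : (signHom n).toLinearMap ∘ₗ LinearMap.mulLeft ℂ (K n) =
      (-1 : ℂ) • (signHom n).toLinearMap := by
    ext a; simp [signHom_K]
  have h' : (signHom n).toLinearMap ∘ₗ LinearMap.mulLeft ℂ (xi i) =
      (0 : ℂ) • (signHom n).toLinearMap := by
    ext a; simp [signHom_xi]
  rw [sgnSlice, hSlice_xi_mul, h, h', hSlice_smul, hSlice_smul]; simp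

theorem sgnSlice_one : sgnSlice n 1 = 1 := by
  rw [sgnSlice, hSlice_one]; simp

theorem xibarSlice_K_mul (i : Fin n) (a : NicholsAlgebra n) :
    hSlice (xibarLin i) (K n * a) = K n * hSlice (xibarLin i) a := by
  have h : xibarLin i ∘ₗ LinearMap.mulLeft ℂ (K n) = xibarLin i := by
    ext a; simp [xibarLin_mul, counit_K, xibarLin_K]
  rw [hSlice_K_mul, h]

theorem xibarSlice_xi_mul (i j : Fin n) (a : NicholsAlgebra n) :
    hSlice (xibarLin i) (xi j * a) = xi j * hSlice (xibarLin i) a +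
      if i = j then sgnSlice n a else 0 := by
  have h : xibarLin i ∘ₗ LinearMap.mulLeft ℂ (K n) = xibarLin i := by
    ext a; simp [xibarLin_mul, counit_K, xibarLin_K]
  have h' : xibarLin i ∘ₗ LinearMap.mulLeft ℂ (xi j) =
      (if i = j then 1 else 0 : ℂ) • (signHom n).toLinearMap := by
    ext a
    simp only [LinearMap.comp_apply, LinearMap.mulLeft_apply, xibarLin_mul, counit_xi,
      xibarLin_xi, zero_mul, zero_add, LinearMap.smul_apply, AlgHom.toLinearMap_apply,
      smul_eq_mul, eq_comm]
  rw [hSlice_xi_mul, h, h', hSlice_smul, sgnSlice]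
  split_ifs <;> simp

theorem xibarSlice_one (i : Fin n) : hSlice (xibarLin i) 1 = 0 := by
  rw [hSlice_one, xibarLin_one, zero_smul]

theorem translate_xi_K (i : Fin n) (φ : DualNichols n) :
    translate (xi i) (translate (K n) φ) = -translate (K n) (translate (xi i) φ) := by
  rw [← translate_mul, ← translate_mul, K_mul_xi, translate_neg, neg_neg]

theorem translate_xi_xi (i j : Fin n) (φ : DualNichols n) :
    translate (xi i) (translate (xi j) φ) = -translate (xi j) (translate (xi i) φ) := by
  rw [← translate_mul, ← translate_mul, xi_mul_xi, translate_neg]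

end

section

variable {n : ℕ}

/-- The operator `K ⇀ - ⊗ sgn` on the double, which anticommutes with left multiplication by the
generators. -/
def sgOp (n : ℕ) : Dbl n →ₗ[ℂ] Dbl n := opElt (translate (K n)) (sgnSlice n)

/-- The skew derivation of the double along `ξᵢ`. -/
def dOp (i : Fin n) : Dbl n →ₗ[ℂ] Dbl n := opElt LinearMap.id (hSlice (xibarLin i))

/-- The skew derivation of the double along `ξ̄ᵢ`. -/
def eOp (i : Fin n) : Dbl n →ₗ[ℂ] Dbl n :=
  opElt (translate (K n) ∘ₗ translate (xi i)) (sgnSlice n)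

theorem sgOp_elt (φ : DualNichols n) (a : NicholsAlgebra n) :
    sgOp n (elt φ a) = elt (translate (K n) φ) (sgnSlice n a) := rfl
theorem dOp_elt (i : Fin n) (φ : DualNichols n) (a : NicholsAlgebra n) :
    dOp i (elt φ a) = elt φ (hSlice (xibarLin i) a) := rfl
theorem eOp_elt (i : Fin n) (φ : DualNichols n) (a : NicholsAlgebra n) :
    eOp i (elt φ a) = elt (translate (K n) (translate (xi i) φ)) (sgnSlice n a) := rfl

theorem gK_mul_elt (φ : DualNichols n) (a : NicholsAlgebra n) :
    gK n * elt φ a = elt (translate (K n) (coTranslate (K n) φ)) (K n * a) := K_mul_elt a φ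
theorem gKb_mul_elt (φ : DualNichols n) (a : NicholsAlgebra n) :
    gKb n * elt φ a = elt (kbar n * φ) a := ofHd_mul_elt _ _ _
theorem gx_mul_elt (i : Fin n) (φ : DualNichols n) (a : NicholsAlgebra n) :
    gx i * elt φ a = elt (translate (K n) (coTranslate (xi i) φ)) (K n * a) +
      elt (translate (K n) φ) (xi i * a) + elt (translate (xi i) φ) a := xi_mul_elt i a φ
theorem gy_mul_elt (i : Fin n) (φ : DualNichols n) (a : NicholsAlgebra n) :
    gy i * elt φ a = elt (xibar i * φ) a := ofHd_mul_elt _ _ _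

/-- An identity between linear operators on the double can be checked on the elements `φ ⊗ h`. -/
theorem dbl_congr {V : Type*} [AddCommGroup V] [Module ℂ V] (f g : Dbl n →ₗ[ℂ] V)
    (h : ∀ φ a, f (elt φ a) = g (elt φ a)) (z : Dbl n) : f z = g z :=
  LinearMap.congr_fun (dbl_hom_ext h) z

theorem sgOp_gK (z : Dbl n) : sgOp n (gK n * z) = -(gK n * sgOp n z) := by
  refine dbl_congr (sgOp n ∘ₗ LinearMap.mulLeft ℂ (gK n))
    (-(LinearMap.mulLeft ℂ (gK n) ∘ₗ sgOp n)) (fun φ a => ?_) z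
  change sgOp n (gK n * elt φ a) = -(gK n * sgOp n (elt φ a))
  rw [gK_mul_elt, sgOp_elt, sgOp_elt, gK_mul_elt, sgnSlice_K_mul, map_neg, translate_coTranslate,
    translate_coTranslate]

theorem sgOp_gKb (z : Dbl n) : sgOp n (gKb n * z) = -(gKb n * sgOp n z) := by
  refine dbl_congr (sgOp n ∘ₗ LinearMap.mulLeft ℂ (gKb n))
    (-(LinearMap.mulLeft ℂ (gKb n) ∘ₗ sgOp n)) (fun φ a => ?_) z
  change sgOp n (gKb n * elt φ a) = -(gKb n * sgOp n (elt φ a))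
  rw [gKb_mul_elt, sgOp_elt, sgOp_elt, gKb_mul_elt, translate_K_mul, translate_K_kbar, neg_mul,
    elt_neg]

theorem sgOp_gx (i : Fin n) (z : Dbl n) : sgOp n (gx i * z) = -(gx i * sgOp n z) := by
  refine dbl_congr (sgOp n ∘ₗ LinearMap.mulLeft ℂ (gx i))
    (-(LinearMap.mulLeft ℂ (gx i) ∘ₗ sgOp n)) (fun φ a => ?_) z
  change sgOp n (gx i * elt φ a) = -(gx i * sgOp n (elt φ a))
  rw [gx_mul_elt, map_add, map_add, sgOp_elt, sgOp_elt, sgOp_elt, sgOp_elt, gx_mul_elt]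
  simp only [translate_coTranslate, translate_xi_K, sgnSlice_K_mul, sgnSlice_xi_mul, map_neg,
    elt_neg]
  abel

theorem sgOp_gy (i : Fin n) (z : Dbl n) : sgOp n (gy i * z) = -(gy i * sgOp n z) := by
  refine dbl_congr (sgOp n ∘ₗ LinearMap.mulLeft ℂ (gy i))
    (-(LinearMap.mulLeft ℂ (gy i) ∘ₗ sgOp n)) (fun φ a => ?_) z
  change sgOp n (gy i * elt φ a) = -(gy i * sgOp n (elt φ a))
  rw [gy_mul_elt, sgOp_elt, sgOp_elt, gy_mul_elt, translate_K_mul, translate_K_xibar, neg_mul,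
    elt_neg]

theorem dOp_gK (i : Fin n) (z : Dbl n) : dOp i (gK n * z) = gK n * dOp i z := by
  refine dbl_congr (dOp i ∘ₗ LinearMap.mulLeft ℂ (gK n))
    (LinearMap.mulLeft ℂ (gK n) ∘ₗ dOp i) (fun φ a => ?_) z
  change dOp i (gK n * elt φ a) = gK n * dOp i (elt φ a)
  rw [gK_mul_elt, dOp_elt, dOp_elt, gK_mul_elt, xibarSlice_K_mul]

theorem dOp_ofHd (i : Fin n) (ψ : DualNichols n) (z : Dbl n) :
    dOp i (ofHd n ψ * z) = ofHd n ψ * dOp i z := by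
  refine dbl_congr (dOp i ∘ₗ LinearMap.mulLeft ℂ (ofHd n ψ))
    (LinearMap.mulLeft ℂ (ofHd n ψ) ∘ₗ dOp i) (fun φ a => ?_) z
  change dOp i (ofHd n ψ * elt φ a) = ofHd n ψ * dOp i (elt φ a)
  rw [ofHd_mul_elt, dOp_elt, dOp_elt, ofHd_mul_elt]

theorem dOp_gx (i j : Fin n) (z : Dbl n) :
    dOp i (gx j * z) = gx j * dOp i z + if i = j then sgOp n z else 0 := by
  refine dbl_congr (dOp i ∘ₗ LinearMap.mulLeft ℂ (gx j))
    (LinearMap.mulLeft ℂ (gx j) ∘ₗ dOp i + if i = j then sgOp n else 0)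
    (fun φ a => ?_) z |>.trans ?_
  · change dOp i (gx j * elt φ a) = gx j * dOp i (elt φ a) +
      (if i = j then sgOp n else 0 : Dbl n →ₗ[ℂ] Dbl n) (elt φ a)
    rw [gx_mul_elt, map_add, map_add, dOp_elt, dOp_elt, dOp_elt, dOp_elt, gx_mul_elt,
      xibarSlice_K_mul, xibarSlice_xi_mul]
    split_ifs
    · rw [sgOp_elt, map_add]
      abel
    · rw [LinearMap.zero_apply, add_zero, add_zero]
  · split_ifs <;> rfl

theorem eOp_gK (i : Fin n) (z : Dbl n) : eOp i (gK n * z) = gK n * eOp i z := by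
  refine dbl_congr (eOp i ∘ₗ LinearMap.mulLeft ℂ (gK n))
    (LinearMap.mulLeft ℂ (gK n) ∘ₗ eOp i) (fun φ a => ?_) z
  change eOp i (gK n * elt φ a) = gK n * eOp i (elt φ a)
  rw [gK_mul_elt, eOp_elt, eOp_elt, gK_mul_elt]
  simp only [translate_coTranslate, translate_xi_K, sgnSlice_K_mul, map_neg, elt_neg, neg_neg]

theorem eOp_gKb (i : Fin n) (z : Dbl n) : eOp i (gKb n * z) = gKb n * eOp i z := by
  refine dbl_congr (eOp i ∘ₗ LinearMap.mulLeft ℂ (gKb n))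
    (LinearMap.mulLeft ℂ (gKb n) ∘ₗ eOp i) (fun φ a => ?_) z
  change eOp i (gKb n * elt φ a) = gKb n * eOp i (elt φ a)
  rw [gKb_mul_elt, eOp_elt, eOp_elt, gKb_mul_elt, translate_xi_mul, translate_K_kbar,
    translate_xi_kbar, zero_mul, add_zero, translate_K_mul, map_neg, translate_K_kbar, neg_neg]

theorem eOp_gx (i j : Fin n) (z : Dbl n) : eOp i (gx j * z) = gx j * eOp i z := by
  refine dbl_congr (eOp i ∘ₗ LinearMap.mulLeft ℂ (gx j))
    (LinearMap.mulLeft ℂ (gx j) ∘ₗ eOp i) (fun φ a => ?_) z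
  change eOp i (gx j * elt φ a) = gx j * eOp i (elt φ a)
  rw [gx_mul_elt, map_add, map_add, eOp_elt, eOp_elt, eOp_elt, eOp_elt, gx_mul_elt,
    translate_xi_xi i j]
  simp only [translate_coTranslate, translate_xi_K, sgnSlice_K_mul, sgnSlice_xi_mul, map_neg,
    elt_neg, neg_neg]

theorem eOp_gy (i j : Fin n) (z : Dbl n) :
    eOp i (gy j * z) = gy j * eOp i z + if i = j then sgOp n z else 0 := by
  refine dbl_congr (eOp i ∘ₗ LinearMap.mulLeft ℂ (gy j))
    (LinearMap.mulLeft ℂ (gy j) ∘ₗ eOp i + if i = j then sgOp n else 0)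
    (fun φ a => ?_) z |>.trans ?_
  · change eOp i (gy j * elt φ a) = gy j * eOp i (elt φ a) +
      (if i = j then sgOp n else 0 : Dbl n →ₗ[ℂ] Dbl n) (elt φ a)
    rw [gy_mul_elt, eOp_elt, eOp_elt, gy_mul_elt, translate_xi_mul, translate_K_xibar,
      translate_xi_xibar, map_add, translate_K_mul, map_neg, translate_K_xibar, neg_neg]
    split_ifs
    · rw [sgOp_elt, one_mul, elt_add]
    · rw [zero_mul, map_zero, add_zero, LinearMap.zero_apply, add_zero]
  · split_ifs <;> rfl

theorem one_eq_elt : (1 : Dbl n) = elt 1 1 := by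
  rw [← map_one (ofH n), ofH_eq_elt]

/-! ### Cointegrals of the double -/

/-- The functional `φ ⊗ h ↦ φ(y) f(h)` on the double. -/
def evalOp (y : NicholsAlgebra n) (f : NicholsAlgebra n →ₗ[ℂ] ℂ) : Dbl n →ₗ[ℂ] ℂ :=
  DrinfeldDouble.liftLinear (LinearMap.mk₂ ℂ
    (fun (φ : DualAlg ℂ (NicholsAlgebra n)) a => φ y * f a)
    (fun _ _ _ => add_mul _ _ _) (fun _ _ _ => mul_assoc _ _ _)
    (fun _ _ _ => by rw [map_add, mul_add])
    (fun _ _ _ => by rw [map_smul, smul_eq_mul, smul_eq_mul, mul_left_comm]))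

theorem evalOp_elt (y : NicholsAlgebra n) (f : NicholsAlgebra n →ₗ[ℂ] ℂ) (φ : DualNichols n)
    (a : NicholsAlgebra n) : evalOp y f (elt φ a) = φ.eval y * f a := rfl

theorem evalOp_slice (l : Dbl n →ₗ[ℂ] ℂ) (y : NicholsAlgebra n)
    (f : NicholsAlgebra n →ₗ[ℂ] ℂ) (s : DualNichols n ⊗[ℂ] DualNichols n)
    (t : NicholsAlgebra n ⊗[ℂ] NicholsAlgebra n) :
    evalOp y f (TensorProduct.rid ℂ (Dbl n) (l.lTensor (Dbl n) (dualTwo n s * hopfTwo n t))) =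
      l (elt (slice n s y) (TensorProduct.lid ℂ _ (f.rTensor _ t))) := by
  induction s with
  | zero =>
    rw [map_zero, map_zero, zero_mul, LinearMap.zero_apply, map_zero, map_zero, map_zero,
      elt_eq, map_zero, zero_mul, map_zero]
  | add s s' hs hs' =>
    rw [map_add, map_add, add_mul, LinearMap.add_apply, map_add, map_add, map_add, hs, hs',
      elt_add, map_add]
  | tmul φ ψ =>
    induction t with
    | zero => simp
    | add t t' ht ht' =>
      simp only [map_add, mul_add] at ht ht' ⊢
      rw [ht, ht']
    | tmul a b =>
      rw [dualTwo_tmul, hopfTwo_tmul, Algebra.TensorProduct.tmul_mul_tmul, ← elt_eq, ← elt_eq,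
        LinearMap.lTensor_tmul, TensorProduct.rid_tmul, map_smul, evalOp_elt, slice_tmul,
        LinearMap.rTensor_tmul, TensorProduct.lid_tmul, elt_smul, map_smul, map_smul, map_smul]
      simp only [smul_eq_mul]
      ring

/-- The invariance of a left cointegral, evaluated at a point of the first leg. -/
theorem cointegral_elt {l : Dbl n →ₗ[ℂ] ℂ} (hl : IsCointegral l) (y : NicholsAlgebra n)
    (f : NicholsAlgebra n →ₗ[ℂ] ℂ) (φ : DualNichols n) (a : NicholsAlgebra n) :
    l (elt (translate y φ) (hSlice f a)) = counit (R := ℂ) y * f 1 * l (elt φ a) := by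
  have h1 := congrArg (evalOp y f) (hl.comul_eq (elt φ a))
  rw [comulD_elt, map_smul, one_eq_elt, evalOp_elt, dual_one_apply] at h1
  have h2 := (evalOp_slice l y f (coD n φ) (comul a)).symm.trans h1
  rw [slice_coD] at h2
  rw [hSlice_apply, h2, smul_eq_mul]
  ring

theorem cointegral_sgOp {l : Dbl n →ₗ[ℂ] ℂ} (hl : IsCointegral l) (z : Dbl n) :
    l (sgOp n z) = l z := by
  refine dbl_congr (l ∘ₗ sgOp n) l (fun φ a => ?_) z
  refine (cointegral_elt hl (K n) (signHom n).toLinearMap φ a).trans ?_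
  rw [counit_K]; simp

theorem cointegral_dOp {l : Dbl n →ₗ[ℂ] ℂ} (hl : IsCointegral l) (i : Fin n) (z : Dbl n) :
    l (dOp i z) = 0 := by
  refine dbl_congr (l ∘ₗ dOp i) 0 (fun φ a => ?_) z
  change l (elt φ (hSlice (xibarLin i) a)) = 0
  rw [← translate_one_apply φ, cointegral_elt hl, xibarLin_one, mul_zero, zero_mul]

theorem cointegral_eOp {l : Dbl n →ₗ[ℂ] ℂ} (hl : IsCointegral l) (i : Fin n) (z : Dbl n) :
    l (eOp i z) = 0 := by
  refine dbl_congr (l ∘ₗ eOp i) 0 (fun φ a => ?_) z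
  change l (elt (translate (K n) (translate (xi i) φ)) (sgnSlice n a)) = 0
  have h := cointegral_elt hl (xi i) counit φ a
  rw [counit_xi, zero_mul, zero_mul, hSlice_counit] at h
  rw [← h, ← translate_mul, sgnSlice, cointegral_elt hl, Bialgebra.counit_mul, counit_xi,
    mul_zero, zero_mul, zero_mul]
  exact h.symm

/-- A left cointegral of the double satisfies the abstract relations: the operators are the actions
of functionals on the first leg of the coproduct. -/
theorem cointegralRel {l : Dbl n →ₗ[ℂ] ℂ} (hl : IsCointegral l) :
    CointegralRel (gK n) (gc n) (gx (n := n)) gy l (sgOp n) dOp eOp where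
  l_sg := cointegral_sgOp hl
  l_d := cointegral_dOp hl
  l_e := cointegral_eOp hl
  sg_one := by rw [one_eq_elt, sgOp_elt, translate_K_one, sgnSlice_one]
  d_one i := by rw [one_eq_elt, dOp_elt, xibarSlice_one, map_zero]
  e_one i := by
    rw [one_eq_elt, eOp_elt, translate_xi_one, map_zero, elt_eq, map_zero, zero_mul]
  sg_K := sgOp_gK
  sg_c z := by rw [gc, mul_assoc, sgOp_gKb, sgOp_gK, mul_neg, neg_neg, mul_assoc]
  sg_x := sgOp_gx
  sg_y := sgOp_gy
  d_K i := dOp_gK i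
  d_c i := mul_mem (s := leftCommutant (dOp i)) (fun z => dOp_ofHd i _ z) (fun z => dOp_gK i z)
  d_y i j := fun z => dOp_ofHd i _ z
  d_x i j hij := fun z => by rw [dOp_gx, if_neg hij, add_zero]
  d_x_self i z := by rw [dOp_gx, if_pos rfl]
  e_K i := eOp_gK i
  e_c i := mul_mem (s := leftCommutant (eOp i)) (fun z => eOp_gKb i z) (fun z => eOp_gK i z)
  e_x i j := eOp_gx i j
  e_y i j hij := fun z => by rw [eOp_gy, if_neg hij, add_zero]
  e_y_self i z := by rw [eOp_gy, if_pos rfl]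

theorem x_comm_sign {R : Type*} [Ring R] {a p q : R} {m : ℕ} (hp : a * p = -(p * a))
    (hq : a * q = (-1) ^ m * (q * a)) : a * (p * q) = (-1) ^ (m + 1) * (p * q * a) := by
  rw [← mul_assoc, hp, neg_mul, mul_assoc, hq, pow_succ]
  simp only [← mul_assoc]
  rw [← ((Commute.neg_one_left p).pow_left m).eq]
  simp

/-- The element `∏ᵢ yᵢ xᵢ` is of the form `φ ⊗ h`, with `φ` of the parity of its length. -/
theorem prodYX_eq_elt {l : List (Fin n)} (hl : l.Nodup) : ∃ φ : DualNichols n,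
    ∃ a : NicholsAlgebra n, prodYX gx gy l = ofHd n φ * ofH n a ∧
      translate (K n) φ = (-1) ^ l.length * φ ∧
      ∀ i ∉ l, gx i * ofHd n φ = (-1) ^ l.length * (ofHd n φ * gx i) := by
  induction l with
  | nil => exact ⟨1, 1, by simp [prodYX], by simp, by simp⟩
  | cons j l ih =>
    rw [List.nodup_cons] at hl
    obtain ⟨φ, a, h1, h2, h3⟩ := ih hl.2
    refine ⟨xibar j * φ, (-1) ^ l.length * (xi j * a), ?_, ?_, ?_⟩
    · rw [prodYX_cons, h1, mul_assoc, ← mul_assoc (gx j), h3 j hl.1, map_mul, map_mul, map_mul,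
        map_pow, map_neg, map_one]
      rw [← gx, ← gy]
      have hs : ∀ z : Dbl n, z * (-1) ^ l.length = (-1) ^ l.length * z := fun z =>
        ((Commute.neg_one_left z).pow_left _).eq.symm
      simp only [← mul_assoc]
      rw [hs, hs]
      simp only [mul_assoc]
    · rw [translate_K_mul, translate_K_xibar, h2, List.length_cons, pow_succ]
      simp only [← mul_assoc]
      rw [neg_mul, ← ((Commute.neg_one_left (xibar j)).pow_left l.length).eq]
      simp
    · intro i hi
      have hij : i ≠ j := by rintro rfl; simp at hi
      have hil : i ∉ l := by intro hit; simp [hit] at hi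
      rw [map_mul, ← gy, List.length_cons]
      exact x_comm_sign ((doubleRel n).x_y i j hij) (h3 i hil)

/-- A cointegral vanishes on `∏ᵢ yᵢ xᵢ · c` for even `n`. -/
theorem cointegral_prodYX_mul_c {l : Dbl n →ₗ[ℂ] ℂ} (hl : IsCointegral l) (hn : Even n) :
    l (prodYX gx gy (List.finRange n) * gc n) = 0 := by
  obtain ⟨φ, a, h1, h2, -⟩ := prodYX_eq_elt (List.nodup_finRange n)
  rw [List.length_finRange, hn.neg_one_pow, one_mul] at h2
  have h3 : prodYX gx gy (List.finRange n) * gc n = elt (kbar n * φ) (a * K n) := by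
    rw [← gc_comm, gc, mul_assoc, (doubleRel n).K_comm_prodYX, h1, elt_eq, map_mul, map_mul]
    simp only [mul_assoc]
    rfl
  have h4 := cointegral_elt hl (K n) counit (kbar n * φ) (a * K n)
  rw [translate_K_mul, h2, translate_K_kbar, hSlice_counit, neg_mul, elt_neg, map_neg, counit_K,
    Bialgebra.counit_one, one_mul, one_mul, LinearMap.id_apply] at h4
  rw [h3]
  exact self_eq_neg.mp h4.symm

end

section

/-! ### Integrals of the double -/

section integral

variable {A : Type*} [Ring A] [Algebra ℂ A] {n : ℕ} {K c : A} {x y : Fin n → A} {l : A →ₗ[ℂ] ℂ}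
  {sg : A →ₗ[ℂ] A} {d e : Fin n → A →ₗ[ℂ] A}

theorem DoubleRel.odd_comm_prodXY (h : DoubleRel K c x y) {i : Fin n} {s : List (Fin n)}
    (hi : i ∉ s) : x i * prodXY x y s = prodXY x y s * x i ∧
      y i * prodXY x y s = prodXY x y s * y i := by
  have hne : ∀ j ∈ s, i ≠ j := by rintro j hj rfl; exact hi hj
  exact ⟨comm_listProd fun j hj => odd_comm_odd_mul_odd (h.x_x i j) (h.x_y i j (hne j hj)),
    comm_listProd fun j hj => odd_comm_odd_mul_odd (h.y_x (hne j hj)) (h.y_y i j)⟩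

/-- An element annihilated by all odd generators is divisible by all products `xᵢ yᵢ`. -/
theorem CointegralRel.exists_eq_prodXY_mul (h : CointegralRel K c x y l sg d e)
    (hD : DoubleRel K c x y) (hsg : ∀ z, sg (sg z) = z) {z : A} (hx : ∀ i, x i * z = 0)
    (hy : ∀ i, y i * z = 0) {s : List (Fin n)} (hs : s.Nodup) :
    ∃ w, z = prodXY x y s * w := by
  have hzx : ∀ i, z = x i * sg (d i z) := fun i => by
    have h1 := h.d_x_self i z
    rw [hx, map_zero, eq_comm, add_eq_zero_iff_eq_neg'] at h1
    have h2 := congrArg sg h1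
    rwa [hsg, map_neg, h.sg_x, neg_neg] at h2
  have hzy : ∀ i, z = y i * sg (e i z) := fun i => by
    have h1 := h.e_y_self i z
    rw [hy, map_zero, eq_comm, add_eq_zero_iff_eq_neg'] at h1
    have h2 := congrArg sg h1
    rwa [hsg, map_neg, h.sg_y, neg_neg] at h2
  induction s with
  | nil => exact ⟨z, by simp [prodXY]⟩
  | cons i s ih =>
    rw [List.nodup_cons] at hs
    obtain ⟨w, hw⟩ := ih hs.2
    have hsgP : prodXY x y s ∈ leftCommutant sg := Subalgebra.list_prod_mem _ fun u hu => by
      obtain ⟨j, -, rfl⟩ := List.mem_map.mp hu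
      intro v
      rw [mul_assoc, h.sg_x, h.sg_y, mul_neg, neg_neg, mul_assoc]
    have hne : ∀ j ∈ s, i ≠ j := by rintro j hj rfl; exact hs.1 hj
    have hd : prodXY x y s ∈ leftCommutant (d i) := Subalgebra.list_prod_mem _ fun u hu => by
      obtain ⟨j, hj, rfl⟩ := List.mem_map.mp hu
      exact mul_mem (h.d_x i j (hne j hj)) (h.d_y i j)
    have he : prodXY x y s ∈ leftCommutant (e i) := Subalgebra.list_prod_mem _ fun u hu => by
      obtain ⟨j, hj, rfl⟩ := List.mem_map.mp hu
      exact mul_mem (h.e_x i j) (h.e_y i j (hne j hj))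
    have hcomm := hD.odd_comm_prodXY hs.1
    have h1 : z = prodXY x y s * (y i * sg (e i w)) := by
      conv_lhs => rw [hzy i, hw, he, hsgP, ← mul_assoc, hcomm.2, mul_assoc]
    refine ⟨-sg (d i (sg (e i w))), ?_⟩
    conv_lhs => rw [hzx i, h1, hd, hsgP, h.d_y i i, h.sg_y]
    rw [prodXY_cons, ← mul_assoc, hcomm.1, mul_assoc (x i), hcomm.2]
    simp only [mul_neg, ← mul_assoc]
    rw [hcomm.1]

/-- The elements `xⱼ yⱼ xⱼ` and `xⱼ yⱼ yⱼ` vanish on the part `c = 1`. -/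
theorem DoubleRel.prodXY_mul_odd (h : DoubleRel K c x y) {j : Fin n} {s : List (Fin n)}
    (hs : s.Nodup) (hj : j ∈ s) :
    (1 + c) * (prodXY x y s * x j) = 0 ∧ (1 + c) * (prodXY x y s * y j) = 0 := by
  induction s with
  | nil => simp at hj
  | cons i s ih =>
    rw [List.nodup_cons] at hs
    by_cases hij : j = i
    · subst hij
      have h1 : (1 + c) * (x j * y j * x j) = 0 := by
        simp only [mul_assoc, add_mul, one_mul, (h.pair j).rules, mul_sub, mul_add, mul_neg,
          neg_mul, sub_mul, neg_zero, mul_zero]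
        abel
      have hcomm := h.odd_comm_prodXY hs.1
      rw [prodXY_cons, mul_assoc _ _ (x j), mul_assoc _ _ (y j), ← hcomm.1, ← hcomm.2]
      constructor
      · rw [← mul_assoc (x j * y j), ← mul_assoc, h1, zero_mul]
      · rw [mul_assoc (x j), ← mul_assoc (y j), h.y_sq, zero_mul, mul_zero, mul_zero]
    · have hj' : j ∈ s := by simpa [hij] using hj
      obtain ⟨h1, h2⟩ := ih hs.2 hj'
      constructor
      · rw [prodXY_cons, mul_assoc _ _ (x j), ← mul_assoc, h.one_add_c_comm, mul_assoc, h1,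
          mul_zero]
      · rw [prodXY_cons, mul_assoc _ _ (y j), ← mul_assoc, h.one_add_c_comm, mul_assoc, h2,
          mul_zero]

/-- Right multiplication by odd letters annihilates `(1 + c) ∏ᵢ xᵢ yᵢ`, so this element generates a
right ideal of dimension at most two. -/
theorem DoubleRel.prodXY_mul_mem (h : DoubleRel K c x y) (s : List (Fin n)) {m : A}
    (hm : m ∈ normalForms K c x y s) :
    (1 + c) * prodXY x y (List.finRange n) * m ∈
      Submodule.span ℂ {(1 + c) * prodXY x y (List.finRange n),
        (1 + c) * prodXY x y (List.finRange n) * K} := by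
  set Q := (1 + c) * prodXY x y (List.finRange n) with hQ
  have hQc : Q * c = Q := by
    rw [← h.c_comm, hQ, ← mul_assoc, mul_add, mul_one, h.c_sq, add_comm]
  have hQx : ∀ j, Q * x j = 0 ∧ Q * y j = 0 := fun j => by
    rw [hQ, mul_assoc, mul_assoc]
    exact h.prodXY_mul_odd (List.nodup_finRange n) (List.mem_finRange j)
  suffices normalForms K c x y s ≤
      (Submodule.span ℂ {Q, Q * K}).comap (LinearMap.mulLeft ℂ Q) from this hm
  clear hm m
  induction s with
  | nil =>
    apply normalForms_nil_le <;> simp only [Submodule.mem_comap, LinearMap.mulLeft_apply,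
      mul_one, ← mul_assoc, hQc] <;> exact Submodule.subset_span (by simp)
  | cons i s ih =>
    refine normalForms_cons_le fun m hm => ?_
    refine ⟨ih hm, ?_, ?_, ?_⟩ <;>
      simp only [Submodule.mem_comap, LinearMap.mulLeft_apply, ← mul_assoc, hQx, zero_mul] <;>
      exact Submodule.zero_mem _

/-- An element on which all generators act by the counit is a multiple of
`(1 + c) ∏ᵢ xᵢ yᵢ (1 + K)`. -/
theorem CointegralRel.integral_eq (h : CointegralRel K c x y l sg d e)
    (hD : DoubleRel K c x y) (hsg : ∀ z, sg (sg z) = z)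
    (htop : normalForms K c x y (List.finRange n) = ⊤) {z : A} (hx : ∀ i, x i * z = 0)
    (hy : ∀ i, y i * z = 0) (hK : K * z = z) (hc : c * z = z) :
    ∃ r : ℂ, z = r • (prodXY x y (List.finRange n) * ((1 + c) * (1 + K))) := by
  obtain ⟨w, hw⟩ := h.exists_eq_prodXY_mul hD hsg hx hy (List.nodup_finRange n)
  have h1 := hD.prodXY_mul_mem (List.finRange n) (m := w) (by rw [htop]; trivial)
  set P := prodXY x y (List.finRange n) with hP
  have hKP : K * P = P * K := comm_listProd fun i _ => odd_comm_odd_mul_odd (hD.K_x i) (hD.K_y i)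
  rw [mul_assoc (1 + c) P w, ← hw, add_mul 1 c z, one_mul, hc] at h1
  obtain ⟨a, b, hab⟩ := Submodule.mem_span_pair.mp h1
  have h2 : z = (1 / 2 : ℂ) • (z + z) := by module
  have h3 : z = (1 / 2 : ℂ) • (z + K * z) := by rw [hK]; exact h2
  have hKc : K * ((1 + c) * P) = P * ((1 + c) * K) := by
    rw [← mul_assoc, ← hD.one_add_c_comm, mul_assoc, hKP, ← mul_assoc, hD.one_add_c_comm,
      mul_assoc]
  have hcP : (1 + c) * P = P * (1 + c) := hD.one_add_c_comm P
  have hKcK : K * ((1 + c) * P * K) = P * (1 + c) := by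
    rw [← mul_assoc, hKc, mul_assoc P, mul_assoc (1 + c), hD.K_sq, mul_one]
  refine ⟨(a + b) / 4, ?_⟩
  rw [h3, h2, ← hab, mul_smul_comm, mul_add, mul_smul_comm, mul_smul_comm, hKc, hKcK, hcP]
  simp only [mul_add, add_mul, mul_one, one_mul, mul_assoc]
  module

end integral

variable {n : ℕ}

theorem sgOp_sgOp (z : Dbl n) : sgOp n (sgOp n z) = z := by
  refine mem_of_mul_left_mem (adjoin_dblGens (n := n))
    (LinearMap.eqLocus (sgOp n ∘ₗ sgOp n) LinearMap.id) ?_ ?_ z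
  · change sgOp n (sgOp n 1) = 1
    rw [one_eq_elt, sgOp_elt, translate_K_one, sgnSlice_one, sgOp_elt, translate_K_one,
      sgnSlice_one]
  · intro g hg z hz
    change sgOp n (sgOp n z) = z at hz
    change sgOp n (sgOp n (g * z)) = g * z
    rcases hg with rfl | rfl | ⟨i, rfl⟩ | ⟨i, rfl⟩
    · rw [sgOp_gK, map_neg, sgOp_gK, hz, neg_neg]
    · rw [sgOp_gKb, map_neg, sgOp_gKb, hz, neg_neg]
    · rw [sgOp_gx, map_neg, sgOp_gx, hz, neg_neg]
    · rw [sgOp_gy, map_neg, sgOp_gy, hz, neg_neg]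

theorem integral_eq {l : Dbl n →ₗ[ℂ] ℂ} (hl : IsCointegral l) {Λ : Dbl n}
    (hΛ : IsIntegral Λ) : ∃ r : ℂ, r ≠ 0 ∧
      Λ = r • (prodXY gx gy (List.finRange n) * ((1 + gc n) * (1 + gK n))) := by
  obtain ⟨r, hr⟩ := (cointegralRel hl).integral_eq (doubleRel n) sgOp_sgOp (normalForms_dbl n)
    (fun i => by rw [hΛ.mul_eq, counitD_gx, zero_smul])
    (fun i => by rw [hΛ.mul_eq, counitD_gy, zero_smul])
    (by rw [hΛ.mul_eq, counitD_gK, one_smul])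
    (by rw [hΛ.mul_eq, gc, counitD_mul, counitD_gK, counitD_gKb, mul_one, one_smul])
  exact ⟨r, fun h0 => hΛ.ne_zero (by rw [hr, h0, zero_smul]), hr⟩

/-! ### The Higman ideal -/

/-- The action `a ⊗ b ↦ (z ↦ S(b) z a)`. -/
def adj (n : ℕ) : Dbl n ⊗[ℂ] Dbl n →ₗ[ℂ] Dbl n →ₗ[ℂ] Dbl n :=
  TensorProduct.lift (LinearMap.mk₂ ℂ
      (fun a b : Dbl n => LinearMap.mulLeft ℂ (antipodeD b) ∘ₗ LinearMap.mulRight ℂ a)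
      (fun _ _ _ => by ext; simp [mul_add])
      (fun _ _ _ => by ext; simp)
      (fun _ _ _ => by ext; simp [add_mul])
      (fun _ _ _ => by ext; simp))

theorem adj_tmul (a b z : Dbl n) : adj n (a ⊗ₜ b) z = antipodeD b * (z * a) := rfl

theorem higmanTrace_apply (Λ : Dbl n) (G : (Dbl n)ˣ) (z : Dbl n) :
    higmanTrace Λ G z = adj n (comulD Λ) z * (↑G⁻¹ : Dbl n) := rfl

theorem adj_mul (s t : Dbl n ⊗[ℂ] Dbl n) (z : Dbl n) :
    adj n (s * t) z = adj n t (adj n s z) := by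
  induction s with
  | zero => simp
  | add s s' hs hs' => simp only [add_mul, map_add, LinearMap.add_apply, hs, hs']
  | tmul a b =>
    induction t with
    | zero => simp
    | add s s' hs hs' => simp only [mul_add, map_add, LinearMap.add_apply, hs, hs']
    | tmul a' b' =>
      rw [Algebra.TensorProduct.tmul_mul_tmul, adj_tmul, adj_tmul, adj_tmul, antipodeD_mul]
      simp only [mul_assoc]

theorem adj_comulD_mul (a b z : Dbl n) :
    adj n (comulD (a * b)) z = adj n (comulD b) (adj n (comulD a) z) := by
  rw [comulD_mul, adj_mul]

theorem adj_comulD_one (z : Dbl n) : adj n (comulD 1) z = z := by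
  rw [comulD_one, Algebra.TensorProduct.one_def, adj_tmul, antipodeD_one, one_mul, mul_one]

theorem adj_comulD_gK (z : Dbl n) : adj n (comulD (gK n)) z = gK n * (z * gK n) := by
  rw [comulD_gK, adj_tmul, antipodeD_gK]

theorem comulD_gc : comulD (gc n) = gc n ⊗ₜ gc n := by
  rw [gc, comulD_mul, comulD_gK, comulD_gKb, Algebra.TensorProduct.tmul_mul_tmul]

theorem antipodeD_gc : antipodeD (gc n) = gc n := by
  rw [gc, antipodeD_mul, antipodeD_gK, antipodeD_gKb, gK_mul_gKb]

theorem adj_comulD_gc (z : Dbl n) : adj n (comulD (gc n)) z = z := by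
  rw [comulD_gc, adj_tmul, antipodeD_gc, ← gc_comm, ← mul_assoc, (doubleRel n).c_sq, one_mul]

theorem adj_comulD_gx (i : Fin n) (z : Dbl n) :
    adj n (comulD (gx i)) (z * gK n) = twistedComm (gK n) (gx i) z * gK n := by
  rw [comulD_gx, map_add, LinearMap.add_apply, adj_tmul, adj_tmul, antipodeD_gx, antipodeD_one,
    twistedComm_apply, one_mul, sub_mul, gK_mul_gx, neg_neg]
  simp only [mul_assoc, gK_mul_gK, gK_mul_gx, mul_one, mul_neg]
  abel

theorem adj_comulD_gy (i : Fin n) (z : Dbl n) :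
    adj n (comulD (gy i)) (z * gK n) = twistedComm (gK n) (gy i) z * gK n := by
  rw [comulD_gy, map_add, LinearMap.add_apply, adj_tmul, adj_tmul, antipodeD_gy, antipodeD_one,
    twistedComm_apply, one_mul, sub_mul, gKb_mul_gy, neg_neg, ← gc_mul_gK]
  have h1 : gy i * (gc n * gK n) * (z * gK n * (gc n * gK n)) = gy i * (gK n * z) := by
    have h2 : z * gK n * (gc n * gK n) = gc n * z := by
      rw [← mul_assoc, ← gc_comm, mul_assoc, mul_assoc z, gK_mul_gK, mul_one]
    rw [h2, mul_assoc, mul_assoc (gc n), ← mul_assoc (gK n), ← gc_comm (gK n),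
      mul_assoc (gc n) (gK n), ← mul_assoc (gc n) (gc n), (doubleRel n).c_sq, one_mul]
  rw [h1]
  simp only [mul_assoc, gK_mul_gK, gK_mul_gy, mul_one, mul_neg]
  abel

theorem prodXY_cons_comm {i : Fin n} {s : List (Fin n)} (hi : i ∉ s) :
    prodXY (gx (n := n)) gy (i :: s) = prodXY gx gy s * (gx i * gy i) := by
  have h := (doubleRel n).odd_comm_prodXY hi
  rw [prodXY_cons, mul_assoc, h.2, ← mul_assoc, h.1, mul_assoc]

/-- Up to the twist by `K`, the adjoint action of `∏ᵢ xᵢ yᵢ` is an iterated twisted commutator. -/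
theorem adj_comulD_prodXY {s : List (Fin n)} (hs : s.Nodup) (z : Dbl n) :
    adj n (comulD (prodXY gx gy s)) (z * gK n) = listComm (gK n) gx gy s z * gK n := by
  induction s with
  | nil =>
    change adj n (comulD 1) (z * gK n) = z * gK n
    rw [adj_comulD_one]
  | cons i s ih =>
    rw [List.nodup_cons] at hs
    rw [prodXY_cons_comm hs.1, adj_comulD_mul, ih hs.2, adj_comulD_mul, adj_comulD_gx,
      adj_comulD_gy, listComm_cons, pairComm_apply]

/-- `S²` is the conjugation by `K`. -/
theorem antipodeD_antipodeD (z : Dbl n) : antipodeD (antipodeD z) = gK n * z * gK n := by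
  refine mem_of_mul_left_mem (adjoin_dblGens (n := n))
    (LinearMap.eqLocus (antipodeD ∘ₗ antipodeD)
      (LinearMap.mulRight ℂ (gK n) ∘ₗ LinearMap.mulLeft ℂ (gK n))) ?_ ?_ z
  · change antipodeD (antipodeD 1) = gK n * 1 * gK n
    rw [antipodeD_one, antipodeD_one, mul_one, gK_mul_gK]
  · intro g hg z hz
    change antipodeD (antipodeD z) = gK n * z * gK n at hz
    change antipodeD (antipodeD (g * z)) = gK n * (g * z) * gK n
    rw [antipodeD_mul, antipodeD_mul, hz]
    have key : ∀ s : Dbl n, antipodeD (antipodeD g) = s → s * gK n = gK n * g →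
        antipodeD (antipodeD g) * (gK n * z * gK n) = gK n * (g * z) * gK n := by
      rintro s rfl h
      rw [mul_assoc (gK n), ← mul_assoc, h]
      simp only [mul_assoc]
    rcases hg with rfl | rfl | ⟨i, rfl⟩ | ⟨i, rfl⟩
    · exact key _ (by rw [antipodeD_gK, antipodeD_gK]) rfl
    · exact key _ (by rw [antipodeD_gKb, antipodeD_gKb]) gK_mul_gKb.symm
    · refine key (-gx i) ?_ (by rw [gK_mul_gx, neg_mul])
      rw [antipodeD_gx, map_neg, antipodeD_mul, antipodeD_gK, antipodeD_gx, gK_mul_gx, neg_mul,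
        neg_neg, neg_mul, mul_assoc, gK_mul_gK, mul_one]
    · refine key (-gy i) ?_ (by rw [gK_mul_gy, neg_mul])
      rw [antipodeD_gy, map_neg, antipodeD_mul, antipodeD_gKb, antipodeD_gy, gKb_mul_gy, neg_mul,
        neg_neg, neg_mul, mul_assoc, gKb_mul_gKb, mul_one]

/-- Two elements that implement `S²` differ by a central factor. -/
theorem gK_mul_inv_comm {G : (Dbl n)ˣ} (hG : ImplementsAntipodeSq G) (z : Dbl n) :
    gK n * (↑G⁻¹ : Dbl n) * z = z * (gK n * (↑G⁻¹ : Dbl n)) := by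
  have h1 := (antipodeD_antipodeD (gK n * z * gK n)).symm.trans (hG _)
  have h2 : gK n * (gK n * z * gK n) * gK n = z := by
    simp only [mul_assoc, gK_mul_gK, mul_one]
    rw [← mul_assoc, gK_mul_gK, one_mul]
  rw [h2] at h1
  have h3 : (↑G⁻¹ : Dbl n) * z = gK n * z * gK n * (↑G⁻¹ : Dbl n) := by
    conv_lhs => rw [h1]
    simp only [← mul_assoc, Units.inv_mul, one_mul]
  rw [mul_assoc, h3]
  simp only [← mul_assoc, gK_mul_gK, one_mul]

theorem finRange_ne_nil (hn : 0 < n) : List.finRange n ≠ [] := by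
  intro h0
  have := congrArg List.length h0
  rw [List.length_finRange, List.length_nil] at this
  omega

/-- The Higman ideal is spanned by `1 - c`, `ω` and `c ω`, where `ω = K ∏ᵢ wᵢ`. -/
theorem higman_eq {l : Dbl n →ₗ[ℂ] ℂ} (hl : IsCointegral l) (hn : 0 < n) {Λ : Dbl n}
    (hΛ : IsIntegral Λ) {G : (Dbl n)ˣ} (hG : ImplementsAntipodeSq G) :
    Higman Λ G = higmanSpan (gK n) (gc n) gx gy (List.finRange n) := by
  obtain ⟨r, hr0, hr⟩ := integral_eq hl hΛ
  rw [← (doubleRel n).range_averagedComm (List.nodup_finRange n) (finRange_ne_nil hn)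
    (normalForms_dbl n)]
  have htrace : ∀ z, higmanTrace Λ G (z * gK n) = averagedComm (gK n) gx gy (List.finRange n)
      ((2 * r) • (gK n * (↑G⁻¹ : Dbl n) * z)) := by
    intro z
    rw [map_smul, averagedComm_central_mul gK_mul_gK (gK_mul_inv_comm hG), higmanTrace_apply, hr,
      map_smul, map_smul, LinearMap.smul_apply, adj_comulD_mul,
      adj_comulD_prodXY (List.nodup_finRange n), adj_comulD_mul, map_add, map_add, map_add,
      map_add, LinearMap.add_apply, LinearMap.add_apply, adj_comulD_one, adj_comulD_gc,
      adj_comulD_one, adj_comulD_gK, gK_mul_inv_comm hG, averagedComm_apply]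
    simp only [mul_assoc, add_mul, mul_add, gK_mul_gK, mul_one, smul_add, smul_mul_assoc]
    rw [← mul_assoc (gK n) (gK n), gK_mul_gK, one_mul]
    module
  have hK : ∀ z : Dbl n, z * gK n * gK n = z := fun z => by rw [mul_assoc, gK_mul_gK, mul_one]
  apply le_antisymm
  · rintro _ ⟨z, rfl⟩
    rw [← hK z, htrace]
    exact ⟨_, rfl⟩
  · rintro _ ⟨z, rfl⟩
    refine ⟨(2 * r)⁻¹ • ((G : Dbl n) * gK n * z) * gK n, ?_⟩
    rw [htrace]
    congr 1
    rw [mul_smul_comm, smul_smul, mul_inv_cancel₀ (mul_ne_zero two_ne_zero hr0), one_smul]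
    simp only [← mul_assoc]
    rw [mul_assoc (gK n), Units.inv_mul, mul_one, gK_mul_gK, one_mul]

end

section

/-! ### Central elements of the Higman ideal -/

section central

variable {A : Type*} [Ring A] [Algebra ℂ A] {n : ℕ} {K c : A} {x y : Fin n → A}

/-- A letter of one of the pairs anticommutes with the product `W` of the `wᵢ`: it anticommutes with
its own `wᵢ` and commutes with the others. -/
theorem DoubleRel.odd_anticomm_prodW (h : DoubleRel K c x y) {i : Fin n} {s : List (Fin n)}
    (hs : s.Nodup) (hi : i ∈ s) : x i * prodW x y s = -(prodW x y s * x i) ∧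
      y i * prodW x y s = -(prodW x y s * y i) := by
  induction s with
  | nil => simp at hi
  | cons j s ih =>
    rw [List.nodup_cons] at hs
    by_cases hij : i = j
    · subst hij
      have h1 : x i * pairW x y i = -(pairW x y i * x i) := by
        simp only [pairW, mul_sub, sub_mul, mul_assoc, (h.pair i).rules, mul_add, add_mul, mul_neg,
          neg_mul, mul_zero, neg_zero, mul_one, one_mul]
        abel
      have h2 : y i * pairW x y i = -(pairW x y i * y i) := by
        simp only [pairW, mul_sub, sub_mul, mul_assoc, (h.pair i).rules, mul_add, add_mul, mul_neg,
          neg_mul, mul_zero, neg_zero, mul_one, one_mul]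
        abel
      rw [prodW_cons]
      constructor
      · rw [← mul_assoc, h1, neg_mul, mul_assoc, h.x_comm_prodW hs.1, mul_assoc]
      · rw [← mul_assoc, h2, neg_mul, mul_assoc, h.y_comm_prodW hs.1, mul_assoc]
    · have hi' : i ∈ s := by simpa [hij] using hi
      obtain ⟨h1, h2⟩ := ih hs.2 hi'
      rw [prodW_cons]
      constructor
      · rw [← mul_assoc, h.x_comm_pairW hij, mul_assoc, h1, mul_neg, mul_assoc]
      · rw [← mul_assoc, h.y_comm_pairW hij, mul_assoc, h2, mul_neg, mul_assoc]

/-- The element `ω = K ∏ᵢ wᵢ` commutes with the generators. -/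
theorem DoubleRel.generators_comm_omega (h : DoubleRel K c x y) :
    (K * (K * prodW x y (List.finRange n)) = K * prodW x y (List.finRange n) * K) ∧ ∀ i : Fin n,
      x i * (K * prodW x y (List.finRange n)) = K * prodW x y (List.finRange n) * x i ∧
      y i * (K * prodW x y (List.finRange n)) = K * prodW x y (List.finRange n) * y i := by
  refine ⟨by rw [mul_assoc, h.K_comm_prodW], fun i => ?_⟩
  obtain ⟨h1, h2⟩ := h.odd_anticomm_prodW (List.nodup_finRange n) (List.mem_finRange i)
  constructor
  · rw [← mul_assoc, ← neg_eq_iff_eq_neg.mpr (h.K_x i), neg_mul, mul_assoc, h1, mul_neg, neg_neg,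
      mul_assoc]
  · rw [← mul_assoc, ← neg_eq_iff_eq_neg.mpr (h.K_y i), neg_mul, mul_assoc, h2, mul_neg, neg_neg,
      mul_assoc]

theorem DoubleRel.odd_mul_prodW_one_add (h : DoubleRel K c x y) (i : Fin n) :
    x i * (prodW x y (List.finRange n) * (1 + c)) = 0 ∧
      y i * (prodW x y (List.finRange n) * (1 + c)) = 0 := by
  obtain ⟨h1, h2⟩ := h.odd_anticomm_prodW (List.nodup_finRange n) (List.mem_finRange i)
  obtain ⟨h3, h4⟩ := h.prodXY_mul_odd (List.nodup_finRange n) (List.mem_finRange i)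
  have key : ∀ z : A, (1 + c) * (prodXY x y (List.finRange n) * z) = 0 →
      prodW x y (List.finRange n) * z * (1 + c) = 0 := by
    intro z hz
    rw [mul_assoc, ← h.one_add_c_comm, ← mul_assoc, (h.prodW_mul_one_add _).1, smul_mul_assoc,
      ← h.one_add_c_comm, mul_assoc, hz, smul_zero]
  rw [← mul_assoc, ← mul_assoc, h1, h2, neg_mul, neg_mul, key _ h3, key _ h4, neg_zero]
  exact ⟨rfl, rfl⟩

theorem DoubleRel.one_add_mul_one_sub (h : DoubleRel K c x y) : (1 + c) * (1 - c) = 0 := by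
  rw [mul_sub, mul_one, add_mul, one_mul, h.c_sq]
  abel

theorem DoubleRel.one_add_c_mul_self (h : DoubleRel K c x y) :
    (1 + c) * (1 + c) = (2 : ℂ) • (1 + c) := by
  rw [mul_add, mul_one, add_mul, one_mul, h.c_sq]
  module

/-- The part of the Higman ideal on which `c = 1`, and the part on which `c = -1`. -/
theorem DoubleRel.higmanSpan_parts (h : DoubleRel K c x y) {s : List (Fin n)} {z : A}
    (hz : z ∈ higmanSpan K c x y s) :
    (∃ r : ℂ, z * (1 + c) = r • (K * prodW x y s * (1 + c))) ∧
      ∃ a b : ℂ, z * (1 - c) = a • (1 - c) + b • (K * prodW x y s * (1 - c)) := by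
  have e1 : c * (1 + c) = 1 + c := by rw [mul_add, mul_one, h.c_sq, add_comm]
  have e2 : c * (1 - c) = -(1 - c) := by rw [mul_sub, mul_one, h.c_sq]; abel
  have e3 : (1 - c) * (1 + c) = 0 := by rw [← h.one_add_c_comm, h.one_add_mul_one_sub]
  induction hz using Submodule.span_induction with
  | mem z hz =>
    rcases hz with rfl | rfl | rfl
    · exact ⟨⟨0, by rw [e3, zero_smul]⟩, 2, 0, by rw [h.one_sub_c_mul_self]; simp⟩
    · exact ⟨⟨1, by rw [one_smul]⟩, 0, 1, by simp⟩
    · refine ⟨⟨1, ?_⟩, 0, -1, ?_⟩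
      · rw [one_smul, h.c_comm, mul_assoc, e1]
      · rw [h.c_comm, mul_assoc, e2, mul_neg, neg_one_smul, zero_smul, zero_add]
  | zero => exact ⟨⟨0, by simp⟩, 0, 0, by simp⟩
  | add z w _ _ hz hw =>
    obtain ⟨⟨r, hr⟩, a, b, hab⟩ := hz
    obtain ⟨⟨r', hr'⟩, a', b', hab'⟩ := hw
    refine ⟨⟨r + r', by rw [add_mul, hr, hr']; module⟩, a + a', b + b', ?_⟩
    rw [add_mul, hab, hab']
    module
  | smul t z _ hz =>
    obtain ⟨⟨r, hr⟩, a, b, hab⟩ := hz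
    refine ⟨⟨t * r, by rw [smul_mul_assoc, hr]; module⟩, t * a, t * b, ?_⟩
    rw [smul_mul_assoc, hab]
    module

end central

variable {n : ℕ}

/-- The central element `ω = K ∏ᵢ wᵢ` of the double. -/
def om (n : ℕ) : Dbl n := gK n * prodW gx gy (List.finRange n)

theorem om_comm (a : Dbl n) : om n * a = a * om n := by
  have h : Algebra.adjoin ℂ (dblGens n) ≤ Subalgebra.centralizer ℂ {om n} := by
    have hg := (doubleRel n).generators_comm_omega
    rw [Algebra.adjoin_le_iff]
    intro g hg'
    rw [SetLike.mem_coe, Subalgebra.mem_centralizer_iff]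
    rintro _ rfl
    rcases hg' with rfl | rfl | ⟨i, rfl⟩ | ⟨i, rfl⟩
    · exact hg.1.symm
    · rw [← gc_mul_gK, ← mul_assoc, ← gc_comm (om n), mul_assoc (gc n) (om n), om, ← hg.1]
      simp only [mul_assoc]
    · exact (hg.2 i).1.symm
    · exact (hg.2 i).2.symm
  rw [adjoin_dblGens] at h
  exact (Subalgebra.mem_centralizer_iff ℂ).mp (h (Algebra.mem_top (x := a))) _ rfl

/-- The Higman ideal is stable under multiplication by central elements. -/
theorem central_mul_mem (hn : 0 < n) {v : Dbl n} (hv : ∀ z, v * z = z * v) {z : Dbl n}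
    (hz : z ∈ higmanSpan (gK n) (gc n) gx gy (List.finRange n)) :
    v * z ∈ higmanSpan (gK n) (gc n) gx gy (List.finRange n) := by
  rw [← (doubleRel n).range_averagedComm (List.nodup_finRange n) (finRange_ne_nil hn)
    (normalForms_dbl n)] at hz ⊢
  obtain ⟨p, rfl⟩ := hz
  exact ⟨v * p, averagedComm_central_mul gK_mul_gK hv _ _⟩

theorem one_sub_gc_mem : 1 - gc n ∈ higmanSpan (gK n) (gc n) gx gy (List.finRange n) :=
  Submodule.subset_span (by simp)

theorem om_mul_mem : om n * (1 - gc n) ∈ higmanSpan (gK n) (gc n) gx gy (List.finRange n) ∧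
    om n * (1 + gc n) ∈ higmanSpan (gK n) (gc n) gx gy (List.finRange n) := by
  rw [← (doubleRel n).one_sub_c_comm, ← (doubleRel n).one_add_c_comm, sub_mul, add_mul, one_mul]
  have h1 : om n ∈ higmanSpan (gK n) (gc n) gx gy (List.finRange n) :=
    Submodule.subset_span (by simp [om])
  have h2 : gc n * om n ∈ higmanSpan (gK n) (gc n) gx gy (List.finRange n) :=
    Submodule.subset_span (by simp [om])
  exact ⟨Submodule.sub_mem _ h1 h2, Submodule.add_mem _ h1 h2⟩

/-! ### Values of a cointegral -/

theorem cointegral_prodYX_ne_zero {l : Dbl n →ₗ[ℂ] ℂ} (hl : IsCointegral l) (hn : Even n) :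
    l (prodYX gx gy (List.finRange n)) ≠ 0 :=
  (cointegralRel hl).apply_prodYX_ne_zero (normalForms_dbl n) hl.ne_zero
    (cointegral_prodYX_mul_c hl hn)

theorem cointegral_prodYX_mul {l : Dbl n →ₗ[ℂ] ℂ} (hl : IsCointegral l) (hn : Even n) :
    l (prodYX gx gy (List.finRange n) * (1 - gc n)) = l (prodYX gx gy (List.finRange n)) ∧
      l (prodYX gx gy (List.finRange n) * (1 + gc n)) = l (prodYX gx gy (List.finRange n)) := by
  rw [mul_sub, mul_add, mul_one, map_sub, map_add, cointegral_prodYX_mul_c hl hn, sub_zero,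
    add_zero]
  exact ⟨rfl, rfl⟩

theorem one_sub_gc_ne_zero {l : Dbl n →ₗ[ℂ] ℂ} (hl : IsCointegral l) (hn : Even n) :
    1 - gc n ≠ 0 := by
  intro h0
  apply cointegral_prodYX_ne_zero hl hn
  rw [← (cointegral_prodYX_mul hl hn).1, h0, mul_zero, map_zero]

/-- The element `ω (1 + c)(1 - K)` of the socle of the double, on which `K` acts by `-1`. -/
def oddSocle (n : ℕ) : Dbl n := om n * (1 + gc n) * (1 - gK n)

theorem cointegral_oddSocle_ne_zero {l : Dbl n →ₗ[ℂ] ℂ} (hl : IsCointegral l) (hn : Even n) :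
    l (oddSocle n) ≠ 0 := by
  have h1 : oddSocle n = om n * (1 + gc n) - gK n * om n * (1 + gc n) := by
    rw [oddSocle, mul_sub, mul_one, mul_assoc (om n) _ (gK n), (doubleRel n).one_add_c_comm,
      ← mul_assoc, om_comm (gK n)]
  have h2 := ((doubleRel n).prodW_mul_one_add (List.finRange n)).2
  have h3 : gK n * om n = prodW gx gy (List.finRange n) := by
    rw [om, ← mul_assoc, gK_mul_gK, one_mul]
  rw [h1, h3, om, mul_assoc, h2, mul_smul_comm, ← mul_assoc, (doubleRel n).K_comm_prodYX,
    mul_assoc, map_sub, map_smul, map_smul,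
    (cointegralRel hl).apply_prodYX_mul_K _ (cointegralRel hl).one_sub_c_mem_sg.2, smul_zero,
    zero_sub, (cointegral_prodYX_mul hl hn).2, smul_eq_mul]
  exact neg_ne_zero.mpr (mul_ne_zero (pow_ne_zero _ (by norm_num))
    (cointegral_prodYX_ne_zero hl hn))

/-! ### The ribbon element on the Higman ideal -/

theorem om_mul_one_add_mul_one_add :
    om n * (1 + gc n) * (1 + gc n) = (2 : ℂ) • (om n * (1 + gc n)) := by
  rw [mul_assoc, (doubleRel n).one_add_c_mul_self, mul_smul_comm]

/-- The ribbon element acts as the identity on the part `c = 1` of the Higman ideal. -/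
theorem ribbon_mul_om_one_add {l : Dbl n →ₗ[ℂ] ℂ} (hl : IsCointegral l) (hn : 0 < n)
    {Λ v : Dbl n} (hΛ : IsIntegral Λ) (hv : IsRibbon v) :
    v * (om n * (1 + gc n)) = om n * (1 + gc n) := by
  obtain ⟨r, hr⟩ := ((doubleRel n).higmanSpan_parts
    (central_mul_mem hn hv.central om_mul_mem.2)).1
  obtain ⟨s, hs0, hs⟩ := integral_eq hl hΛ
  have h1 : v * (om n * (1 + gc n)) = (r / 2) • (om n * (1 + gc n)) := by
    rw [← om, mul_assoc, om_mul_one_add_mul_one_add, mul_smul_comm] at hr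
    rw [div_eq_inv_mul, mul_smul, ← hr, smul_smul]
    norm_num
  -- the integral is a multiple of `ω (1 + c) (1 + K)`
  have h2 : om n * (1 + gc n) * (1 + gK n) = (2 ^ n / s : ℂ) • Λ := by
    have h3 : om n * (1 + gc n) * (1 + gK n) =
        prodW gx gy (List.finRange n) * (1 + gc n) * (1 + gK n) := by
      have : gK n * (1 + gK n) = 1 + gK n := by rw [mul_add, mul_one, gK_mul_gK, add_comm]
      rw [om, (doubleRel n).K_comm_prodW, mul_assoc, mul_assoc, ← mul_assoc (gK n),
        ← (doubleRel n).one_add_c_comm, mul_assoc (1 + gc n), this, ← mul_assoc]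
    rw [h3, ((doubleRel n).prodW_mul_one_add _).1, List.length_finRange, hs, smul_smul,
      div_mul_cancel₀ _ hs0, smul_mul_assoc, mul_assoc]
  have h3 : v * Λ = Λ := by rw [hΛ.mul_eq, hv.counit_eq, one_smul]
  have h4 : (r / 2 - 1) • Λ = 0 := by
    have h5 := congrArg (v * ·) h2
    beta_reduce at h5
    rw [← mul_assoc, h1, mul_smul_comm, h3, smul_mul_assoc, h2, smul_smul] at h5
    have h6 : (2 ^ n / s : ℂ) ≠ 0 := div_ne_zero (pow_ne_zero _ two_ne_zero) hs0
    have h7 : (2 ^ n / s : ℂ) • ((r / 2 - 1) • Λ) = 0 := by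
      rw [smul_smul, mul_sub, sub_smul, mul_one, mul_comm, h5, sub_self]
    exact (smul_eq_zero.mp h7).resolve_left h6
  have h5 : r / 2 - 1 = 0 := (smul_eq_zero.mp h4).resolve_right hΛ.ne_zero
  rw [h1, sub_eq_zero.mp h5, one_smul]

end

section

/-! ### The ribbon element on the part `c = -1` -/

section socle

variable {A : Type*} [Ring A] [Algebra ℂ A] {n : ℕ} {K c X : A} {x y : Fin n → A}

theorem rGroup_mul_rGroupFlip_tmul (hK : K * K = 1) (hKc : K * c = c * K) (hKX : K * X = -X)
    (hcX : c * X = X) (p : A) :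
    rGroup K c * rGroupFlip K c * (p ⊗ₜ X) = (c * p) ⊗ₜ X := by
  have h1 : ∀ q : A, rGroup K c * (q ⊗ₜ X) = (K * q) ⊗ₜ X := by
    intro q
    simp only [rGroup, smul_mul_assoc, add_mul, sub_mul, Algebra.TensorProduct.tmul_mul_tmul,
      one_mul, mul_assoc, hKX, mul_neg, hcX, tmul_neg]
    module
  have h2 : rGroupFlip K c * (p ⊗ₜ X) = (c * (K * p)) ⊗ₜ X := by
    simp only [rGroupFlip, smul_mul_assoc, add_mul, sub_mul, Algebra.TensorProduct.tmul_mul_tmul,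
      one_mul, mul_assoc, hKX, tmul_neg]
    module
  rw [mul_assoc, h2, h1, ← mul_assoc, hKc, mul_assoc, ← mul_assoc K, hK, one_mul]

theorem prodF_mul_tmul (hx : ∀ i, x i * X = 0) (hy : ∀ i, y i * X = 0) (hcX : c * X = X) (q : A)
    (s : List (Fin n)) : prodF K c x y s * (q ⊗ₜ X) = q ⊗ₜ X := by
  induction s with
  | nil => simp [prodF]
  | cons i s ih =>
    have h1 : prodF K c x y (i :: s) = rFactor K c (x i) (y i) * prodF K c x y s := by
      simp [prodF]
    rw [h1, mul_assoc, ih]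
    simp only [rFactor, add_mul, sub_mul, Algebra.TensorProduct.tmul_mul_tmul, one_mul, mul_assoc,
      hx, hy, hcX, mul_zero, tmul_zero, sub_zero, add_zero]

end socle

variable {n : ℕ}

/-- The odd generators annihilate the element `ω (1 + c)(1 - K)`, and the ribbon element fixes
it. -/
theorem mul_oddSocle {l : Dbl n →ₗ[ℂ] ℂ} (hl : IsCointegral l) (hn : 0 < n)
    {Λ v : Dbl n} (hΛ : IsIntegral Λ) (hv : IsRibbon v) :
    (gK n * oddSocle n = -oddSocle n ∧ gc n * oddSocle n = oddSocle n ∧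
      v * oddSocle n = oddSocle n) ∧
      ∀ i, gx i * oddSocle n = 0 ∧ gy i * oddSocle n = 0 := by
  have h := doubleRel n
  refine ⟨⟨?_, ?_, ?_⟩, fun i => ?_⟩
  · have h1 : gK n * (1 - gK n) = -(1 - gK n) := by
      rw [mul_sub, mul_one, gK_mul_gK, neg_sub]
    rw [oddSocle, ← mul_assoc, ← mul_assoc, ← om_comm, mul_assoc (om n), ← h.one_add_c_comm,
      mul_assoc, mul_assoc, h1, mul_neg, mul_neg, ← mul_assoc]
  · have h1 : gc n * (1 + gc n) = 1 + gc n := by rw [mul_add, mul_one, h.c_sq, add_comm]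
    rw [oddSocle, ← mul_assoc, ← mul_assoc, gc_comm (om n), mul_assoc (om n), h1]
  · rw [oddSocle, ← mul_assoc, ribbon_mul_om_one_add hl hn hΛ hv]
  · obtain ⟨h1, h2⟩ := h.odd_mul_prodW_one_add i
    constructor
    · rw [oddSocle, om, ← mul_assoc, mul_assoc (gK n), ← mul_assoc,
        ← neg_eq_iff_eq_neg.mpr (h.K_x i), neg_mul, mul_assoc (gK n), h1, mul_zero, neg_zero,
        zero_mul]
    · rw [oddSocle, om, ← mul_assoc, mul_assoc (gK n), ← mul_assoc,
        ← neg_eq_iff_eq_neg.mpr (h.K_y i), neg_mul, mul_assoc (gK n), h2, mul_zero, neg_zero,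
        zero_mul]

/-- Coproducts of elements of the Higman ideal, multiplied by `1 ⊗ X` for an element `X` of the
socle on which `K` acts by `-1`. -/
theorem comulD_mul_one_tmul {X : Dbl n} (hK : gK n * X = -X) (hc : gc n * X = X)
    (hxy : ∀ i, gx i * X = 0 ∧ gy i * X = 0) :
    comulD (1 - gc n) * (1 ⊗ₜ X) = (1 - gc n) ⊗ₜ X ∧
      comulD (om n * (1 - gc n)) * (1 ⊗ₜ X) = -((om n * (1 - gc n)) ⊗ₜ X) := by
  have hx : ∀ i (p : Dbl n), comulD (gx i) * (p ⊗ₜ X) = (gx i * p) ⊗ₜ X := by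
    intro i p
    rw [comulD_gx, add_mul, Algebra.TensorProduct.tmul_mul_tmul,
      Algebra.TensorProduct.tmul_mul_tmul, (hxy i).1, tmul_zero, zero_add, one_mul]
  have hy : ∀ i (p : Dbl n), comulD (gy i) * (p ⊗ₜ X) = (gy i * p) ⊗ₜ X := by
    intro i p
    rw [comulD_gy, add_mul, Algebra.TensorProduct.tmul_mul_tmul,
      Algebra.TensorProduct.tmul_mul_tmul, (hxy i).2, tmul_zero, add_zero, one_mul]
  have hW : ∀ (s : List (Fin n)) (p : Dbl n),
      comulD (prodW gx gy s) * (p ⊗ₜ X) = (prodW gx gy s * p) ⊗ₜ X := by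
    intro s p
    induction s with
    | nil =>
      have : prodW (gx (n := n)) gy [] = 1 := by simp [prodW]
      rw [this, comulD_one, one_mul, one_mul]
    | cons i s ih =>
      rw [prodW_cons, comulD_mul, mul_assoc, ih, pairW, map_sub, comulD_mul, comulD_mul, sub_mul,
        mul_assoc, mul_assoc, hy, hx, hx, hy, ← sub_tmul, sub_mul, sub_mul]
      simp only [mul_assoc]
  have h1 : comulD (1 - gc n) * (1 ⊗ₜ X) = (1 - gc n) ⊗ₜ X := by
    rw [map_sub, comulD_one, comulD_gc, sub_mul, one_mul, Algebra.TensorProduct.tmul_mul_tmul, hc,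
      mul_one, sub_tmul]
  refine ⟨h1, ?_⟩
  rw [comulD_mul, mul_assoc, h1, om, comulD_mul, mul_assoc, hW, comulD_gK,
    Algebra.TensorProduct.tmul_mul_tmul, hK, tmul_neg, ← mul_assoc]

/-- The ribbon element maps `1 - c` to a multiple of `ω (1 - c)`: a comparison of the two sides of
`Δ(v) = (R₂₁ R)⁻¹ (v ⊗ v)`, multiplied by `Δ(1 - c)(1 ⊗ X)` for the element `X` of the socle. -/
theorem ribbon_mul_one_sub {l : Dbl n →ₗ[ℂ] ℂ} (hl : IsCointegral l) (hn : 0 < n) (he : Even n)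
    {Λ v : Dbl n} (hΛ : IsIntegral Λ) (hv : IsRibbon v) :
    ∃ b : ℂ, v * (1 - gc n) = b • (om n * (1 - gc n)) := by
  have h := doubleRel n
  obtain ⟨a, b, hab⟩ := (h.higmanSpan_parts (central_mul_mem hn hv.central one_sub_gc_mem)).2
  obtain ⟨⟨hKX, hcX, hvX⟩, hX⟩ := mul_oddSocle hl hn hΛ hv
  obtain ⟨h1, h2⟩ := comulD_mul_one_tmul hKX hcX hX
  rw [← om, mul_assoc, h.one_sub_c_mul_self, mul_smul_comm] at hab
  have e2 : gc n * (1 - gc n) = -(1 - gc n) := by rw [mul_sub, mul_one, h.c_sq, neg_sub]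
  have h3 : v * (1 - gc n) = (a / 2) • (1 - gc n) + (b / 2) • (om n * (1 - gc n)) := by
    rw [div_eq_inv_mul, div_eq_inv_mul, mul_smul, mul_smul, ← smul_add, ← hab, smul_smul]
    norm_num
  have h4 : comulD (v * (1 - gc n)) * (1 ⊗ₜ oddSocle n) =
      -((v * (1 - gc n)) ⊗ₜ oddSocle n) := by
    rw [comulD_mul, mul_assoc, h1, hv.comul_eq, inverse_monodromy ⟨0, hn⟩, mul_assoc,
      Algebra.TensorProduct.tmul_mul_tmul, hvX, monodromyInv, mul_assoc,
      rGroup_mul_rGroupFlip_tmul h.K_sq (h.c_comm _).symm hKX hcX,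
      prodF_mul_tmul (fun i => (hX i).1) (fun i => (hX i).2) hcX, ← mul_assoc, gc_comm v,
      mul_assoc, e2, mul_neg, neg_tmul]
  rw [h3, map_add, map_smul, map_smul, add_mul, smul_mul_assoc, smul_mul_assoc, h1, h2] at h4
  have h5 : (a • (1 - gc n)) ⊗ₜ[ℂ] oddSocle n = 0 := by
    have h6 : (a • (1 - gc n)) ⊗ₜ[ℂ] oddSocle n =
        ((a / 2) • ((1 - gc n) ⊗ₜ[ℂ] oddSocle n) +
          (b / 2) • (-((om n * (1 - gc n)) ⊗ₜ[ℂ] oddSocle n))) +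
        (((a / 2) • (1 - gc n) + (b / 2) • (om n * (1 - gc n))) ⊗ₜ[ℂ] oddSocle n) := by
      rw [add_tmul, ← smul_tmul', ← smul_tmul', ← smul_tmul']
      module
    rw [h6, h4, neg_add_cancel]
  have h6 := congrArg (sliceRight l) h5
  rw [sliceRight_tmul, map_zero, smul_smul] at h6
  have h7 : a = 0 := by
    rcases mul_eq_zero.mp ((smul_eq_zero.mp h6).resolve_right (one_sub_gc_ne_zero hl he)) with h | h
    · exact absurd h (cointegral_oddSocle_ne_zero hl he)
    · exact h
  exact ⟨b / 2, by rw [h3, h7, zero_div, zero_smul, zero_add]⟩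

/-- On the part `c = -1`, each factor `F` of `(R₂₁ R)⁻¹` contributes `-1` to `∑ a S(b)`. -/
theorem mulS_rFactor_mul {t : Dbl n ⊗[ℂ] Dbl n} {r : ℂ}
    (ht : mulS n t * (1 - gc n) = r • (1 - gc n)) (i : Fin n) :
    mulS n (rFactor (gK n) (gc n) (gx i) (gy i) * t) * (1 - gc n) = (-r) • (1 - gc n) := by
  have h := (doubleRel n).pair i
  have key : ∀ a b : Dbl n, mulS n (a ⊗ₜ b * t) * (1 - gc n) =
      r • (a * antipodeD b * (1 - gc n)) := by
    intro a b
    rw [mulS_tmul_mul, mul_assoc _ (antipodeD b), ← (doubleRel n).one_sub_c_comm, ← mul_assoc,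
      mul_assoc a, ht, mul_smul_comm, smul_mul_assoc, mul_assoc a, mul_assoc a,
      (doubleRel n).one_sub_c_comm]
  rw [rFactor, add_mul, sub_mul, sub_mul, map_add, map_sub, map_sub, add_mul, sub_mul, sub_mul,
    key, key, key, key, neg_smul, ← smul_neg, ← smul_sub, ← smul_sub, ← smul_add]
  congr 1
  simp only [antipodeD_mul, antipodeD_one, antipodeD_gx, antipodeD_gy, antipodeD_gc, ← gc_mul_gK,
    mul_add, add_mul, mul_sub, sub_mul, mul_one, one_mul, mul_assoc, h.rules, mul_neg, neg_mul,
    neg_neg, mul_zero, neg_zero]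
  abel

theorem mulS_rGroup :
    mulS n (rGroup (gK n) (gc n) * rGroupFlip (gK n) (gc n)) * (1 - gc n) = 1 - gc n := by
  have h1 : gK n * gc n = gc n * gK n := (gc_comm _).symm
  have h2 : ∀ z : Dbl n, gK n * (gc n * z) = gc n * (gK n * z) := by
    intro z; rw [← mul_assoc, h1, mul_assoc]
  have h3 : ∀ z : Dbl n, gK n * (gK n * z) = z := by
    intro z; rw [← mul_assoc, gK_mul_gK, one_mul]
  have h4 : gc n * gc n = 1 := (doubleRel n).c_sq
  have h5 : ∀ z : Dbl n, gc n * (gc n * z) = z := by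
    intro z; rw [← mul_assoc, h4, one_mul]
  simp only [rGroup, rGroupFlip, smul_mul_assoc, mul_smul_comm, mul_add, add_mul, mul_sub, sub_mul,
    Algebra.TensorProduct.tmul_mul_tmul, mul_one, one_mul, mul_assoc, map_smul, map_add, map_sub,
    mulS_tmul, antipodeD_mul, antipodeD_one, antipodeD_gK, antipodeD_gc, h1, h2, h3, h4, h5,
    gK_mul_gK]
  module

/-- For even `n` the signs from the factors `F` cancel. -/
theorem mulS_monodromyInv (he : Even n) : mulS n (monodromyInv n) * (1 - gc n) = 1 - gc n := by
  have h : ∀ s : List (Fin n), mulS n (prodF (gK n) (gc n) (gx (n := n)) gy s *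
      (rGroup (gK n) (gc n) * rGroupFlip (gK n) (gc n))) * (1 - gc n) =
        ((-1) ^ s.length : ℂ) • (1 - gc n) := by
    intro s
    induction s with
    | nil =>
      have h1 : prodF (gK n) (gc n) (gx (n := n)) gy [] = 1 := by simp [prodF]
      rw [h1, one_mul, mulS_rGroup, List.length_nil, pow_zero, one_smul]
    | cons i s ih =>
      have h1 : prodF (gK n) (gc n) gx gy (i :: s) =
          rFactor (gK n) (gc n) (gx i) (gy i) * prodF (gK n) (gc n) gx gy s := by
        simp [prodF]
      rw [h1, mul_assoc, mulS_rFactor_mul ih, List.length_cons, pow_succ, mul_neg_one]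
  rw [monodromyInv, h, List.length_finRange, he.neg_one_pow, one_smul]

/-- The square of the ribbon element is the inverse of `∑ a S(b)` for `∑ a ⊗ b = (R₂₁ R)⁻¹`, so
it acts as the identity on the part `c = -1`. -/
theorem ribbon_mul_ribbon_mul_one_sub (hn : 0 < n) (he : Even n) {v : Dbl n} (hv : IsRibbon v) :
    v * (v * (1 - gc n)) = 1 - gc n := by
  have hvv : ∀ t : Dbl n ⊗[ℂ] Dbl n, t * (v ⊗ₜ v) = (v ⊗ₜ v) * t := by
    intro t
    induction t with
    | zero => simp
    | add s t hs ht => rw [mul_add, add_mul, hs, ht]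
    | tmul a b => exact tmul_comm_of_commute (hv.central a).symm (hv.central b).symm
  have h1 := mulS_comulD v
  rw [hv.comul_eq, inverse_monodromy ⟨0, hn⟩, hvv, mulS_tmul_mul, hv.antipode_eq, hv.counit_eq,
    one_smul] at h1
  calc v * (v * (1 - gc n)) = v * mulS n (monodromyInv n) * v * (1 - gc n) := by
        conv_lhs => rw [← mulS_monodromyInv he]
        rw [hv.central (mulS n _ * _)]
        simp only [mul_assoc]
        rw [hv.central (1 - gc n)]
    _ = 1 - gc n := by rw [h1, one_mul]

end

section

/-! ### The permutation representation of `SL(2,ℤ)` of level two -/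

section permutation

open Matrix MatrixGroups

/-- The nonzero vectors of the plane over `ZMod 2`. -/
def vecTwo : Fin 3 → Fin 2 → ZMod 2 := ![![0, 1], ![1, 1], ![1, 0]]

/-- The number of a nonzero vector of the plane over `ZMod 2`; the value at zero is irrelevant. -/
def idxTwo (w : Fin 2 → ZMod 2) : Fin 3 := if w 0 = 0 then 0 else if w 1 = 0 then 2 else 1

theorem idxTwo_vecTwo (i : Fin 3) : idxTwo (vecTwo i) = i := by revert i; decide

theorem vecTwo_idxTwo : ∀ w : Fin 2 → ZMod 2, w ≠ 0 → vecTwo (idxTwo w) = w := by decide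

theorem vecTwo_ne_zero : ∀ i, vecTwo i ≠ 0 := by decide

/-- The inclusion of `SL(2, ZMod 2)` in the monoid of matrices. -/
def matTwo : SL(2, ZMod 2) →* Matrix (Fin 2) (Fin 2) (ZMod 2) where
  toFun g := g.1
  map_one' := rfl
  map_mul' _ _ := rfl

theorem mulVec_vecTwo_ne_zero (g : SL(2, ZMod 2)) (i : Fin 3) : matTwo g *ᵥ vecTwo i ≠ 0 := by
  intro h
  apply vecTwo_ne_zero i
  rw [← one_mulVec (vecTwo i), ← map_one matTwo, ← inv_mul_cancel g, map_mul, ← mulVec_mulVec, h,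
    mulVec_zero]

/-- The action of `SL(2, ZMod 2)` on the three nonzero vectors of the plane. -/
def permTwo : SL(2, ZMod 2) →* Equiv.Perm (Fin 3) :=
  MonoidHom.toHomPerm
    { toFun := fun g i => idxTwo (matTwo g *ᵥ vecTwo i)
      map_one' := by
        funext i
        change idxTwo (matTwo 1 *ᵥ vecTwo i) = i
        rw [map_one, one_mulVec, idxTwo_vecTwo]
      map_mul' := by
        intro g h
        funext i
        change idxTwo (matTwo (g * h) *ᵥ vecTwo i) =
          idxTwo (matTwo g *ᵥ vecTwo (idxTwo (matTwo h *ᵥ vecTwo i)))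
        rw [vecTwo_idxTwo _ (mulVec_vecTwo_ne_zero h i), mulVec_mulVec, map_mul] }

theorem permTwo_apply (g : SL(2, ZMod 2)) (i : Fin 3) :
    permTwo g i = idxTwo (matTwo g *ᵥ vecTwo i) := rfl

/-- Reduction modulo two. -/
def modTwo : SL(2, ℤ) →* SL(2, ZMod 2) := SpecialLinearGroup.map (Int.castRingHom (ZMod 2))

theorem permTwo_S : permTwo (modTwo ModularGroup.S) = Equiv.swap 0 2 := by
  ext i
  rw [permTwo_apply]
  have : matTwo (modTwo ModularGroup.S) = !![0, -1; 1, 0] := by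
    ext i j
    fin_cases i <;> fin_cases j <;> rfl
  rw [this]
  revert i
  decide

theorem permTwo_T : permTwo (modTwo ModularGroup.T) = Equiv.swap 0 1 := by
  ext i
  rw [permTwo_apply]
  have : matTwo (modTwo ModularGroup.T) = !![1, 1; 0, 1] := by
    ext i j
    fin_cases i <;> fin_cases j <;> rfl
  rw [this]
  revert i
  decide

variable {V : Type*} [AddCommGroup V] [Module ℂ V]

/-- The linear representation in which permutations act on a basis. -/
def basisPerm {ι : Type*} (b : Module.Basis ι ℂ V) :
    Equiv.Perm ι →* LinearMap.GeneralLinearGroup ℂ V :=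
  (LinearMap.GeneralLinearGroup.generalLinearEquiv ℂ V).symm.toMonoidHom.comp
    { toFun := fun σ => b.equiv b σ
      map_one' := by
        apply LinearEquiv.toLinearMap_injective
        apply b.ext
        intro i
        simp
      map_mul' := by
        intro σ τ
        apply LinearEquiv.toLinearMap_injective
        apply b.ext
        intro i
        simp }

theorem basisPerm_apply {ι : Type*} (b : Module.Basis ι ℂ V) (σ : Equiv.Perm ι) (i : ι) :
    (basisPerm b σ : V →ₗ[ℂ] V) (b i) = b (σ i) := by
  change (b.equiv b σ) (b i) = _
  simp

/-- The representation of `SL(2,ℤ)` through the permutations of the nonzero vectors modulo two. -/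
def levelTwo (b : Module.Basis (Fin 3) ℂ V) : SL(2, ℤ) →* LinearMap.GeneralLinearGroup ℂ V :=
  (basisPerm b).comp (permTwo.comp modTwo)

theorem levelTwo_S (b : Module.Basis (Fin 3) ℂ V) (i : Fin 3) :
    (levelTwo b ModularGroup.S : V →ₗ[ℂ] V) (b i) = b (Equiv.swap 0 2 i) := by
  rw [← permTwo_S]
  exact basisPerm_apply b _ i

theorem levelTwo_T (b : Module.Basis (Fin 3) ℂ V) (i : Fin 3) :
    (levelTwo b ModularGroup.T : V →ₗ[ℂ] V) (b i) = b (Equiv.swap 0 1 i) := by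
  rw [← permTwo_T]
  exact basisPerm_apply b _ i

theorem Gamma_two_le_ker_levelTwo (b : Module.Basis (Fin 3) ℂ V) :
    CongruenceSubgroup.Gamma 2 ≤ (levelTwo b).ker := by
  intro g hg
  have h : modTwo g = 1 := hg
  rw [MonoidHom.mem_ker, levelTwo, MonoidHom.comp_apply, MonoidHom.comp_apply, h, map_one, map_one]

/-- A representation in which the generators of `SL(2,ℤ)` act as in `levelTwo` up to a scalar for
`S` agrees with `levelTwo`, because the relation `(S T)³ = S²` determines the scalar. -/
theorem eq_levelTwo (b : Module.Basis (Fin 3) ℂ V)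
    (ρ : SL(2, ℤ) →* LinearMap.GeneralLinearGroup ℂ V) {μ : ℂ} (hμ : μ ≠ 0)
    (hS : ∀ i, (ρ ModularGroup.S : V →ₗ[ℂ] V) (b i) = μ • b (Equiv.swap 0 2 i))
    (hT : ∀ i, (ρ ModularGroup.T : V →ₗ[ℂ] V) (b i) = b (Equiv.swap 0 1 i)) :
    ρ = levelTwo b := by
  have hrel : (ModularGroup.S * ModularGroup.T) ^ 3 = ModularGroup.S ^ 2 := by
    ext i j
    fin_cases i <;> fin_cases j <;> rfl
  have h0 := congrArg (fun g => (ρ g : V →ₗ[ℂ] V) (b 0)) hrel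
  have s02 : Equiv.swap (0 : Fin 3) 2 0 = 2 := by decide
  have s12 : Equiv.swap (0 : Fin 3) 2 1 = 1 := by decide
  have s22 : Equiv.swap (0 : Fin 3) 2 2 = 0 := by decide
  have t01 : Equiv.swap (0 : Fin 3) 1 0 = 1 := by decide
  have t11 : Equiv.swap (0 : Fin 3) 1 1 = 0 := by decide
  have t21 : Equiv.swap (0 : Fin 3) 1 2 = 2 := by decide
  simp only [pow_succ, pow_zero, one_mul, map_mul, Units.val_mul, Module.End.mul_apply, hT, hS,
    map_smul, s02, s12, s22, t01, t11, t21, smul_smul] at h0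
  have hμ1 : μ = 1 := by
    have h1 := smul_left_injective ℂ (b.ne_zero 0) h0
    have h2 : μ * μ * μ = μ * μ * 1 := by rw [mul_one, mul_assoc, h1]
    exact mul_left_cancel₀ (mul_ne_zero hμ hμ) h2
  have hle : Subgroup.closure {ModularGroup.S, ModularGroup.T} ≤ ρ.eqLocus (levelTwo b) := by
    rw [Subgroup.closure_le]
    rintro g (rfl | rfl)
    · refine Units.ext (b.ext fun i => ?_)
      rw [hS, levelTwo_S, hμ1, one_smul]
    · refine Units.ext (b.ext fun i => ?_)
      rw [hT, levelTwo_T]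
  rw [SpecialLinearGroup.SL2Z_generators] at hle
  ext1 g
  exact hle (Subgroup.mem_top g)

/-- Both kernels contain `Γ(2)`, and neither is everything, because `T` does not act as a scalar. -/
theorem isCongruenceOfLevel_levelTwo (b : Module.Basis (Fin 3) ℂ V) :
    IsCongruenceOfLevel (levelTwo b).ker 2 ∧
      IsCongruenceOfLevel ((QuotientGroup.mk' (Subgroup.center
        (LinearMap.GeneralLinearGroup ℂ V))).comp (levelTwo b)).ker 2 := by
  have hle : (levelTwo b).ker ≤ ((QuotientGroup.mk' (Subgroup.center
      (LinearMap.GeneralLinearGroup ℂ V))).comp (levelTwo b)).ker := by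
    intro g hg
    rw [MonoidHom.mem_ker, MonoidHom.comp_apply, MonoidHom.mem_ker.mp hg, map_one]
  -- `T` does not act as a scalar, because it does not commute with `S`
  have hlow : ∀ M, 0 < M → CongruenceSubgroup.Gamma M ≤ ((QuotientGroup.mk' (Subgroup.center
      (LinearMap.GeneralLinearGroup ℂ V))).comp (levelTwo b)).ker → 2 ≤ M := by
    intro M hM hMle
    by_contra hlt
    obtain rfl : M = 1 := by omega
    rw [CongruenceSubgroup.Gamma_one_top] at hMle
    have h1 := hMle (Subgroup.mem_top ModularGroup.T)
    rw [MonoidHom.mem_ker, MonoidHom.comp_apply, QuotientGroup.mk'_apply,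
      QuotientGroup.eq_one_iff, Subgroup.mem_center_iff] at h1
    have h2 := congrArg (fun g : LinearMap.GeneralLinearGroup ℂ V => (g : V →ₗ[ℂ] V) (b 0))
      (h1 (levelTwo b ModularGroup.S))
    simp only [Units.val_mul, Module.End.mul_apply, levelTwo_S, levelTwo_T] at h2
    exact absurd (b.injective h2) (by decide)
  exact ⟨⟨⟨two_pos, Gamma_two_le_ker_levelTwo b⟩, fun M hM => hlow M hM.1 (hM.2.trans hle)⟩,
    ⟨⟨two_pos, (Gamma_two_le_ker_levelTwo b).trans hle⟩, fun M hM => hlow M hM.1 hM.2⟩⟩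

end permutation

end

section

/-! ### A basis of the Higman ideal permuted by the Lyubashenko–Majid maps -/

variable {n : ℕ}

/-- The elements `1 - c`, `v (1 - c)` and `2⁻ⁿ ω (1 + c)` of the Higman ideal. -/
def higmanVec (v : Dbl n) : Fin 3 → Dbl n :=
  ![1 - gc n, v * (1 - gc n), (2 ^ n : ℂ)⁻¹ • (om n * (1 + gc n))]

/-- The Lyubashenko–Majid map as a linear map. -/
def lmS (l : Dbl n →ₗ[ℂ] ℂ) : Dbl n →ₗ[ℂ] Dbl n :=
  (TensorProduct.rid ℂ (Dbl n)).toLinearMap ∘ₗ l.lTensor (Dbl n) ∘ₗ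
    LinearMap.mulRight ℂ (Ring.inverse (RMatrix₂₁ ℂ (NicholsAlgebra n))) ∘ₗ
    LinearMap.mulLeft ℂ (Ring.inverse (RMatrix ℂ (NicholsAlgebra n))) ∘ₗ
    TensorProduct.mk ℂ (Dbl n) (Dbl n) 1

theorem lmS_apply (l : Dbl n →ₗ[ℂ] ℂ) (x : Dbl n) : lmS l x = lyubashenkoMajidS l x := rfl

/-- The Lyubashenko–Majid map exchanges `1 - c` and `ω (1 + c)`, and preserves `ω (1 - c)`, up to
scalars. -/
theorem lmS_values {l : Dbl n →ₗ[ℂ] ℂ} (hl : IsCointegral l) (hn : 0 < n) (he : Even n) :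
    lmS l (1 - gc n) = (l (prodYX gx gy (List.finRange n)) / 2 / 2 ^ n) • (om n * (1 + gc n)) ∧
    lmS l (om n * (1 - gc n)) =
      (l (prodYX gx gy (List.finRange n)) / 2) • (om n * (1 - gc n)) ∧
    lmS l (om n * (1 + gc n)) =
      (2 ^ n * l (prodYX gx gy (List.finRange n)) / 2) • (1 - gc n) := by
  have h := doubleRel n
  have h1 := h.one_sub_c_comm
  have h2 := h.one_add_c_comm
  have hom : ∀ {z : Dbl n}, (∀ a, z * a = a * z) → ∀ a, om n * z * a = a * (om n * z) := by
    intro z hz a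
    rw [mul_assoc, hz, ← mul_assoc, om_comm, mul_assoc]
  rw [lmS_apply, lmS_apply, lmS_apply, lyubashenkoMajidS_eq ⟨0, hn⟩ l h1,
    lyubashenkoMajidS_eq ⟨0, hn⟩ l (hom h1), lyubashenkoMajidS_eq ⟨0, hn⟩ l (hom h2)]
  have hr := cointegralRel hl
  have hc := cointegral_prodYX_mul_c hl he
  exact ⟨hr.sMap_one_sub h he ⟨0, hn⟩ hc, hr.sMap_w_one_sub h ⟨0, hn⟩ hc,
    hr.sMap_w_one_add h he ⟨0, hn⟩ hc⟩

theorem lmS_higmanVec {l : Dbl n →ₗ[ℂ] ℂ} (hl : IsCointegral l) (hn : 0 < n) (he : Even n)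
    {Λ v : Dbl n} (hΛ : IsIntegral Λ) (hv : IsRibbon v) (i : Fin 3) :
    lmS l (higmanVec v i) =
      (l (prodYX gx gy (List.finRange n)) / 2) • higmanVec v (Equiv.swap 0 2 i) := by
  obtain ⟨h1, h2, h3⟩ := lmS_values hl hn he
  obtain ⟨b, hb⟩ := ribbon_mul_one_sub hl hn he hΛ hv
  have hp : (2 ^ n : ℂ) ≠ 0 := pow_ne_zero _ two_ne_zero
  fin_cases i
  · change lmS l (1 - gc n) = _ • ((2 ^ n : ℂ)⁻¹ • (om n * (1 + gc n)))
    rw [h1, smul_smul, div_eq_mul_inv _ ((2 : ℂ) ^ n)]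
  · change lmS l (v * (1 - gc n)) = _ • (v * (1 - gc n))
    rw [hb, map_smul, h2, smul_comm]
  · change lmS l ((2 ^ n : ℂ)⁻¹ • (om n * (1 + gc n))) = _ • (1 - gc n)
    rw [map_smul, h3, smul_smul, mul_div_assoc, inv_mul_cancel_left₀ hp]

theorem ribbon_mul_higmanVec {l : Dbl n →ₗ[ℂ] ℂ} (hl : IsCointegral l) (hn : 0 < n) (he : Even n)
    {Λ v : Dbl n} (hΛ : IsIntegral Λ) (hv : IsRibbon v) (i : Fin 3) :
    v * higmanVec v i = higmanVec v (Equiv.swap 0 1 i) := by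
  fin_cases i
  · rfl
  · exact ribbon_mul_ribbon_mul_one_sub hn he hv
  · change v * ((2 ^ n : ℂ)⁻¹ • (om n * (1 + gc n))) = (2 ^ n : ℂ)⁻¹ • (om n * (1 + gc n))
    rw [mul_smul_comm, ribbon_mul_om_one_add hl hn hΛ hv]

theorem ribbon_mul_one_sub_ne_zero {l : Dbl n →ₗ[ℂ] ℂ} (hl : IsCointegral l) (hn : 0 < n)
    (he : Even n) {v : Dbl n} (hv : IsRibbon v) : v * (1 - gc n) ≠ 0 := by
  intro h0
  apply one_sub_gc_ne_zero hl he
  rw [← ribbon_mul_ribbon_mul_one_sub hn he hv, h0, mul_zero]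

theorem linearIndependent_higmanVec {l : Dbl n →ₗ[ℂ] ℂ} (hl : IsCointegral l) (hn : 0 < n)
    (he : Even n) {Λ v : Dbl n} (hΛ : IsIntegral Λ) (hv : IsRibbon v) :
    LinearIndependent ℂ (higmanVec v) := by
  have h := doubleRel n
  obtain ⟨b, hb⟩ := ribbon_mul_one_sub hl hn he hΛ hv
  have hp : (2 ^ n : ℂ) ≠ 0 := pow_ne_zero _ two_ne_zero
  have hE1 := one_sub_gc_ne_zero hl he
  have hE2 := ribbon_mul_one_sub_ne_zero hl hn he hv
  have hE3 : om n * (1 + gc n) ≠ 0 := by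
    intro h0
    have h1 := (lmS_values hl hn he).2.2
    rw [h0, map_zero] at h1
    refine smul_ne_zero (div_ne_zero (mul_ne_zero hp (cointegral_prodYX_ne_zero hl he))
      two_ne_zero) hE1 h1.symm
  rw [Fintype.linearIndependent_iff]
  intro g hg
  rw [Fin.sum_univ_three] at hg
  change g 0 • (1 - gc n) + g 1 • (v * (1 - gc n)) +
    g 2 • ((2 ^ n : ℂ)⁻¹ • (om n * (1 + gc n))) = 0 at hg
  have h2 : g 2 = 0 := by
    have h3 := congrArg (· * (1 + gc n)) hg
    have e1 : (1 - gc n) * (1 + gc n) = 0 := by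
      rw [← h.one_add_c_comm, h.one_add_mul_one_sub]
    beta_reduce at h3
    rw [add_mul, add_mul, smul_mul_assoc, smul_mul_assoc, smul_mul_assoc, smul_mul_assoc,
      mul_assoc v, e1, mul_zero, smul_zero, smul_zero, zero_add, zero_add, zero_mul,
      om_mul_one_add_mul_one_add] at h3
    simpa [hp, hE3] using h3
  rw [h2, zero_smul, add_zero] at hg
  -- the coproduct tells `1 - c` from `ω (1 - c)`
  have h4 : g 0 • (1 - gc n) - g 1 • (v * (1 - gc n)) = 0 := by
    obtain ⟨⟨hKX, hcX, -⟩, hX⟩ := mul_oddSocle hl hn hΛ hv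
    obtain ⟨e1, e2⟩ := comulD_mul_one_tmul hKX hcX hX
    have e3 : comulD (v * (1 - gc n)) * (1 ⊗ₜ oddSocle n) =
        -((v * (1 - gc n)) ⊗ₜ oddSocle n) := by
      rw [hb, map_smul, smul_mul_assoc, e2, smul_neg, smul_tmul']
    have h5 := congrArg (fun z => sliceRight l (comulD z * (1 ⊗ₜ oddSocle n))) hg
    beta_reduce at h5
    rw [map_add, map_smul, map_smul, add_mul, smul_mul_assoc, smul_mul_assoc, e1, e3, map_add,
      map_smul, map_smul, map_neg, sliceRight_tmul, sliceRight_tmul, map_zero, zero_mul,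
      map_zero] at h5
    have h6 : l (oddSocle n) • (g 0 • (1 - gc n) - g 1 • (v * (1 - gc n))) = 0 := by
      rw [← h5]
      module
    exact (smul_eq_zero.mp h6).resolve_left (cointegral_oddSocle_ne_zero hl he)
  have h0 : g 0 = 0 := by
    have h5 : (2 * g 0) • (1 - gc n) = 0 := by
      calc (2 * g 0) • (1 - gc n) = (g 0 • (1 - gc n) + g 1 • (v * (1 - gc n))) +
            (g 0 • (1 - gc n) - g 1 • (v * (1 - gc n))) := by module
        _ = 0 := by rw [hg, h4, add_zero]
    simpa [hE1] using h5
  have h1 : g 1 = 0 := by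
    rw [h0, zero_smul, zero_add] at hg
    exact (smul_eq_zero.mp hg).resolve_right hE2
  intro i
  fin_cases i
  exacts [h0, h1, h2]

theorem span_higmanVec {l : Dbl n →ₗ[ℂ] ℂ} (hl : IsCointegral l) (hn : 0 < n) (he : Even n)
    {Λ v : Dbl n} (hΛ : IsIntegral Λ) (hv : IsRibbon v) :
    Submodule.span ℂ (Set.range (higmanVec v)) =
      higmanSpan (gK n) (gc n) gx gy (List.finRange n) := by
  obtain ⟨b, hb⟩ := ribbon_mul_one_sub hl hn he hΛ hv
  have hp : (2 ^ n : ℂ) ≠ 0 := pow_ne_zero _ two_ne_zero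
  have hb0 : b ≠ 0 := by
    rintro rfl
    exact ribbon_mul_one_sub_ne_zero hl hn he hv (by rw [hb, zero_smul])
  apply le_antisymm
  · rw [Submodule.span_le]
    rintro _ ⟨i, rfl⟩
    fin_cases i
    · exact one_sub_gc_mem
    · exact central_mul_mem hn hv.central one_sub_gc_mem
    · exact Submodule.smul_mem _ _ om_mul_mem.2
  · have hmem : ∀ i, higmanVec v i ∈ Submodule.span ℂ (Set.range (higmanVec v)) :=
      fun i => Submodule.subset_span ⟨i, rfl⟩
    have h2 : om n * (1 - gc n) ∈ Submodule.span ℂ (Set.range (higmanVec v)) := by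
      have : om n * (1 - gc n) = b⁻¹ • higmanVec v 1 := by
        change _ = b⁻¹ • (v * (1 - gc n))
        rw [hb, smul_smul, inv_mul_cancel₀ hb0, one_smul]
      rw [this]
      exact Submodule.smul_mem _ _ (hmem 1)
    have h3 : om n * (1 + gc n) ∈ Submodule.span ℂ (Set.range (higmanVec v)) := by
      have : om n * (1 + gc n) = (2 ^ n : ℂ) • higmanVec v 2 := by
        change _ = (2 ^ n : ℂ) • ((2 ^ n : ℂ)⁻¹ • (om n * (1 + gc n)))
        rw [smul_smul, mul_inv_cancel₀ hp, one_smul]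
      rw [this]
      exact Submodule.smul_mem _ _ (hmem 2)
    rw [higmanSpan, Submodule.span_le]
    rintro z (rfl | rfl | rfl)
    · exact hmem 0
    · have : gK n * prodW gx gy (List.finRange n) =
          (1 / 2 : ℂ) • (om n * (1 - gc n) + om n * (1 + gc n)) := by
        rw [← om, mul_sub, mul_add, mul_one]
        module
      rw [this]
      exact Submodule.smul_mem _ _ (Submodule.add_mem _ h2 h3)
    · have : gc n * (gK n * prodW gx gy (List.finRange n)) =
          (1 / 2 : ℂ) • (om n * (1 + gc n) - om n * (1 - gc n)) := by
        rw [← om, gc_comm, mul_sub, mul_add, mul_one]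
        module
      rw [this]
      exact Submodule.smul_mem _ _ (Submodule.sub_mem _ h3 h2)

/-- A basis of the Higman ideal on which `S_LM` acts, up to a scalar, by the transposition of the
outer two vectors and `T_LM` by the transposition of the first two. -/
theorem exists_basis_Higman {l : Dbl n →ₗ[ℂ] ℂ} (hl : IsCointegral l) (hn : 0 < n) (he : Even n)
    {Λ v : Dbl n} (hΛ : IsIntegral Λ) (hv : IsRibbon v) {G : (Dbl n)ˣ}
    (hG : ImplementsAntipodeSq G) :
    ∃ b : Module.Basis (Fin 3) ℂ (Higman Λ G), ∀ i, (b i : Dbl n) = higmanVec v i := by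
  have h : Higman Λ G = Submodule.span ℂ (Set.range (higmanVec v)) := by
    rw [span_higmanVec hl hn he hΛ hv, higman_eq hl hn hΛ hG]
  rw [h]
  exact ⟨Module.Basis.span (linearIndependent_higmanVec hl hn he hΛ hv),
    fun i => congrArg Subtype.val (Module.Basis.span_apply _ i)⟩

end

end NicholsDouble

end

open NicholsDouble in
theorem mainTheorem5 (n : ℕ) (hn : 0 < n) (heven : Even n)
    (Λ : DrinfeldDouble ℂ (NicholsAlgebra n)) (hΛ : DrinfeldDouble.IsIntegral Λ)
    (l : DrinfeldDouble ℂ (NicholsAlgebra n) →ₗ[ℂ] ℂ) (hl : DrinfeldDouble.IsCointegral l)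
    (v : DrinfeldDouble ℂ (NicholsAlgebra n)) (hv : DrinfeldDouble.IsRibbon v)
    (G : (DrinfeldDouble ℂ (NicholsAlgebra n))ˣ) (hG : DrinfeldDouble.ImplementsAntipodeSq G) :
    (∃ ρ : Matrix.SpecialLinearGroup (Fin 2) ℤ →*
        LinearMap.GeneralLinearGroup ℂ (DrinfeldDouble.Higman Λ G),
      DrinfeldDouble.IsLyubashenkoMajid l v Λ G ρ) ∧
    ∀ ρ : Matrix.SpecialLinearGroup (Fin 2) ℤ →*
        LinearMap.GeneralLinearGroup ℂ (DrinfeldDouble.Higman Λ G),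
      DrinfeldDouble.IsLyubashenkoMajid l v Λ G ρ →
        IsCongruenceOfLevel ρ.ker 2 ∧
        IsCongruenceOfLevel
          ((QuotientGroup.mk' (Subgroup.center
            (LinearMap.GeneralLinearGroup ℂ (DrinfeldDouble.Higman Λ G)))).comp ρ).ker 2 := by
  obtain ⟨b, hb⟩ := exists_basis_Higman hl hn heven hΛ hv hG
  have hL := cointegral_prodYX_ne_zero hl heven
  have hS := lmS_higmanVec hl hn heven hΛ hv
  have hT := ribbon_mul_higmanVec hl hn heven hΛ hv
  generalize l (prodYX gx gy (List.finRange n)) = L at hL hS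
  have hL2 : L / 2 ≠ 0 := div_ne_zero hL two_ne_zero
  constructor
  · refine ⟨levelTwo b, ⟨(L / 2)⁻¹, inv_ne_zero hL2, ?_⟩, ?_⟩
    · have h : (DrinfeldDouble.Higman Λ G).subtype ∘ₗ
          (levelTwo b ModularGroup.S : _ →ₗ[ℂ] _) =
          (L / 2)⁻¹ • lmS l ∘ₗ (DrinfeldDouble.Higman Λ G).subtype := by
        refine b.ext fun i => ?_
        rw [LinearMap.comp_apply, levelTwo_S, LinearMap.smul_apply, LinearMap.comp_apply,
          Submodule.subtype_apply, Submodule.subtype_apply, hb, hb, hS, smul_smul,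
          inv_mul_cancel₀ hL2, one_smul]
      exact LinearMap.congr_fun h
    · have h : (DrinfeldDouble.Higman Λ G).subtype ∘ₗ
          (levelTwo b ModularGroup.T : _ →ₗ[ℂ] _) =
          LinearMap.mulLeft ℂ v ∘ₗ (DrinfeldDouble.Higman Λ G).subtype := by
        refine b.ext fun i => ?_
        rw [LinearMap.comp_apply, levelTwo_T, LinearMap.comp_apply, LinearMap.mulLeft_apply,
          Submodule.subtype_apply, Submodule.subtype_apply, hb, hb, hT]
      exact LinearMap.congr_fun h
  · rintro ρ ⟨⟨c, hc, hρS⟩, hρT⟩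
    have h : ρ = levelTwo b := by
      refine eq_levelTwo b ρ (mul_ne_zero hc hL2) (fun i => ?_) fun i => ?_
      · apply Subtype.ext
        rw [hρS, ← lmS_apply, Submodule.coe_smul, hb, hb, hS, smul_smul]
      · apply Subtype.ext
        rw [hρT, hb, hb, hT]
    rw [h]
    exact isCongruenceOfLevel_levelTwo b
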